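/- A weighted tree $T$ is a finite tree with non-negative real edge lengths; $d$ denotes its tree metric (sum of the edge lengths on the unique simple path). An instance $\mathcal I$ of the min-max $r$-gathering problem on a tree consists of a weighted tree $T$, a finite non-empty set $\mathcal U$ of users and a finite set $\mathcal F$ of facilities, all located at vertices of $T$ (several may share a vertex), and an integer $r\ge 0$. A solution is a set of opened facilities together with an assignment of every user to an opened facility such that every opened facility has at least $r$ users; its cost is the maximum distance between a user and the facility it is assigned to. $\mathrm{OPT}(\mathcal I)$ is the minimum cost of a solution. Theorem. There are a single algorithm and a constant $C$ such that, for every instance $\mathcal I$ that has a solution (the tree being given by an arbitrary list of its edges) and every real $\varepsilon>0$, the algorithm on input $(\mathcal I,\varepsilon)$ halts and outputs a solution of cost at most $(1+\varepsilon)\,\mathrm{OPT}(\mathcal I)$, after at most $$|V(T)|^{C}\cdot(|\mathcal U|+|\mathcal F|)^{C\max(1,1/\varepsilon)}$$ steps. In particular, for trees with $|V(T)|=O(|\mathcal U|+|\mathcal F|)$ the running time is $(|\mathcal U|+|\mathcal F|)^{O(1/\varepsilon)}$ (where $O(1/\varepsilon)$ is read as $O(1)$ for $\varepsilon\ge 1$).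 Here an algorithm is a program of a random access machine with natural-number and real registers, organised in finitely many arrays, with indirect addressing, in which each assignment and each test counts as one step. Its operations are addition, subtraction and comparison (of natural numbers, with truncated subtraction, and of real numbers, with $0$ and $1$ as the only real constants); it has no multiplication, division, rounding or conversion between the two sorts. The edge lengths and $\varepsilon$ are given in real registers, so the step bound does not depend on their size (the algorithm is strongly polynomial for fixed $\varepsilon$). -/

import Mathlib

namespace RGathering

/-! ### The min-max r-gathering problem on a weighted tree -/

/-- A weighted tree: an undirected connected acyclic graph with non-negative edge lengths
(the values of `length` off the edges are never used). -/
structure WeightedTree (V : Type*) where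
  graph : SimpleGraph V
  isTree : graph.IsTree
  length : Sym2 V → ℝ
  length_nonneg : ∀ e ∈ graph.edgeSet, 0 ≤ length e

/-- The tree metric: the sum of the edge lengths on the unique simple path from `v` to `w`. -/
noncomputable def WeightedTree.dist {V : Type*} (T : WeightedTree V) (v w : V) : ℝ :=
  ((T.isTree.existsUnique_path v w).choose.edges.map T.length).sum

/-- An instance of the problem: users and facilities (indexed by `U` and `F`) located at vertices
of a weighted tree (several may share a vertex), and the number `r`. -/
structure Instance (V U F : Type*) where
  tree : WeightedTree V
  user : U → V
  facility : F → V
  r : ℕ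

/-- A solution: a set of opened facilities and an assignment of every user to an opened facility
such that every opened facility has at least `r` users. -/
structure Solution {V U F : Type*} (I : Instance V U F) where
  opened : Set F
  assign : U → F
  assign_mem : ∀ u, assign u ∈ opened
  r_le : ∀ f ∈ opened, I.r ≤ {u | assign u = f}.ncard

/-- The maximum distance between a user and the facility that the user is assigned to. -/
noncomputable def Solution.cost {V U F : Type*} {I : Instance V U F} (S : Solution I) : ℝ :=
  ⨆ u, I.tree.dist (I.user u) (I.facility (S.assign u))

/-- The optimal value of an instance (meaningful if the instance has a solution). -/
noncomputable def Instance.opt {V U F : Type*} (I : Instance V U F) : ℝ :=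
  ⨅ S : Solution I, S.cost

/-! ### Random access machine programs with real registers, and their running time

A program works on finitely many one-dimensional arrays of natural numbers and of real numbers
(the arrays are named by numerals, which are constants of the program; indices are computed).
The operations are addition, (truncated) subtraction and comparison, on natural numbers and on
real numbers. There is no multiplication, division or rounding, no real constant but `0` and `1`,
and no conversion between the two sorts. -/

/-- The memory. -/
structure Store where
  nat : ℕ → ℕ → ℕ
  real : ℕ → ℕ → ℝ

/-- Expressions for natural numbers; `get A i` is the entry of array `A` at index `i`. -/
inductive NExpr : Type
  | const (k : ℕ)
  | get (A : ℕ) (i : NExpr)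
  | add (a b : NExpr)
  | sub (a b : NExpr)

/-- Expressions for real numbers; `get A i` is the entry of array `A` at index `i`. -/
inductive RExpr : Type
  | zero
  | one
  | get (A : ℕ) (i : NExpr)
  | add (a b : RExpr)
  | sub (a b : RExpr)

/-- Comparisons. -/
inductive Test : Type
  | natLe (a b : NExpr)
  | realLe (a b : RExpr)

/-- Programs. -/
inductive Prog : Type
  | skip
  | setNat (A : ℕ) (i : NExpr) (a : NExpr)
  | setReal (A : ℕ) (i : NExpr) (a : RExpr)
  | seq (p q : Prog)
  | ite (t : Test) (p q : Prog)
  | loop (t : Test) (p : Prog)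

def NExpr.eval (s : Store) : NExpr → ℕ
  | const k => k
  | get A i => s.nat A (i.eval s)
  | add a b => a.eval s + b.eval s
  | sub a b => a.eval s - b.eval s

noncomputable def RExpr.eval (s : Store) : RExpr → ℝ
  | zero => 0
  | one => 1
  | get A i => s.real A (i.eval s)
  | add a b => a.eval s + b.eval s
  | sub a b => a.eval s - b.eval s

def Test.Holds (s : Store) : Test → Prop
  | natLe a b => a.eval s ≤ b.eval s
  | realLe a b => a.eval s ≤ b.eval s

/-- Write `x` into the natural number array `A` at index `i`. -/
def Store.writeNat (s : Store) (A i x : ℕ) : Store where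
  nat := fun B j => if B = A ∧ j = i then x else s.nat B j
  real := s.real

/-- Write `x` into the real array `A` at index `i`. -/
noncomputable def Store.writeReal (s : Store) (A i : ℕ) (x : ℝ) : Store where
  nat := s.nat
  real := fun B j => if B = A ∧ j = i then x else s.real B j

/-- `Exec p s n s'`: started in memory `s`, the program `p` halts after `n` steps in memory `s'`.
Every assignment, every `skip` and every evaluation of a test is one step (the expressions in a
fixed program have bounded size, so this is the number of elementary operations up to a constant
factor that depends only on the program). For given `p` and `s` there is at most one pair `n`, `s'`:
`loop t p` repeats `p` as long as `t` holds, and everything else is a deterministic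
instruction. -/
inductive Exec : Prog → Store → ℕ → Store → Prop
  | skip (s : Store) : Exec .skip s 1 s
  | setNat (s : Store) (A : ℕ) (i a : NExpr) :
      Exec (.setNat A i a) s 1 (s.writeNat A (i.eval s) (a.eval s))
  | setReal (s : Store) (A : ℕ) (i : NExpr) (a : RExpr) :
      Exec (.setReal A i a) s 1 (s.writeReal A (i.eval s) (a.eval s))
  | seq {p q : Prog} {s s' s'' : Store} {m n : ℕ} :
      Exec p s m s' → Exec q s' n s'' → Exec (.seq p q) s (m + n) s''
  | ite_true {t : Test} {p q : Prog} {s s' : Store} {n : ℕ} :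
      t.Holds s → Exec p s n s' → Exec (.ite t p q) s (n + 1) s'
  | ite_false {t : Test} {p q : Prog} {s s' : Store} {n : ℕ} :
      ¬ t.Holds s → Exec q s n s' → Exec (.ite t p q) s (n + 1) s'
  | loop_true {t : Test} {p : Prog} {s s' s'' : Store} {m n : ℕ} :
      t.Holds s → Exec p s m s' → Exec (.loop t p) s' n s'' →
        Exec (.loop t p) s (m + n + 1) s''
  | loop_false {t : Test} {p : Prog} {s : Store} :
      ¬ t.Holds s → Exec (.loop t p) s 1 s

/-! ### Input and output -/

/-- A list of the edges of a graph, each edge occurring exactly once, with either orientation. -/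
structure EdgeList {V : Type*} (G : SimpleGraph V) (k : ℕ) where
  src : Fin k → V
  dst : Fin k → V
  injective : Function.Injective fun i => s(src i, dst i)
  range_eq : Set.range (fun i => s(src i, dst i)) = G.edgeSet

/-- The array with entries `a 0, …, a (k - 1)`, filled up with zeros. -/
def toArray {α : Type*} [Zero α] {k : ℕ} (a : Fin k → α) (i : ℕ) : α :=
  if h : i < k then a ⟨i, h⟩ else 0

/-- The initial memory for an instance with vertices `Fin nV`, users `Fin nU` and facilities
`Fin nF`, given with a list of the `nE` edges of the tree, and for the accuracy `ε`. Number array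
`0` holds the sizes and `r`, arrays `1` and `2` the ends of the edges, arrays `3` and `4` the
locations of the users and of the facilities; real array `0` holds `ε`, and real array `1` the edge
lengths. All other entries are zero. -/
def input {nV nE nU nF : ℕ} (I : Instance (Fin nV) (Fin nU) (Fin nF))
    (E : EdgeList I.tree.graph nE) (ε : ℝ) : Store where
  nat
    | 0 => toArray ![nV, nE, nU, nF, I.r]
    | 1 => toArray fun i => (E.src i : ℕ)
    | 2 => toArray fun i => (E.dst i : ℕ)
    | 3 => toArray fun u => (I.user u : ℕ)
    | 4 => toArray fun f => (I.facility f : ℕ)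
    | _ => fun _ => 0
  real
    | 0 => toArray ![ε]
    | 1 => toArray fun i => I.tree.length s(E.src i, E.dst i)
    | _ => fun _ => 0

/-- The memory `s` holds the solution `S` as output: number array `5` holds the assignment, and
number array `6` marks the opened facilities by `1` and the others by `0`. -/
def Store.Outputs {nV nU nF : ℕ} {I : Instance (Fin nV) (Fin nU) (Fin nF)} (s : Store)
    (S : Solution I) : Prop :=
  (∀ u : Fin nU, s.nat 5 u = (S.assign u : ℕ)) ∧
    ∀ f : Fin nF, (f ∈ S.opened → s.nat 6 f = 1) ∧ (f ∉ S.opened → s.nat 6 f = 0)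

end RGathering

set_option linter.unusedSimpArgs false

namespace RGathering

/-! ### A weakest-precondition calculus with time bounds -/

/-! The optimum is the distance of some user and some facility, hence of the form `dep u + dep f - 2
* dep a` with `a` a common ancestor in the rooted tree. The algorithm tries this number for all
triples `(a, u, f)`, whether `a` is an ancestor or not, as a threshold `b ≥ 0`. For each `b` it
either produces a solution of cost at most `(1 + 4/K) * b` or certifies that no solution of cost at
most `b` exists, where `K = ⌊4/ε⌋ + 1`, so that `4/K < ε`. The best threshold that succeeds is at
most the cost of every solution.

For a fixed `b`, depths are multiplied by `K` (nothing can be divided), so the threshold becomes `B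
= K * b`. The items (users and facilities) are grouped by a greedy net into classes of radius `b` in
scaled depth, users and facilities apart. A dynamic program runs bottom-up over parts of the tree
that are merged two at a time. Each facility guesses in advance its number of users, either `0` or
at least `r`, and then carries that many open slots. A user and a slot are matched in a part whose
top is a common ancestor of both; whether they may be matched depends only on their classes and on
the top.

Completeness (`Scheme.exists_complete`): a state matters only through the number of pending items in
each class, because items of one class can be exchanged; and if exactly one end of a pair lies in a
part, all common ancestors of the pair are above the top of the part (`anc_top`), so measuring
through the top underestimates the distance (`Scheme.Geo.target`). Rounding two depths costs `2 *
b`, which the test tolerates. Soundness (`Scheme.Der.valid`, `Scheme.Geo.close_of_allow`): undoing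
the rounding costs another `2 * b`, which gives `B + 4 * b`.

Counting (`Scheme.card_le`, `Scheme.Geo.card_le`): pending items deeper than about `B` below the top
are useless, so the relevant class centres lie in an interval of length `(K + 2) * b`, and there are
at most `2 * (K + 3)` of them. Hence each part has at most `(n * nU + 1) ^ (2 * (K + 3))`
inequivalent states, and computing the closure under the rules takes time polynomial in the total
number of states.

The rest transfers this to the machine: a calculus of weakest preconditions with step bounds, in
which every bound is a power of one number `Z`. -/

instance (k : ℕ) : OfNat NExpr k := ⟨.const k⟩
instance : Add NExpr := ⟨.add⟩
instance : Sub NExpr := ⟨.sub⟩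
instance : Add RExpr := ⟨.add⟩
instance : Sub RExpr := ⟨.sub⟩

infixr:30 " ;; " => Prog.seq

@[simp] theorem NExpr.eval_ofNat (s : Store) (k : ℕ) :
    NExpr.eval s (no_index (OfNat.ofNat k)) = k := rfl
@[simp] theorem NExpr.eval_const (s : Store) (k : ℕ) : (NExpr.const k).eval s = k := rfl
@[simp] theorem NExpr.eval_get (s : Store) (A : ℕ) (i : NExpr) :
    (NExpr.get A i).eval s = s.nat A (i.eval s) := rfl
@[simp] theorem NExpr.eval_add (s : Store) (a b : NExpr) : (a + b).eval s = a.eval s + b.eval s :=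
  rfl
@[simp] theorem NExpr.eval_sub (s : Store) (a b : NExpr) : (a - b).eval s = a.eval s - b.eval s :=
  rfl
@[simp] theorem RExpr.eval_zero (s : Store) : RExpr.zero.eval s = 0 := rfl
@[simp] theorem RExpr.eval_one (s : Store) : RExpr.one.eval s = 1 := rfl
@[simp] theorem RExpr.eval_get (s : Store) (A : ℕ) (i : NExpr) :
    (RExpr.get A i).eval s = s.real A (i.eval s) := rfl
@[simp] theorem RExpr.eval_add (s : Store) (a b : RExpr) : (a + b).eval s = a.eval s + b.eval s :=
  rfl
@[simp] theorem RExpr.eval_sub (s : Store) (a b : RExpr) : (a - b).eval s = a.eval s - b.eval s :=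
  rfl
@[simp] theorem Test.holds_natLe (s : Store) (a b : NExpr) :
    (Test.natLe a b).Holds s ↔ a.eval s ≤ b.eval s := Iff.rfl
@[simp] theorem Test.holds_realLe (s : Store) (a b : RExpr) :
    (Test.realLe a b).Holds s ↔ a.eval s ≤ b.eval s := Iff.rfl

@[simp] theorem Store.nat_writeNat (s : Store) (A i x B j : ℕ) :
    (s.writeNat A i x).nat B j = if B = A ∧ j = i then x else s.nat B j := rfl
@[simp] theorem Store.real_writeNat (s : Store) (A i x : ℕ) : (s.writeNat A i x).real = s.real := rfl
@[simp] theorem Store.real_writeReal (s : Store) (A i : ℕ) (x : ℝ) (B j : ℕ) :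
    (s.writeReal A i x).real B j = if B = A ∧ j = i then x else s.real B j := rfl
@[simp] theorem Store.nat_writeReal (s : Store) (A i : ℕ) (x : ℝ) :
    (s.writeReal A i x).nat = s.nat := rfl

theorem Store.nat_writeNat_of_ne (s : Store) {A B : ℕ} (h : B ≠ A) (i x : ℕ) :
    (s.writeNat A i x).nat B = s.nat B := by
  funext j; simp [h]

theorem Store.real_writeReal_of_ne (s : Store) {A B : ℕ} (h : B ≠ A) (i : ℕ) (x : ℝ) :
    (s.writeReal A i x).real B = s.real B := by
  funext j; simp [h]

/-- The arrays of numbers that a program may write to. -/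
def Prog.writesNat : Prog → ℕ → Bool
  | skip, _ => false
  | setNat A _ _, B => A == B
  | setReal _ _ _, _ => false
  | seq p q, B => p.writesNat B || q.writesNat B
  | ite _ p q, B => p.writesNat B || q.writesNat B
  | loop _ p, B => p.writesNat B

/-- The arrays of reals that a program may write to. -/
def Prog.writesReal : Prog → ℕ → Bool
  | skip, _ => false
  | setNat _ _ _, _ => false
  | setReal A _ _, B => A == B
  | seq p q, B => p.writesReal B || q.writesReal B
  | ite _ p q, B => p.writesReal B || q.writesReal B
  | loop _ p, B => p.writesReal B

/-- The stores `s` and `s'` agree on the arrays that `p` does not write to. -/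
structure Frame (p : Prog) (s s' : Store) : Prop where
  nat : ∀ A, p.writesNat A = false → s'.nat A = s.nat A
  real : ∀ A, p.writesReal A = false → s'.real A = s.real A

/-- This makes the proofs about programs modular: which arrays a program may write to is computed
from its syntax, so preservation of any other array is proved by `rfl`. -/
theorem Exec.frame {p : Prog} {s s' : Store} {n : ℕ} (h : Exec p s n s') : Frame p s s' := by
  induction h with
  | skip s => exact ⟨fun _ _ => rfl, fun _ _ => rfl⟩
  | setNat s A i a =>
    refine ⟨fun B hB => ?_, fun _ _ => rfl⟩
    have : B ≠ A := fun e => by simp [Prog.writesNat, e] at hB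
    exact s.nat_writeNat_of_ne this _ _
  | setReal s A i a =>
    refine ⟨fun _ _ => rfl, fun B hB => ?_⟩
    have : B ≠ A := fun e => by simp [Prog.writesReal, e] at hB
    exact s.real_writeReal_of_ne this _ _
  | seq _ _ ih1 ih2 =>
    refine ⟨fun B hB => ?_, fun B hB => ?_⟩
    · simp only [Prog.writesNat, Bool.or_eq_false_iff] at hB
      rw [ih2.nat B hB.2, ih1.nat B hB.1]
    · simp only [Prog.writesReal, Bool.or_eq_false_iff] at hB
      rw [ih2.real B hB.2, ih1.real B hB.1]
  | ite_true _ _ ih =>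
    refine ⟨fun B hB => ?_, fun B hB => ?_⟩
    · simp only [Prog.writesNat, Bool.or_eq_false_iff] at hB
      exact ih.nat B hB.1
    · simp only [Prog.writesReal, Bool.or_eq_false_iff] at hB
      exact ih.real B hB.1
  | ite_false _ _ ih =>
    refine ⟨fun B hB => ?_, fun B hB => ?_⟩
    · simp only [Prog.writesNat, Bool.or_eq_false_iff] at hB
      exact ih.nat B hB.2
    · simp only [Prog.writesReal, Bool.or_eq_false_iff] at hB
      exact ih.real B hB.2
  | loop_true _ _ _ ih1 ih2 =>
    exact ⟨fun B hB => (ih2.nat B hB).trans (ih1.nat B hB),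
      fun B hB => (ih2.real B hB).trans (ih1.real B hB)⟩
  | loop_false _ => exact ⟨fun _ _ => rfl, fun _ _ => rfl⟩

theorem Frame.refl (p : Prog) (s : Store) : Frame p s s := ⟨fun _ _ => rfl, fun _ _ => rfl⟩

theorem Frame.trans {p : Prog} {s s' s'' : Store} (h : Frame p s s') (h' : Frame p s' s'') :
    Frame p s s'' :=
  ⟨fun A hA => (h'.nat A hA).trans (h.nat A hA), fun A hA => (h'.real A hA).trans (h.real A hA)⟩

/-- Started in `s`, the program `p` halts within `T` steps in a store that satisfies `Q`. -/
def WP (p : Prog) (s : Store) (T : ℕ) (Q : Store → Prop) : Prop :=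
  ∃ n s', Exec p s n s' ∧ n ≤ T ∧ Q s'

theorem WP.mono {p : Prog} {s : Store} {T T' : ℕ} {Q Q' : Store → Prop} (h : WP p s T Q)
    (hT : T ≤ T') (hQ : ∀ s', Frame p s s' → Q s' → Q' s') : WP p s T' Q' := by
  obtain ⟨n, s', he, hn, hq⟩ := h
  exact ⟨n, s', he, hn.trans hT, hQ s' he.frame hq⟩

theorem WP.seq {p q : Prog} {s : Store} {T₁ T₂ : ℕ} {R Q : Store → Prop} (hp : WP p s T₁ R)
    (hq : ∀ s', Frame p s s' → R s' → WP q s' T₂ Q) : WP (p ;; q) s (T₁ + T₂) Q := by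
  obtain ⟨n, s', he, hn, hr⟩ := hp
  obtain ⟨m, s'', he', hm, hq'⟩ := hq s' he.frame hr
  exact ⟨n + m, s'', he.seq he', by omega, hq'⟩

theorem WP.skip {s : Store} {Q : Store → Prop} (h : Q s) : WP .skip s 1 Q :=
  ⟨1, s, .skip s, le_rfl, h⟩

theorem WP.ite {t : Test} {p q : Prog} {s : Store} {T : ℕ} {Q : Store → Prop}
    (hp : t.Holds s → WP p s T Q) (hq : ¬ t.Holds s → WP q s T Q) :
    WP (.ite t p q) s (T + 1) Q := by
  by_cases h : t.Holds s
  · obtain ⟨n, s', he, hn, hr⟩ := hp h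
    exact ⟨n + 1, s', .ite_true h he, by omega, hr⟩
  · obtain ⟨n, s', he, hn, hr⟩ := hq h
    exact ⟨n + 1, s', .ite_false h he, by omega, hr⟩

/-- `if t then p`. -/
def Prog.when (t : Test) (p : Prog) : Prog := .ite t p .skip

/-- `if a = b then p`. -/
def Prog.whenEq (a b : NExpr) (p : Prog) : Prog := .when (.natLe a b) (.when (.natLe b a) p)

theorem WP.when {t : Test} {p : Prog} {s : Store} {T : ℕ} {Q : Store → Prop}
    (hp : t.Holds s → WP p s T Q) (hq : ¬ t.Holds s → Q s) : WP (.when t p) s (T + 2) Q :=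
  (WP.ite (T := T + 1) (fun h => (hp h).mono (by omega) fun _ _ h => h)
    fun h => (WP.skip (hq h)).mono (by omega) fun _ _ h => h)

theorem WP.whenEq {a b : NExpr} {p : Prog} {s : Store} {T : ℕ} {Q : Store → Prop}
    (hp : a.eval s = b.eval s → WP p s T Q) (hq : a.eval s ≠ b.eval s → Q s) :
    WP (.whenEq a b p) s (T + 4) Q := by
  refine WP.when (fun h => WP.when (fun h' => hp (le_antisymm h h')) fun h' => hq ?_) fun h => hq ?_
  · exact fun e => h' e.ge
  · exact fun e => h e.le

/-- The result of a program without loops. -/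
noncomputable def Prog.run : Prog → Store → Store
  | skip, s => s
  | setNat A i a, s => s.writeNat A (i.eval s) (a.eval s)
  | setReal A i a, s => s.writeReal A (i.eval s) (a.eval s)
  | seq p q, s => q.run (p.run s)
  | ite t p q, s => open Classical in if t.Holds s then p.run s else q.run s
  | loop _ _, s => s

def Prog.loopFree : Prog → Bool
  | seq p q => p.loopFree && q.loopFree
  | ite _ p q => p.loopFree && q.loopFree
  | loop _ _ => false
  | _ => true

def Prog.size : Prog → ℕ
  | seq p q => p.size + q.size
  | ite _ p q => p.size + q.size + 1
  | _ => 1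

theorem Prog.exec_run {p : Prog} (h : p.loopFree = true) (s : Store) :
    ∃ n ≤ p.size, Exec p s n (p.run s) := by
  induction p generalizing s with
  | skip => exact ⟨1, le_rfl, .skip s⟩
  | setNat A i a => exact ⟨1, le_rfl, .setNat s A i a⟩
  | setReal A i a => exact ⟨1, le_rfl, .setReal s A i a⟩
  | seq p q ihp ihq =>
    simp only [Prog.loopFree, Bool.and_eq_true] at h
    obtain ⟨n, hn, he⟩ := ihp h.1 s
    obtain ⟨m, hm, he'⟩ := ihq h.2 (p.run s)
    exact ⟨n + m, by simp only [Prog.size]; omega, he.seq he'⟩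
  | ite t p q ihp ihq =>
    simp only [Prog.loopFree, Bool.and_eq_true] at h
    by_cases ht : t.Holds s
    · obtain ⟨n, hn, he⟩ := ihp h.1 s
      exact ⟨n + 1, by simp only [Prog.size]; omega, by
        simpa only [Prog.run, if_pos ht] using Exec.ite_true ht he⟩
    · obtain ⟨n, hn, he⟩ := ihq h.2 s
      exact ⟨n + 1, by simp only [Prog.size]; omega, by
        simpa only [Prog.run, if_neg ht] using Exec.ite_false ht he⟩
  | loop t p _ => simp [Prog.loopFree] at h

theorem WP.run {p : Prog} {s : Store} {T : ℕ} {Q : Store → Prop} (h : p.loopFree = true)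
    (hT : p.size ≤ T) (hQ : Q (p.run s)) : WP p s T Q := by
  obtain ⟨n, hn, he⟩ := Prog.exec_run h s
  exact ⟨n, _, he, hn.trans hT, hQ⟩

/-- The invariant is indexed by the number of completed rounds. That the test can hold only for `k <
N` is part of the hypothesis and serves as the termination proof. -/
theorem WP.loop {t : Test} {p : Prog} {N T : ℕ} {Inv : ℕ → Store → Prop} {s : Store}
    (h : ∀ k s', Frame p s s' → Inv k s' → t.Holds s' → k < N ∧ WP p s' T (Inv (k + 1)))
    (h0 : Inv 0 s) :
    WP (.loop t p) s (N * (T + 1) + 1) fun s' => ¬ t.Holds s' ∧ ∃ k ≤ N, Inv k s' := by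
  have key : ∀ m k s', m + k = N → Frame p s s' → Inv k s' →
      WP (.loop t p) s' (m * (T + 1) + 1) fun s' => ¬ t.Holds s' ∧ ∃ k ≤ N, Inv k s' := by
    intro m
    induction m with
    | zero =>
      intro k s' hk hf hi
      have ht : ¬ t.Holds s' := fun ht => by have := (h k s' hf hi ht).1; omega
      exact ⟨1, s', .loop_false ht, by omega, ht, k, by omega, hi⟩
    | succ m ih =>
      intro k s' hk hf hi
      by_cases ht : t.Holds s'
      · obtain ⟨n, s₁, he, hn, hi₁⟩ := (h k s' hf hi ht).2
        obtain ⟨n', s₂, he', hn', hq⟩ := ih (k + 1) s₁ (by omega) (hf.trans he.frame) hi₁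
        refine ⟨n + n' + 1, s₂, .loop_true ht he he', ?_, hq⟩
        have : (m + 1) * (T + 1) = m * (T + 1) + (T + 1) := by ring
        omega
      · exact ⟨1, s', .loop_false ht, by omega, ht, k, by omega, hi⟩
  exact key N 0 s (by omega) (Frame.refl _ _) h0

/-- `for i < b do p`, where array `i` holds the counter. -/
def Prog.for (i : ℕ) (b : NExpr) (p : Prog) : Prog :=
  .setNat i 0 0 ;; .loop (.natLe (.get i 0 + 1) b) (p ;; .setNat i 0 (.get i 0 + 1))

/-- The bound `b` is evaluated anew before every round, so `hb` asks for its value in all stores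
that can occur. The invariant always speaks about the store in which the counter has already been
set. -/
theorem WP.for {i : ℕ} {b : NExpr} {p : Prog} {s : Store} {N T : ℕ} (Inv : ℕ → Store → Prop)
    (hi : p.writesNat i = false)
    (hb : ∀ s', Frame (.for i b p) s s' → b.eval s' = N)
    (h0 : Inv 0 (s.writeNat i 0 0))
    (hs : ∀ k < N, ∀ s', Frame (.for i b p) s s' → s'.nat i 0 = k → Inv k s' →
      WP p s' T fun s'' => Inv (k + 1) (s''.writeNat i 0 (k + 1))) :
    WP (.for i b p) s (N * (T + 2) + 2) (Inv N) := by
  have hfr : ∀ s', Frame (p ;; .setNat i 0 (.get i 0 + 1)) (s.writeNat i 0 0) s' →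
      Frame (.for i b p) s s' := by
    refine fun s' h => ⟨fun A hA => ?_, fun A hA => ?_⟩
    · simp only [Prog.for, Prog.writesNat, Bool.or_eq_false_iff] at hA
      rw [h.nat A (by simp only [Prog.writesNat, Bool.or_eq_false_iff]; exact hA.2)]
      exact s.nat_writeNat_of_ne (fun e => by simp [e] at hA) _ _
    · simp only [Prog.for, Prog.writesReal, Bool.or_eq_false_iff] at hA
      rw [h.real A (by simp only [Prog.writesReal, Bool.or_eq_false_iff]; exact hA.2)]
      rfl
  have h1 : WP (.setNat i 0 0) s 1 fun s' => s' = s.writeNat i 0 0 :=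
    ⟨1, _, .setNat s i 0 0, le_rfl, rfl⟩
  have h2 := WP.loop (t := .natLe (.get i 0 + 1) b) (p := p ;; .setNat i 0 (.get i 0 + 1))
    (N := N) (T := T + 1) (Inv := fun k s' => Inv k s' ∧ s'.nat i 0 = k ∧ k ≤ N)
    (s := s.writeNat i 0 0) ?_ ⟨h0, by simp, by omega⟩
  · refine ((h1.seq (T₂ := N * (T + 1 + 1) + 1) fun s' _ hs' => ?_).mono (by
      have : N * (T + 1 + 1) = N * (T + 2) := by ring
      omega) fun _ _ h => h)
    subst hs'
    refine h2.mono le_rfl ?_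
    rintro s' fr ⟨ht, k, hk, hinv, hk', _⟩
    have := hb s' (hfr s' ⟨fr.nat, fr.real⟩)
    simp only [Test.holds_natLe, NExpr.eval_add, NExpr.eval_get, NExpr.eval_ofNat, hk', this] at ht
    obtain rfl : k = N := by omega
    exact hinv
  · rintro k s' fr ⟨hinv, hk, hkN⟩ ht
    have hf := hfr s' fr
    simp only [Test.holds_natLe, NExpr.eval_add, NExpr.eval_get, NExpr.eval_ofNat, hk, hb s' hf] at ht
    refine ⟨by omega, (hs k (by omega) s' hf hk hinv).seq fun s'' fr' h => ?_⟩
    have e : s''.nat i 0 = k := by rw [fr'.nat i hi, hk]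
    refine WP.run rfl le_rfl ?_
    simp only [Prog.run, NExpr.eval_add, NExpr.eval_get, NExpr.eval_ofNat, e]
    exact ⟨h, by simp, by omega⟩

/-! ### Step bounds as powers of one number -/

theorem mul_pow_le {Z : ℕ} (hZ : 16 ≤ Z) (k : ℕ) : 16 * Z ^ k ≤ Z ^ (k + 1) := by
  rw [pow_succ']; exact Nat.mul_le_mul_right _ hZ

/-- The factor `16` between consecutive powers absorbs constants and sums of a few terms, so that
adding up step bounds is linear arithmetic with the powers as atoms. -/
theorem pow_steps {Z : ℕ} (hZ : 16 ≤ Z) :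
    16 ≤ Z ^ 1 ∧ 16 * Z ^ 1 ≤ Z ^ 2 ∧ 16 * Z ^ 2 ≤ Z ^ 3 ∧ 16 * Z ^ 3 ≤ Z ^ 4 ∧ 16 * Z ^ 4 ≤ Z ^ 5 ∧
    16 * Z ^ 5 ≤ Z ^ 6 ∧ 16 * Z ^ 6 ≤ Z ^ 7 ∧ 16 * Z ^ 7 ≤ Z ^ 8 ∧ 16 * Z ^ 8 ≤ Z ^ 9 ∧
    16 * Z ^ 9 ≤ Z ^ 10 ∧ 16 * Z ^ 10 ≤ Z ^ 11 ∧ 16 * Z ^ 11 ≤ Z ^ 12 ∧ 16 * Z ^ 12 ≤ Z ^ 13 ∧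
    16 * Z ^ 13 ≤ Z ^ 14 ∧ 16 * Z ^ 14 ≤ Z ^ 15 ∧ 16 * Z ^ 15 ≤ Z ^ 16 ∧ 16 * Z ^ 16 ≤ Z ^ 17 ∧
    16 * Z ^ 17 ≤ Z ^ 18 ∧ 16 * Z ^ 18 ≤ Z ^ 19 ∧ 16 * Z ^ 19 ≤ Z ^ 20 ∧ 16 * Z ^ 20 ≤ Z ^ 21 ∧
    16 * Z ^ 21 ≤ Z ^ 22 ∧ 16 * Z ^ 22 ≤ Z ^ 23 ∧ 16 * Z ^ 23 ≤ Z ^ 24 ∧ 16 * Z ^ 24 ≤ Z ^ 25 := by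
  have h := mul_pow_le hZ
  exact ⟨by simpa, h _, h _, h _, h _, h _, h _, h _, h _, h _, h _, h _, h _, h _, h _, h _, h _, h _,
    h _, h _, h _, h _, h _, h _, h _⟩

/-- A loop with at most `Z` rounds raises the exponent by two: one for the rounds, one for the
overhead. -/
theorem for_le_pow {Z N T : ℕ} (m : ℕ) {k : ℕ} (hZ : 16 ≤ Z) (hN : N ≤ Z) (hT : T ≤ Z ^ m)
    (hk : m + 2 ≤ k) : N * (T + 2) + 2 ≤ Z ^ k := by
  refine le_trans ?_ (Nat.pow_le_pow_right (by omega) hk)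
  have h1 : N * (T + 2) ≤ Z * (Z ^ m + 2) := Nat.mul_le_mul hN (by omega)
  have h2 : Z * (Z ^ m + 2) = Z ^ (m + 1) + 2 * Z := by ring
  have h3 := mul_pow_le hZ (m + 1)
  have h4 : Z ^ 1 ≤ Z ^ (m + 1) := Nat.pow_le_pow_right (by omega) (by omega)
  simp only [pow_one] at h4
  have h5 : m + 1 + 1 = m + 2 := by omega
  rw [h5] at h3
  omega

theorem loop_le_pow {Z N T : ℕ} (m : ℕ) {k : ℕ} (hZ : 16 ≤ Z) (hN : N ≤ Z) (hT : T ≤ Z ^ m)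
    (hk : m + 2 ≤ k) : N * (T + 1) + 1 ≤ Z ^ k :=
  le_trans (by
    have : N * (T + 1) ≤ N * (T + 2) := Nat.mul_le_mul_left _ (by omega)
    omega) (for_le_pow m hZ hN hT hk)

/-! ### Partial solutions and the rules that generate them -/

/-- The data that the search for a solution of cost about `b` works with: sizes, the class `cid x`
of every item (users come first, facilities follow), the tree of merges (`mate`, `out`, `top`), scaled
depths `D` of the nodes, the scaled threshold `B`. -/
structure Scheme where
  nV : ℕ
  nU : ℕ
  nF : ℕ
  r : ℕ
  cid : ℕ → ℕ
  mate : ℕ → ℕ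
  out : ℕ → ℕ
  top : ℕ → ℕ
  D : ℕ → ℝ
  b : ℝ
  B : ℝ

namespace Scheme

variable (S : Scheme)

abbrev n : ℕ := S.nU + S.nF

/-- Class `c` is close enough to the top of the part with tag `t`. -/
def FitC (t c : ℕ) : Prop := S.D (S.nV + c) - S.D (S.top t) ≤ S.B + S.b

/-- This is the pruning condition. A solution of cost at most `b` never leaves an item pending that
is farther below the top of its part, so states that do not fit can be dropped. -/
def Fit (t : ℕ) (q : ℕ → ℕ) : Prop := ∀ x < S.n, 1 ≤ q x → S.FitC t (S.cid x)

/-- Users of class `c` may be assigned at the top of part `t` to facilities of class `c'`. -/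
def Allow (t c c' : ℕ) : Prop :=
  -- Each of the two centres differs from its item by at most `b` in depth, which explains `b + b`
  -- on the right.
  S.D (S.nV + c) + S.D (S.nV + c') - S.D (S.top t) - S.D (S.top t) ≤ S.B + S.b + S.b

/-- The number of pending items of class `c`. -/
def key (q : ℕ → ℕ) (c : ℕ) : ℕ := ∑ y ∈ Finset.range S.n, if S.cid y = c then q y else 0

def Eqv (q q' : ℕ → ℕ) : Prop := ∀ x < S.n, S.key q (S.cid x) = S.key q' (S.cid x)

/-- The generated partial solutions: tag, pending items, assignment. -/
inductive Der : ℕ → (ℕ → ℕ) → (ℕ → ℕ) → Prop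
  | vertex {k : ℕ} (hk : k < S.nV) : Der k (fun _ => 0) (fun _ => 0)
  | user {u : ℕ} (hu : u < S.nU) : Der (S.nV + u) (fun x => if x = u then 1 else 0) (fun _ => 0)
  -- The facility commits to its final number `m` of users. The requirement with `r` is checked only
  -- here, since later rules turn slots into users one for one.
  | facility {f m : ℕ} (hf : f < S.nF) (hm : m ≤ S.nU) (hr : m = 0 ∨ S.r ≤ m) :
      Der (S.nV + (S.nU + f)) (fun x => if x = S.nU + f then m else 0) (fun _ => 0)
  | assign {t u f : ℕ} {q a : ℕ → ℕ} (h : Der t q a) (hu : u < S.nU) (hf : f < S.nF)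
      (hqu : 1 ≤ q u) (hqf : 1 ≤ q (S.nU + f)) (hal : S.Allow t (S.cid u) (S.cid (S.nU + f))) :
      Der t (fun x => if x = u ∨ x = S.nU + f then q x - 1 else q x)
        (fun x => if x = u then f + 1 else a x)
  | merge {t : ℕ} {q a q' a' : ℕ → ℕ} (h : Der t q a) (h' : Der (S.mate t) q' a')
      (ho : 1 ≤ S.out t) : Der (S.out t) (fun x => q x + q' x) (fun x => a x + a' x)
  -- Only the entries below `n` are meaningful: in memory, the next entries belong to another member
  -- of the pool.
  | congr {t : ℕ} {q a q' a' : ℕ → ℕ} (h : Der t q a) (hq : ∀ x < S.n, q x = q' x)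
      (ha : ∀ x < S.n, a x = a' x) : Der t q' a'

/-- `cov t x` says that item `x` belongs to the part of the tree with tag `t`. -/
structure Plan (cov : ℕ → ℕ → Prop) : Prop where
  vertex : ∀ k < S.nV, ∀ x, ¬ cov k x
  item : ∀ x < S.n, ∀ y, cov (S.nV + x) y ↔ y = x
  out : ∀ t, 1 ≤ S.out t → ∀ y, cov (S.out t) y ↔ cov t y ∨ cov (S.mate t) y
  disj : ∀ t, 1 ≤ S.out t → ∀ y, cov t y → ¬ cov (S.mate t) y
  out_lt : ∀ t, 1 ≤ S.out t → S.out t < 2 * (S.nV + S.n)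

variable {S} {cov : ℕ → ℕ → Prop} {G : ℕ → ℕ → Prop}

theorem key_congr {q q' : ℕ → ℕ} (h : ∀ x < S.n, q x = q' x) (c : ℕ) : S.key q c = S.key q' c :=
  Finset.sum_congr rfl fun y hy => by rw [h y (Finset.mem_range.1 hy)]

theorem key_add (q q' : ℕ → ℕ) (c : ℕ) :
    S.key (fun x => q x + q' x) c = S.key q c + S.key q' c := by
  simp only [key, ← Finset.sum_add_distrib]
  exact Finset.sum_congr rfl fun y _ => by split_ifs <;> simp

theorem key_zero (c : ℕ) : S.key (fun _ => 0) c = 0 := by simp [key]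

theorem le_key {q : ℕ → ℕ} {x : ℕ} (hx : x < S.n) : q x ≤ S.key q (S.cid x) := by
  have := Finset.single_le_sum (f := fun y => if S.cid y = S.cid x then q y else 0)
    (fun _ _ => Nat.zero_le _) (Finset.mem_range.2 hx)
  simpa [key] using this

theorem exists_of_key_pos {q : ℕ → ℕ} {c : ℕ} (h : 1 ≤ S.key q c) :
    ∃ y < S.n, S.cid y = c ∧ 1 ≤ q y := by
  by_contra! hc
  have : S.key q c = 0 := Finset.sum_eq_zero fun y hy => by
    split_ifs with e
    · have := hc y (Finset.mem_range.1 hy) e; omega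
    · rfl
  omega

theorem Eqv.refl (q : ℕ → ℕ) : S.Eqv q q := fun _ _ => rfl
theorem Eqv.symm {q q' : ℕ → ℕ} (h : S.Eqv q q') : S.Eqv q' q := fun x hx => (h x hx).symm
theorem Eqv.trans {q q' q'' : ℕ → ℕ} (h : S.Eqv q q') (h' : S.Eqv q' q'') : S.Eqv q q'' :=
  fun x hx => (h x hx).trans (h' x hx)
theorem Eqv.of_eq {q q' : ℕ → ℕ} (h : ∀ x < S.n, q x = q' x) : S.Eqv q q' :=
  fun _ _ => key_congr h _

theorem Fit.of_eqv {t : ℕ} {q q' : ℕ → ℕ} (h : S.Fit t q) (he : S.Eqv q q') : S.Fit t q' := by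
  intro x hx hq
  have h1 : 1 ≤ S.key q (S.cid x) := by rw [he x hx]; exact hq.trans (le_key hx)
  obtain ⟨y, hy, hc, hqy⟩ := exists_of_key_pos h1
  exact hc ▸ h y hy hqy

/-! ### Soundness -/

/-- The number of users assigned to facility `f`. -/
def load (S : Scheme) (a : ℕ → ℕ) (f : ℕ) : ℕ := ∑ u ∈ Finset.range S.nU, if a u = f + 1 then 1 else 0

/-- The soundness invariant. In `a`, the value `0` means unassigned and `f + 1` means facility `f`;
`G` collects what is known about matched pairs. The last field counts open slots and served users
together, so it becomes the lower bound on the load once nothing is pending. -/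
structure Valid (S : Scheme) (cov : ℕ → ℕ → Prop) (G : ℕ → ℕ → Prop) (t : ℕ) (q a : ℕ → ℕ) :
    Prop where
  tag_lt : t < 2 * (S.nV + S.n)
  user : ∀ u < S.nU, (¬ cov t u ∧ q u = 0 ∧ a u = 0) ∨ (cov t u ∧ q u = 1 ∧ a u = 0) ∨
    (cov t u ∧ q u = 0 ∧ ∃ f < S.nF, cov t (S.nU + f) ∧ a u = f + 1 ∧ G u f)
  le : ∀ f < S.nF, q (S.nU + f) ≤ S.nU
  cov : ∀ f < S.nF, 1 ≤ q (S.nU + f) → cov t (S.nU + f)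
  load : ∀ f < S.nF, q (S.nU + f) + S.load a f = 0 ∨ S.r ≤ q (S.nU + f) + S.load a f

theorem Valid.load_eq_zero {t : ℕ} {q a : ℕ → ℕ} (h : S.Valid cov G t q a) {f : ℕ}
    (hc : ¬ cov t (S.nU + f)) : S.load a f = 0 := by
  refine Finset.sum_eq_zero fun u hu => ?_
  rw [if_neg]
  intro e
  rcases h.user u (Finset.mem_range.1 hu) with h1 | h1 | ⟨_, _, f', _, hc', ha, _⟩
  · omega
  · omega
  · obtain rfl : f' = f := by omega
    exact hc hc'

/-- Induction on the rules. Geometry enters through `hG` alone. For a merge, the two parts are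
disjoint, so at every item one of the summands vanishes and addition of states is their union. -/
theorem Der.valid (hP : S.Plan cov)
    (hG : ∀ t u f, u < S.nU → f < S.nF → cov t u → cov t (S.nU + f) →
      S.Allow t (S.cid u) (S.cid (S.nU + f)) → G u f)
    {t : ℕ} {q a : ℕ → ℕ} (h : S.Der t q a) : S.Valid cov G t q a := by
  have load_zero : ∀ f, S.load (fun _ => 0) f = 0 := fun f => by simp [Scheme.load]
  induction h with
  | @vertex k hk =>
    refine ⟨by omega, fun u _ => .inl ⟨hP.vertex k hk u, rfl, rfl⟩, fun _ _ => Nat.zero_le _,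
      fun f _ h => by simp at h, fun f _ => .inl ?_⟩
    simp [load_zero]
  | @user u hu =>
    refine ⟨by simp only [n]; omega, fun v hv => ?_, fun f hf => ?_, fun f hf h => ?_,
      fun f hf => .inl ?_⟩
    · rw [hP.item u (by simp only [n]; omega)]
      by_cases e : v = u <;> simp [e]
    · simp [show S.nU + f ≠ u by omega]
    · simp [show S.nU + f ≠ u by omega] at h
    · simp [show S.nU + f ≠ u by omega, load_zero]
  | @facility f m hf hm hr =>
    refine ⟨by simp only [n]; omega, fun v hv => ?_, fun f' hf' => ?_, fun f' hf' h => ?_,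
      fun f' hf' => ?_⟩
    · rw [hP.item (S.nU + f) (by simp only [n]; omega)]
      simp [show v ≠ S.nU + f by omega]
    · split_ifs <;> omega
    · rw [hP.item (S.nU + f) (by simp only [n]; omega)]
      by_contra hne
      rw [if_neg hne] at h
      omega
    · rw [load_zero]
      split_ifs <;> omega
  | @assign t u f q a _ hu hf hqu hqf hal ih =>
    have hcu : cov t u ∧ q u = 1 ∧ a u = 0 := by
      rcases ih.user u hu with h | h | h
      · omega
      · exact h
      · omega
    have hcf := ih.cov f hf hqf
    have hg := hG t u f hu hf hcu.1 hcf hal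
    refine ⟨ih.tag_lt, fun v hv => ?_, fun f' hf' => ?_, fun f' hf' h => ?_, fun f' hf' => ?_⟩
    · by_cases e : v = u
      · subst e
        exact .inr (.inr ⟨hcu.1, by simp [hcu.2.1], f, hf, hcf, by simp, hg⟩)
      · simpa [e, show v ≠ S.nU + f by omega] using ih.user v hv
    · have := ih.le f' hf'
      split_ifs <;> omega
    · refine ih.cov f' hf' (h.trans ?_)
      split_ifs <;> omega
    · have hl : S.load (fun x => if x = u then f + 1 else a x) f' =
          S.load a f' + if f' = f then 1 else 0 := by
        simp only [Scheme.load]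
        rw [← Finset.sum_erase_add _ _ (Finset.mem_range.2 hu),
          ← Finset.sum_erase_add (Finset.range S.nU) (fun v => if a v = f' + 1 then 1 else 0)
            (Finset.mem_range.2 hu)]
        simp only [hcu.2.2, if_true]
        rw [Finset.sum_congr rfl (g := fun v => if a v = f' + 1 then 1 else 0) fun v hv => by
          simp only [if_neg (Finset.ne_of_mem_erase hv)]]
        simp only [eq_comm (a := f), Nat.add_right_cancel_iff]
        simp
      rw [hl]
      have := ih.load f' hf'
      by_cases e : f' = f
      · subst e
        simp only [or_true, if_true]
        omega
      · simpa [e, show S.nU + f' ≠ u by omega] using this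
  | @merge t q a q' a' _ _ ho ih ih' =>
    have ho' := hP.out t ho
    have hd := hP.disj t ho
    have hl : ∀ f < S.nF, S.load (fun x => a x + a' x) f = S.load a f + S.load a' f := by
      intro f hf
      simp only [Scheme.load, ← Finset.sum_add_distrib]
      refine Finset.sum_congr rfl fun u hu => ?_
      have : a u = 0 ∨ a' u = 0 := by
        have hu := Finset.mem_range.1 hu
        rcases ih.user u hu with h | h | h
        · exact .inl h.2.2
        · exact .inl h.2.2
        · rcases ih'.user u hu with h' | h' | h'
          · exact .inr h'.2.2
          · exact .inr h'.2.2
          · exact absurd h'.1 (hd u h.1)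
      rcases this with h | h <;> simp [h]
    -- A facility lies in at most one of the two parts, and the other part contributes neither slots
    -- nor users.
    have hz : ∀ f < S.nF, (q (S.nU + f) = 0 ∧ S.load a f = 0) ∨
        (q' (S.nU + f) = 0 ∧ S.load a' f = 0) := by
      intro f hf
      by_cases hc : cov t (S.nU + f)
      · have hc' := hd _ hc
        refine .inr ⟨?_, ih'.load_eq_zero hc'⟩
        by_contra h
        exact hc' (ih'.cov f hf (by omega))
      · refine .inl ⟨?_, ih.load_eq_zero hc⟩
        by_contra h
        exact hc (ih.cov f hf (by omega))
    refine ⟨hP.out_lt t ho, fun u hu => ?_, fun f hf => ?_, fun f hf h => ?_, fun f hf => ?_⟩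
    · rw [ho']
      rcases ih.user u hu with h | h | ⟨h1, h2, f, h3, h4, h5, h6⟩ <;>
      rcases ih'.user u hu with h' | h' | ⟨h1', h2', f', h3', h4', h5', h6'⟩
      · exact .inl ⟨by tauto, by omega, by omega⟩
      · exact .inr (.inl ⟨by tauto, by omega, by omega⟩)
      · exact .inr (.inr ⟨by tauto, by omega, f', h3', by rw [ho']; exact .inr h4', by omega, h6'⟩)
      · exact .inr (.inl ⟨by tauto, by omega, by omega⟩)
      · exact absurd h'.1 (hd u h.1)
      · exact absurd h1' (hd u h.1)
      · exact .inr (.inr ⟨by tauto, by omega, f, h3, by rw [ho']; exact .inl h4, by omega, h6⟩)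
      · exact absurd h'.1 (hd u h1)
      · exact absurd h1' (hd u h1)
    · have h1 := ih.le f hf
      have h2 := ih'.le f hf
      rcases hz f hf with h | h <;> omega
    · rw [ho']
      by_cases h1 : 1 ≤ q (S.nU + f)
      · exact .inl (ih.cov f hf h1)
      · exact .inr (ih'.cov f hf (by omega))
    · rw [hl f hf]
      have h1 := ih.load f hf
      have h2 := ih'.load f hf
      rcases hz f hf with h | h <;> omega
  | @congr t q a q' a' _ hq ha ih =>
    have hl : ∀ f, S.load a' f = S.load a f := fun f => Finset.sum_congr rfl fun u hu => by
      rw [ha u (by have := Finset.mem_range.1 hu; simp only [n]; omega)]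
    refine ⟨ih.tag_lt, fun u hu => ?_, fun f hf => ?_, fun f hf => ?_, fun f hf => ?_⟩
    · rw [← hq u (by simp only [n]; omega), ← ha u (by simp only [n]; omega)]
      exact ih.user u hu
    · rw [← hq _ (by simp only [n]; omega)]
      exact ih.le f hf
    · rw [← hq _ (by simp only [n]; omega)]
      exact ih.cov f hf
    · rw [hl, ← hq _ (by simp only [n]; omega)]
      exact ih.load f hf

/-! ### Counting -/

theorem Valid.pending_le {t : ℕ} {q a : ℕ → ℕ} (h : S.Valid cov G t q a) {x : ℕ} (hx : x < S.n) :
    q x ≤ S.nU := by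
  by_cases hu : x < S.nU
  · rcases h.user x hu with h | h | h <;> omega
  · have := h.le (x - S.nU) (by simp only [n] at hx; omega)
    rwa [show S.nU + (x - S.nU) = x by omega] at this

theorem Valid.cov_of_pending {t : ℕ} {q a : ℕ → ℕ} (h : S.Valid cov G t q a) {x : ℕ}
    (hx : x < S.n) (hq : 1 ≤ q x) : cov t x := by
  by_cases hu : x < S.nU
  · rcases h.user x hu with h | h | h
    · omega
    · exact h.1
    · exact h.1
  · have := h.cov (x - S.nU) (by simp only [n] at hx; omega)
    rw [show S.nU + (x - S.nU) = x by omega] at this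
    exact this hq

-- A state that fits has pending items only in the at most `W` classes near the top of its part, and
-- each class sum is at most `n * nU`. Together with the tag, these sums determine the state up to
-- equivalence, so pairwise inequivalent states inject into the set of such data.
open Classical in
theorem card_le {len W : ℕ} {tag : ℕ → ℕ} {q a : ℕ → ℕ → ℕ}
    (hv : ∀ j < len, S.Valid cov G (tag j) (q j) (a j)) (hf : ∀ j < len, S.Fit (tag j) (q j))
    (hne : ∀ i j, i < j → j < len → tag i = tag j → ¬ S.Eqv (q i) (q j))
    (hW : ∀ t, (((Finset.range S.n).filter fun x => cov t x ∧ S.FitC t (S.cid x)).image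
      S.cid).card ≤ W) :
    len ≤ 2 * (S.nV + S.n) * (S.n * S.nU + 1) ^ W := by
  set C : ℕ → Finset ℕ := fun t =>
    ((Finset.range S.n).filter fun x => cov t x ∧ S.FitC t (S.cid x)).image S.cid with hC
  set Y := S.n * S.nU
  have hY : ∀ j < len, ∀ c, S.key (q j) c < Y + 1 := by
    intro j hj c
    refine Nat.lt_succ_of_le ((Finset.sum_le_card_nsmul _ _ S.nU fun y hy => ?_).trans_eq
      (by simp [Y]))
    split_ifs
    · exact (hv j hj).pending_le (Finset.mem_range.1 hy)
    · exact Nat.zero_le _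
  let g : Fin len → Σ t : Fin (2 * (S.nV + S.n)), ({c // c ∈ C t} → Fin (Y + 1)) := fun j =>
    ⟨⟨tag j, (hv j j.2).tag_lt⟩, fun c => ⟨S.key (q j) c, hY j j.2 c⟩⟩
  -- Extension by zero recovers all class sums from the recorded ones, because a class with a
  -- pending item is always recorded.
  let Φ : (Σ t : Fin (2 * (S.nV + S.n)), ({c // c ∈ C t} → Fin (Y + 1))) → ℕ → ℕ := fun σ c =>
    if h : c ∈ C σ.1 then σ.2 ⟨c, h⟩ else 0
  have hΦ : ∀ j : Fin len, ∀ x < S.n, Φ (g j) (S.cid x) = S.key (q j) (S.cid x) := by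
    intro j x hx
    simp only [Φ, g]
    split_ifs with h
    · rfl
    · symm
      by_contra h0
      obtain ⟨y, hy, hc, hq⟩ := exists_of_key_pos (Nat.one_le_iff_ne_zero.2 h0)
      refine h (Finset.mem_image.2 ⟨y, Finset.mem_filter.2 ⟨Finset.mem_range.2 hy, ?_, ?_⟩, hc⟩)
      · exact (hv j j.2).cov_of_pending hy hq
      · exact hf j j.2 y hy hq
  have hinj : Function.Injective g := by
    intro i j hij
    have ht : tag i = tag j := congrArg (fun σ => (σ.1 : ℕ)) hij
    have he : S.Eqv (q i) (q j) := fun x hx => by rw [← hΦ i x hx, ← hΦ j x hx, hij]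
    rcases lt_trichotomy (i : ℕ) j with h | h | h
    · exact absurd he (hne i j h j.2 ht)
    · exact Fin.ext h
    · exact absurd he.symm (hne j i h i.2 ht.symm)
  have hcard := Fintype.card_le_of_injective g hinj
  rw [Fintype.card_fin, Fintype.card_sigma] at hcard
  refine hcard.trans ((Finset.sum_le_card_nsmul _ _ ((Y + 1) ^ W) fun t _ => ?_).trans_eq
    (by simp))
  simp only [Fintype.card_fun, Fintype.card_fin, Fintype.card_coe]
  exact Nat.pow_le_pow_right (by omega) (hW t)

/-! ### Completeness -/

/-- Every generated state that fits is represented. -/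
def Rep (S : Scheme) (P : ℕ → (ℕ → ℕ) → Prop) (t : ℕ) (q : ℕ → ℕ) : Prop :=
  S.Fit t q → ∃ q', P t q' ∧ S.Eqv q q'

/-- What the saturated pool satisfies. The rules are applied only to states that are actually in
`P`, and their results need only be represented up to equivalence, and only if they fit. -/
structure Closed (S : Scheme) (P : ℕ → (ℕ → ℕ) → Prop) : Prop where
  vertex : ∀ k < S.nV, S.Rep P k fun _ => 0
  user : ∀ u < S.nU, S.Rep P (S.nV + u) fun x => if x = u then 1 else 0
  facility : ∀ f < S.nF, ∀ m ≤ S.nU, m = 0 ∨ S.r ≤ m →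
    S.Rep P (S.nV + (S.nU + f)) fun x => if x = S.nU + f then m else 0
  assign : ∀ t q, P t q → ∀ u < S.nU, ∀ f < S.nF, 1 ≤ q u → 1 ≤ q (S.nU + f) →
    S.Allow t (S.cid u) (S.cid (S.nU + f)) →
    S.Rep P t fun x => if x = u ∨ x = S.nU + f then q x - 1 else q x
  merge : ∀ t q q', P t q → P (S.mate t) q' → 1 ≤ S.out t → S.Rep P (S.out t) fun x => q x + q' x

/-- A solution `σ` that the rules are able to find. -/
structure Target (S : Scheme) (cov : ℕ → ℕ → Prop) (σ : ℕ → ℕ) : Prop where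
  lt : ∀ u < S.nU, σ u < S.nF
  load : ∀ f < S.nF, ((Finset.range S.nU).filter fun u => σ u = f).card = 0 ∨
    S.r ≤ ((Finset.range S.nU).filter fun u => σ u = f).card
  fit_user : ∀ t, ∀ u < S.nU, cov t u → ¬ cov t (S.nU + σ u) → S.FitC t (S.cid u)
  fit_facility : ∀ t, ∀ u < S.nU, ¬ cov t u → cov t (S.nU + σ u) → S.FitC t (S.cid (S.nU + σ u))
  cross : ∀ t, 1 ≤ S.out t → ∀ u < S.nU,
    (cov t u ∧ cov (S.mate t) (S.nU + σ u)) ∨ (cov (S.mate t) u ∧ cov t (S.nU + σ u)) →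
    S.Allow (S.out t) (S.cid u) (S.cid (S.nU + σ u)) ∧ S.FitC (S.out t) (S.cid u) ∧
      S.FitC (S.out t) (S.cid (S.nU + σ u))

open Classical in
/-- The state of `σ` on part `t` in which the users in `Y` have already been assigned. -/
noncomputable def state (S : Scheme) (cov : ℕ → ℕ → Prop) (σ : ℕ → ℕ) (t : ℕ) (Y : Finset ℕ)
    (x : ℕ) : ℕ :=
  if x < S.nU then if cov t x ∧ x ∉ Y then 1 else 0
  else if cov t x then ((Finset.range S.nU).filter fun u => S.nU + σ u = x ∧ u ∉ Y).card else 0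

open Classical in
/-- The users that `σ` assigns within part `t`. -/
noncomputable def inner (S : Scheme) (cov : ℕ → ℕ → Prop) (σ : ℕ → ℕ) (t : ℕ) : Finset ℕ :=
  (Finset.range S.nU).filter fun u => cov t u ∧ cov t (S.nU + σ u)

variable {σ : ℕ → ℕ}

theorem mem_inner {t u : ℕ} :
    u ∈ S.inner cov σ t ↔ u < S.nU ∧ cov t u ∧ cov t (S.nU + σ u) := by
  simp [inner]

/-- By disjointness, adding the two states gives the state of the union in which precisely the pairs
inside one of the parts are settled; pairs that cross from one part to the other are still pending
at both ends. -/
theorem state_merge (hP : S.Plan cov) {t : ℕ} (ho : 1 ≤ S.out t) (x : ℕ) :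
    S.state cov σ t (S.inner cov σ t) x + S.state cov σ (S.mate t) (S.inner cov σ (S.mate t)) x =
      S.state cov σ (S.out t) (S.inner cov σ t ∪ S.inner cov σ (S.mate t)) x := by
  classical
  have ho' := hP.out t ho x
  have hd := hP.disj t ho
  have hd' := hd x
  by_cases hu : x < S.nU
  · by_cases h1 : cov t x
    · have h2 := hd' h1
      have h3 : cov (S.out t) x := ho'.2 (.inl h1)
      simp only [state, hu, if_true, h2, false_and, if_false, add_zero]
      exact if_congr (by simp [h1, h2, h3, mem_inner]) rfl rfl
    · by_cases h2 : cov (S.mate t) x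
      · have h3 : cov (S.out t) x := ho'.2 (.inr h2)
        simp only [state, hu, if_true, h1, false_and, if_false, zero_add]
        exact if_congr (by simp [h1, h2, h3, mem_inner]) rfl rfl
      · have h3 : ¬ cov (S.out t) x := fun h => (ho'.1 h).elim h1 h2
        simp [state, hu, h1, h2, h3]
  · by_cases h1 : cov t x
    · have h2 := hd' h1
      have h3 : cov (S.out t) x := ho'.2 (.inl h1)
      simp only [state, hu, h1, h2, h3, if_true, if_false, add_zero]
      congr 1
      refine Finset.filter_congr fun u hu => and_congr_right fun e => ?_
      simp [mem_inner, e, h2]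
    · by_cases h2 : cov (S.mate t) x
      · have h3 : cov (S.out t) x := ho'.2 (.inr h2)
        simp only [state, hu, h1, h2, h3, if_true, if_false, zero_add]
        congr 1
        refine Finset.filter_congr fun u hu => and_congr_right fun e => ?_
        simp [mem_inner, e, h1]
      · have h3 : ¬ cov (S.out t) x := fun h => (ho'.1 h).elim h1 h2
        simp [state, hu, h1, h2, h3]

/-- Settling `u` consumes the pending user `u` and one slot of `σ u`. -/
theorem state_insert {t u : ℕ} {Y : Finset ℕ} (hu : u < S.nU) (hY : u ∉ Y) (hc : cov t u)
    (hc' : cov t (S.nU + σ u)) (x : ℕ) :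
    S.state cov σ t Y x = S.state cov σ t (insert u Y) x +
      ((if x = u then 1 else 0) + if x = S.nU + σ u then 1 else 0) := by
  classical
  by_cases hx : x < S.nU
  · have h1 : x ≠ S.nU + σ u := by omega
    simp only [state, if_pos hx, h1, if_false, add_zero, Finset.mem_insert]
    by_cases e : x = u
    · subst e; simp [hc, hY]
    · simp [e]
  · have h1 : x ≠ u := by omega
    simp only [state, if_neg hx, h1, if_false, zero_add, Finset.mem_insert]
    by_cases e : x = S.nU + σ u
    · subst e
      simp only [hc', if_true]
      rw [← Finset.card_erase_add_one (a := u) (by simp [hu, hY])]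
      congr 2
      ext v
      simp only [Finset.mem_erase, Finset.mem_filter, not_or]
      tauto
    · simp only [e, if_false, add_zero]
      congr 2
      refine Finset.filter_congr fun v _ => and_congr_right fun h => ?_
      have h2 : v ≠ u := by rintro rfl; exact e h.symm
      simp [h2]

/-- The exchange argument. The remaining inner users are settled one at a time. The member of `P` at
hand represents the wanted state only up to equivalence, so another user and another facility of the
same classes may have to be matched instead; the matching test sees only classes, and the class sums
change in the same way. -/
theorem exists_pending {P : ℕ → (ℕ → ℕ) → Prop} (hC : S.Closed P) (hT : S.Target cov σ)
    (hside : ∀ x < S.n, ∀ y < S.n, S.cid x = S.cid y → (x < S.nU ↔ y < S.nU)) {t : ℕ}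
    {Y₀ : Finset ℕ} (hY₀ : Y₀ ⊆ S.inner cov σ t)
    (hcr : ∀ u ∈ S.inner cov σ t, u ∉ Y₀ → S.Allow t (S.cid u) (S.cid (S.nU + σ u)) ∧
      S.FitC t (S.cid u) ∧ S.FitC t (S.cid (S.nU + σ u)))
    (h0 : S.Rep P t (S.state cov σ t Y₀)) :
    ∃ q, P t q ∧ S.Eqv (S.state cov σ t (S.inner cov σ t)) q := by
  classical
  -- No intermediate state may fall victim to the pruning: a pending item either is about to be
  -- settled in this part, or has its partner outside.
  have hfit : ∀ X : Finset ℕ, S.Fit t (S.state cov σ t (Y₀ ∪ X)) := by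
    intro X x hx hq
    by_cases hu : x < S.nU
    · have h1 : cov t x ∧ x ∉ Y₀ ∪ X := by
        by_contra hc
        rw [state, if_pos hu, if_neg hc] at hq
        omega
      by_cases h2 : cov t (S.nU + σ x)
      · exact (hcr x (mem_inner.2 ⟨hu, h1.1, h2⟩)
          fun h => h1.2 (Finset.mem_union_left _ h)).2.1
      · exact hT.fit_user t x hu h1.1 h2
    · have h1 : cov t x := by
        by_contra hc
        rw [state, if_neg hu, if_neg hc] at hq
        omega
      rw [state, if_neg hu, if_pos h1] at hq
      obtain ⟨u, hu'⟩ := Finset.card_pos.1 hq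
      simp only [Finset.mem_filter, Finset.mem_range, Finset.mem_union, not_or] at hu'
      obtain ⟨hun, rfl, h3, _⟩ := hu'
      by_cases h2 : cov t u
      · exact (hcr u (mem_inner.2 ⟨hun, h2, h1⟩) h3).2.2
      · exact hT.fit_facility t u hun h2 h1
  have key : ∀ X : Finset ℕ, X ⊆ S.inner cov σ t \ Y₀ →
      ∃ q, P t q ∧ S.Eqv (S.state cov σ t (Y₀ ∪ X)) q := by
    intro X
    induction X using Finset.induction_on with
    | empty =>
      intro _
      have := hfit ∅
      rw [Finset.union_empty] at this ⊢
      exact h0 this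
    | @insert u X huX ih =>
      intro hsub
      obtain ⟨q, hPq, hq⟩ := ih ((Finset.subset_insert _ _).trans hsub)
      have hu := Finset.mem_sdiff.1 (hsub (Finset.mem_insert_self _ _))
      obtain ⟨hun, hcu, hcf⟩ := mem_inner.1 hu.1
      have hal := (hcr u hu.1 hu.2).1
      have hσ := hT.lt u hun
      have hun' : u < S.n := by simp only [n]; omega
      have hfn' : S.nU + σ u < S.n := by simp only [n]; omega
      have hst := fun x => state_insert (cov := cov) (σ := σ) (Y := Y₀ ∪ X) hun
        (by simp [hu.2, huX]) hcu hcf x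
      rw [← Finset.union_insert] at hst
      have hk : ∀ c, S.key (S.state cov σ t (Y₀ ∪ X)) c =
          S.key (S.state cov σ t (Y₀ ∪ insert u X)) c +
            ((if S.cid u = c then 1 else 0) + if S.cid (S.nU + σ u) = c then 1 else 0) := by
        intro c
        rw [key_congr (fun x _ => hst x), key_add, key_add]
        congr 2
        · simp only [Scheme.key]
          rw [Finset.sum_eq_single u]
          · simp
          · intro y _ hy; simp [hy]
          · intro h; exact absurd (Finset.mem_range.2 hun') h
        · simp only [Scheme.key]
          rw [Finset.sum_eq_single (S.nU + σ u)]
          · simp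
          · intro y _ hy; simp [hy]
          · intro h; exact absurd (Finset.mem_range.2 hfn') h
      -- In `q`, the user `u` itself need not be pending, but its class has a positive sum, so some
      -- user `v` of that class is.
      obtain ⟨v, hv, hvc, hqv⟩ := exists_of_key_pos (S := S) (q := q) (c := S.cid u) (by
        rw [← hq u hun', hk]; simp only [if_true]; omega)
      obtain ⟨g, hg, hgc, hqg⟩ := exists_of_key_pos (S := S) (q := q) (c := S.cid (S.nU + σ u)) (by
        rw [← hq _ hfn', hk]; simp only [if_true]; omega)
      have hvU : v < S.nU := (hside v hv u hun' hvc).2 hun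
      have hgU : ¬ g < S.nU := fun h => by
        have := (hside g hg _ hfn' hgc).1 h
        omega
      obtain ⟨f, rfl⟩ : ∃ f, g = S.nU + f := ⟨g - S.nU, by omega⟩
      have hf : f < S.nF := by simp only [n] at hg; omega
      have hqk : ∀ c, S.key q c = S.key (fun x => if x = v ∨ x = S.nU + f then q x - 1 else q x) c +
          ((if S.cid v = c then 1 else 0) + if S.cid (S.nU + f) = c then 1 else 0) := by
        intro c
        rw [key_congr (q := q) (q' := fun x => (if x = v ∨ x = S.nU + f then q x - 1 else q x) +
          ((if x = v then 1 else 0) + if x = S.nU + f then 1 else 0)), key_add, key_add]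
        · congr 2
          · simp only [Scheme.key]
            rw [Finset.sum_eq_single v]
            · simp
            · intro y _ hy; simp [hy]
            · intro h; exact absurd (Finset.mem_range.2 hv) h
          · simp only [Scheme.key]
            rw [Finset.sum_eq_single (S.nU + f)]
            · simp
            · intro y _ hy; simp [hy]
            · intro h; exact absurd (Finset.mem_range.2 hg) h
        · intro x hx
          by_cases h1 : x = v
          · subst h1
            simp [show x ≠ S.nU + f by omega]
            omega
          · by_cases h2 : x = S.nU + f
            · subst h2
              simp [h1]
              omega
            · simp [h1, h2]
      have he : S.Eqv (S.state cov σ t (Y₀ ∪ insert u X))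
          (fun x => if x = v ∨ x = S.nU + f then q x - 1 else q x) := by
        intro x hx
        have h1 := hq x hx
        rw [hk, hqk, hvc, hgc] at h1
        omega
      obtain ⟨q', hPq', hq'⟩ := hC.assign t q hPq v hvU f hf hqv hqg (by rw [hvc, hgc]; exact hal)
        ((hfit _).of_eqv he)
      exact ⟨q', hPq', he.trans hq'⟩
  have := key _ subset_rfl
  rwa [Finset.union_sdiff_of_subset hY₀] at this

/-- A set of states that is closed under the rules contains the states of every target. -/
theorem exists_state {P : ℕ → (ℕ → ℕ) → Prop} (hC : S.Closed P) (hP : S.Plan cov)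
    (hT : S.Target cov σ)
    (hside : ∀ x < S.n, ∀ y < S.n, S.cid x = S.cid y → (x < S.nU ↔ y < S.nU)) {T : ℕ}
    (htag : ∀ t < T, t < S.nV + S.n ∨ ∃ t' < t, S.mate t' < t ∧ 1 ≤ S.out t' ∧ S.out t' = t)
    (t : ℕ) (ht : t < T) : ∃ q, P t q ∧ S.Eqv (S.state cov σ t (S.inner cov σ t)) q := by
  classical
  induction t using Nat.strong_induction_on with
  | _ t ih =>
    have rep_congr : ∀ {t q q'}, S.Rep P t q → (∀ x < S.n, q' x = q x) → S.Rep P t q' := by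
      intro t q q' h he hf
      obtain ⟨p, hp, hq⟩ := h (hf.of_eqv (Eqv.of_eq he))
      exact ⟨p, hp, (Eqv.of_eq he).trans hq⟩
    rcases htag t ht with h | ⟨t', h1, h2, ho, rfl⟩
    · have hin : S.inner cov σ t = ∅ := by
        refine Finset.eq_empty_of_forall_notMem fun u hu => ?_
        obtain ⟨hu, hc, hc'⟩ := mem_inner.1 hu
        rcases lt_or_ge t S.nV with hk | hk
        · exact hP.vertex t hk _ hc
        · obtain ⟨x, rfl⟩ := Nat.exists_eq_add_of_le hk
          rw [hP.item x (by omega)] at hc hc'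
          omega
      refine exists_pending hC hT hside (Y₀ := ∅) (Finset.empty_subset _) (by simp [hin]) ?_
      rcases lt_or_ge t S.nV with hk | hk
      · refine rep_congr (hC.vertex t hk) fun x _ => ?_
        simp [state, hP.vertex t hk]
      · obtain ⟨x, rfl⟩ := Nat.exists_eq_add_of_le hk
        have hx : x < S.n := by omega
        by_cases hu : x < S.nU
        · refine rep_congr (hC.user x hu) fun y _ => ?_
          simp only [state, hP.item x hx]
          by_cases e : y = x
          · subst e; simp [hu]
          · simp [e]
        · obtain ⟨f, rfl⟩ : ∃ f, x = S.nU + f := ⟨x - S.nU, by omega⟩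
          have hf : f < S.nF := by simp only [n] at hx; omega
          -- The right guess for the number of slots is the load of `f` under `σ`.
          refine rep_congr (hC.facility f hf _ ?_ (hT.load f hf)) fun y _ => ?_
          · exact (Finset.card_filter_le _ _).trans (by simp)
          · simp only [state, hP.item _ hx]
            by_cases e : y = S.nU + f
            · subst e; simp
            · simp [e]
    · obtain ⟨q, hPq, hq⟩ := ih t' h1 (by omega)
      obtain ⟨q', hPq', hq'⟩ := ih _ h2 (by omega)
      have hst := fun x (_ : x < S.n) => state_merge (σ := σ) hP ho x
      have hout := hP.out t' ho
      -- The pairs left over after the merge are those that cross between the two parts, and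
      -- `Target.cross` allows settling them here.
      refine exists_pending hC hT hside
        (Y₀ := S.inner cov σ t' ∪ S.inner cov σ (S.mate t')) ?_ ?_ ?_
      · refine Finset.union_subset (fun u hu => ?_) fun u hu => ?_ <;>
        · rw [mem_inner, hout, hout]
          rw [mem_inner] at hu
          tauto
      · intro u hu hu'
        rw [mem_inner, hout, hout] at hu
        simp only [Finset.mem_union, mem_inner, not_or] at hu'
        exact hT.cross t' ho u hu.1 (by tauto)
      · intro hf
        have he : S.Eqv (S.state cov σ (S.out t') (S.inner cov σ t' ∪ S.inner cov σ (S.mate t')))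
            (fun x => q x + q' x) := by
          intro x hx
          rw [← key_congr hst, key_add, key_add, hq x hx, hq' x hx]
        obtain ⟨p, hp, hpe⟩ := hC.merge t' q q' hPq hPq' ho (hf.of_eqv he)
        exact ⟨p, hp, he.trans hpe⟩

/-- If all items belong to part `t`, a closed set contains a state of `t` without pending items. -/
theorem exists_complete {P : ℕ → (ℕ → ℕ) → Prop} (hC : S.Closed P) (hP : S.Plan cov)
    (hT : S.Target cov σ)
    (hside : ∀ x < S.n, ∀ y < S.n, S.cid x = S.cid y → (x < S.nU ↔ y < S.nU)) {T : ℕ}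
    (htag : ∀ t < T, t < S.nV + S.n ∨ ∃ t' < t, S.mate t' < t ∧ 1 ≤ S.out t' ∧ S.out t' = t)
    {t : ℕ} (ht : t < T) (hcov : ∀ x < S.n, cov t x) :
    ∃ q, P t q ∧ ∀ x < S.n, q x = 0 := by
  obtain ⟨q, hPq, hq⟩ := exists_state hC hP hT hside htag t ht
  have h0 : ∀ x < S.n, S.state cov σ t (S.inner cov σ t) x = 0 := by
    intro x hx
    by_cases hu : x < S.nU
    · have := hT.lt x hu
      have h1 : x ∈ S.inner cov σ t := mem_inner.2 ⟨hu, hcov x hx, hcov _ (by simp only [n]; omega)⟩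
      rw [state, if_pos hu, if_neg (fun h => h.2 h1)]
    · rw [state, if_neg hu, if_pos (hcov x hx), Finset.card_eq_zero]
      refine Finset.filter_eq_empty_iff.2 fun u hu' h => h.2 ?_
      have hu' := Finset.mem_range.1 hu'
      have := hT.lt u hu'
      exact mem_inner.2 ⟨hu', hcov _ (by simp only [n]; omega), h.1 ▸ hcov x hx⟩
  refine ⟨q, hPq, fun x hx => ?_⟩
  have h1 := hq x hx
  rw [key_congr h0, key_zero] at h1
  have := le_key (S := S) (q := q) hx
  omega

end Scheme

/-! ### The pool of partial solutions in memory

Number arrays: `7` the number of items, `20` classes, `16`, `17`, `18` the tree of merges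
(`mate`, `out`, `top`), `21` the size of the pool, `22` the addresses of its members, `23` their tags,
`24` their pending items, `25` their assignments. Real arrays: `3` scaled depths, `4` and `5` the
threshold and the scaled threshold. -/

abbrev NExpr.var (A : ℕ) : NExpr := .get A 0

abbrev RExpr.var (A : ℕ) : RExpr := .get A 0

notation "aN" => 7
notation "aMate" => 16
notation "aOut" => 17
notation "aTop" => 18
notation "aCid" => 20
notation "aLen" => 21
notation "aBase" => 22
notation "aTag" => 23
notation "aQ" => 24
notation "aA" => 25
notation "aOk" => 26
notation "aEq" => 27
notation "rD" => 3
notation "rb" => 4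
notation "rB" => 5

structure Env (S : Scheme) (s : Store) : Prop where
  nV : s.nat 0 0 = S.nV
  nU : s.nat 0 2 = S.nU
  nF : s.nat 0 3 = S.nF
  r : s.nat 0 4 = S.r
  n : s.nat aN 0 = S.n
  cid : s.nat aCid = S.cid
  mate : s.nat aMate = S.mate
  out : s.nat aOut = S.out
  top : s.nat aTop = S.top
  D : s.real rD = S.D
  b : s.real rb 0 = S.b
  B : s.real rB 0 = S.B

/-- The program does not change the environment of the search. -/
def Prog.safe (p : Prog) : Bool :=
  [0, aN, aCid, aMate, aOut, aTop].all (fun A => !p.writesNat A) &&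
    [rD, rb, rB].all fun A => !p.writesReal A

theorem Env.frame {S : Scheme} {s s' : Store} {p : Prog} (he : Env S s) (hf : Frame p s s')
    (hp : p.safe = true) : Env S s' := by
  simp only [Prog.safe, List.all_cons, List.all_nil, Bool.and_true, Bool.and_eq_true,
    Bool.not_eq_true'] at hp
  obtain ⟨⟨h0, h1, h2, h3, h4, h5⟩, h6, h7, h8⟩ := hp
  have e0 := hf.nat _ h0
  exact ⟨by rw [e0, he.nV], by rw [e0, he.nU], by rw [e0, he.nF], by rw [e0, he.r],
    by rw [hf.nat _ h1, he.n], by rw [hf.nat _ h2, he.cid], by rw [hf.nat _ h3, he.mate],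
    by rw [hf.nat _ h4, he.out], by rw [hf.nat _ h5, he.top], by rw [hf.real _ h6, he.D],
    by rw [hf.real _ h7, he.b], by rw [hf.real _ h8, he.B]⟩

def Store.q (s : Store) (n j : ℕ) (x : ℕ) : ℕ := s.nat aQ (j * n + x)

def Store.a (s : Store) (n j : ℕ) (x : ℕ) : ℕ := s.nat aA (j * n + x)

abbrev Store.len (s : Store) : ℕ := s.nat aLen 0

/-- The addresses `j * n` are stored because the machine cannot multiply; `base` includes `j = len`,
where the next candidate is written. Pairwise inequivalence is what bounds the size of the pool. -/
structure Pool (S : Scheme) (s : Store) : Prop where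
  base : ∀ j ≤ s.len, s.nat aBase j = j * S.n
  der : ∀ j < s.len, S.Der (s.nat aTag j) (s.q S.n j) (s.a S.n j)
  fit : ∀ j < s.len, S.Fit (s.nat aTag j) (s.q S.n j)
  ne : ∀ i j, i < j → j < s.len → s.nat aTag i = s.nat aTag j → ¬ S.Eqv (s.q S.n i) (s.q S.n j)

/-- The members of the pool in `s` are in the pool in `s'`. -/
structure Ext (n : ℕ) (s s' : Store) : Prop where
  len : s.len ≤ s'.len
  tag : ∀ j < s.len, s'.nat aTag j = s.nat aTag j
  q : ∀ i < s.len * n, s'.nat aQ i = s.nat aQ i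
  a : ∀ i < s.len * n, s'.nat aA i = s.nat aA i

def Store.Has (s : Store) (n : ℕ) (t : ℕ) (q : ℕ → ℕ) : Prop :=
  ∃ j < s.len, s.nat aTag j = t ∧ ∀ x < n, q x = s.q n j x

/-- The bound `pool` holds for every store satisfying the pool invariant, so each loop that
preserves the invariant gets its bound on the number of members for free. -/
structure Bounds (S : Scheme) (Z : ℕ) : Prop where
  two : 16 ≤ Z
  n : S.n ≤ Z
  nV : S.nV ≤ Z
  nU : S.nU + 1 ≤ Z
  nF : S.nF ≤ Z
  pool : ∀ s, Pool S s → s.len ≤ Z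

theorem mul_add_lt {j l n x : ℕ} (hj : j < l) (hx : x < n) : j * n + x < l * n := by
  have : (j + 1) * n ≤ l * n := Nat.mul_le_mul_right _ hj
  have : (j + 1) * n = j * n + n := by ring
  omega

theorem Ext.refl (n : ℕ) (s : Store) : Ext n s s :=
  ⟨le_rfl, fun _ _ => rfl, fun _ _ => rfl, fun _ _ => rfl⟩

theorem Ext.trans {n : ℕ} {s s' s'' : Store} (h : Ext n s s') (h' : Ext n s' s'') : Ext n s s'' := by
  have := Nat.mul_le_mul_right n h.len
  exact ⟨h.len.trans h'.len, fun j hj => (h'.tag j (hj.trans_le h.len)).trans (h.tag j hj),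
    fun i hi => (h'.q i (hi.trans_le this)).trans (h.q i hi),
    fun i hi => (h'.a i (hi.trans_le this)).trans (h.a i hi)⟩

theorem Ext.item {n : ℕ} {s s' : Store} (h : Ext n s s') {j x : ℕ} (hj : j < s.len) (hx : x < n) :
    s'.q n j x = s.q n j x ∧ s'.a n j x = s.a n j x :=
  ⟨h.q _ (mul_add_lt hj hx), h.a _ (mul_add_lt hj hx)⟩

theorem Ext.of_nat {n : ℕ} {s s' : Store} (h1 : s'.nat aLen = s.nat aLen)
    (h2 : s'.nat aTag = s.nat aTag) (h3 : s'.nat aQ = s.nat aQ) (h4 : s'.nat aA = s.nat aA) :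
    Ext n s s' :=
  ⟨by simp only [Store.len, h1]; exact le_rfl, fun _ _ => by rw [h2], fun _ _ => by rw [h3],
    fun _ _ => by rw [h4]⟩

theorem Pool.of_ext {S : Scheme} {s s' : Store} (hp : Pool S s) (he : Ext S.n s s')
    (hl : s'.nat aLen = s.nat aLen) (hb : s'.nat aBase = s.nat aBase) : Pool S s' := by
  have hl' : s'.len = s.len := congrFun hl 0
  have hq : ∀ j < s.len, ∀ x < S.n, s.q S.n j x = s'.q S.n j x := fun j hj x hx =>
    (he.item hj hx).1.symm
  refine ⟨fun j hj => ?_, fun j hj => ?_, fun j hj => ?_, fun i j hij hj ht h => ?_⟩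
  · rw [hb]; exact hp.base j (hl' ▸ hj)
  · rw [hl'] at hj
    rw [he.tag j hj]
    exact (hp.der j hj).congr (hq j hj) fun x hx => (he.item hj hx).2.symm
  · rw [hl'] at hj
    rw [he.tag j hj]
    exact (hp.fit j hj).of_eqv (.of_eq (hq j hj))
  · rw [hl'] at hj
    rw [he.tag j hj, he.tag i (hij.trans hj)] at ht
    exact hp.ne i j hij hj ht (((Scheme.Eqv.of_eq (hq i (hij.trans hj))).trans h).trans
      (Scheme.Eqv.of_eq (hq j hj)).symm)

theorem Store.Has.mono {n : ℕ} {s s' : Store} {t : ℕ} {q : ℕ → ℕ} (h : s.Has n t q)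
    (he : Ext n s s') : s'.Has n t q := by
  obtain ⟨j, hj, ht, hq⟩ := h
  exact ⟨j, hj.trans_le he.len, (he.tag j hj).trans ht,
    fun x hx => (hq x hx).trans (he.item hj hx).1.symm⟩

theorem rep_mono {S : Scheme} {s s' : Store} {t : ℕ} {q : ℕ → ℕ} (h : S.Rep (s.Has S.n) t q)
    (he : Ext S.n s s') : S.Rep (s'.Has S.n) t q := fun hf => by
  obtain ⟨q', h1, h2⟩ := h hf
  exact ⟨q', h1.mono he, h2⟩

theorem rep_congr {S : Scheme} {P : ℕ → (ℕ → ℕ) → Prop} {t : ℕ} {q q' : ℕ → ℕ} (h : S.Rep P t q)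
    (he : ∀ x < S.n, q' x = q x) : S.Rep P t q' := fun hf => by
  obtain ⟨p, hp, hq⟩ := h (hf.of_eqv (.of_eq he))
  exact ⟨p, hp, (Scheme.Eqv.of_eq he).trans hq⟩

/-! ### Writing and adding a candidate -/

/-- Write a candidate behind the pool. -/
def genCand (eQ eA : NExpr) : Prog :=
  .for 40 (.var aN) (.setNat aQ (.get aBase (.var aLen) + .var 40) eQ ;;
    .setNat aA (.get aBase (.var aLen) + .var 40) eA)

/-- The candidate is written behind the pool while the expressions `eQ` and `eA` may read members of
the pool. Hence they have to be evaluated in every intermediate store that extends `s`. -/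
theorem genCand_spec {S : Scheme} {Z : ℕ} {s : Store} (hZ : Bounds S Z) (he : Env S s)
    (hp : Pool S s) {eQ eA : NExpr} {fq fa : ℕ → ℕ}
    (hev : ∀ x < S.n, ∀ s', s'.nat 40 0 = x → Ext S.n s s' →
      (∀ A, A ≠ aQ → A ≠ aA → A ≠ 40 → s'.nat A = s.nat A) → eQ.eval s' = fq x)
    (hev' : ∀ x < S.n, ∀ s', s'.nat 40 0 = x → Ext S.n s s' →
      (∀ A, A ≠ aQ → A ≠ aA → A ≠ 40 → s'.nat A = s.nat A) → eA.eval s' = fa x) :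
    WP (genCand eQ eA) s (Z ^ 3) fun s' => Ext S.n s s' ∧ Pool S s' ∧ Env S s' ∧
      ∀ x < S.n, s'.q S.n s.len x = fq x ∧ s'.a S.n s.len x = fa x := by
  have hfr : ∀ {s'}, Frame (genCand eQ eA) s s' →
      ∀ A, A ≠ aQ → A ≠ aA → A ≠ 40 → s'.nat A = s.nat A := by
    intro s' fr A h1 h2 h3
    refine fr.nat A ?_
    simp [genCand, Prog.for, Prog.writesNat, h1.symm, h2.symm, h3.symm]
  refine (WP.for (N := S.n) (T := 2) (fun k s' => Ext S.n s s' ∧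
    ∀ x < k, s'.q S.n s.len x = fq x ∧ s'.a S.n s.len x = fa x) rfl ?_ ?_ ?_).mono
    (for_le_pow 1 hZ.two hZ.n (by have := pow_steps hZ.two; omega) (by omega)) ?_
  · intro s' fr
    have h7 := hfr fr aN (by decide) (by decide) (by decide)
    simp [h7, he.n]
  · refine ⟨⟨?_, ?_, ?_, ?_⟩, ?_⟩ <;> simp
  · rintro k hk s' fr hc ⟨hx, hv⟩
    have e21 := hfr fr aLen (by decide) (by decide) (by decide)
    have e22 := hfr fr aBase (by decide) (by decide) (by decide)
    have hb := hp.base s.len le_rfl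
    set s₁ := s'.writeNat aQ (s.len * S.n + k) (fq k) with hs₁
    have hx₁ : Ext S.n s s₁ := by
      refine ⟨by simpa [hs₁] using hx.len, fun j hj => by simpa [hs₁] using hx.tag j hj,
        fun i hi => ?_, fun i hi => by simpa [hs₁] using hx.a i hi⟩
      rw [hs₁, Store.nat_writeNat, if_neg (by omega)]
      exact hx.q i hi
    have e1 := hev k hk s' hc hx (hfr fr)
    have e2 := hev' k hk s₁ (by simp [hs₁, hc]) hx₁ (by
      intro A h1 h2 h3
      rw [hs₁, Store.nat_writeNat_of_ne _ h1, hfr fr A h1 h2 h3])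
    refine WP.run rfl le_rfl ?_
    simp only [Prog.run, NExpr.eval_add, NExpr.eval_get, NExpr.eval_ofNat, e21, e22, hc, hb, e1,
      ← hs₁]
    have e21' : s₁.nat aLen = s'.nat aLen := Store.nat_writeNat_of_ne _ (by decide) _ _
    have e22' : s₁.nat aBase = s'.nat aBase := Store.nat_writeNat_of_ne _ (by decide) _ _
    have e40' : s₁.nat 40 = s'.nat 40 := Store.nat_writeNat_of_ne _ (by decide) _ _
    rw [e21', e22', e40', e21, e22, hc, hb, e2]
    refine ⟨⟨by simpa using hx₁.len, fun j hj => by simpa using hx₁.tag j hj,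
      fun i hi => by simpa using hx₁.q i hi, fun i hi => ?_⟩, fun x hxk => ?_⟩
    · have : i ≠ s.len * S.n + k := by omega
      simpa [this] using hx₁.a i hi
    · by_cases e : x = k
      · subst e
        simp [Store.q, Store.a, hs₁]
      · have := hv x (by omega)
        simpa [Store.q, Store.a, hs₁, e] using this
  · intro s' fr h
    exact ⟨h.1, hp.of_ext h.1 (hfr fr _ (by decide) (by decide) (by decide))
      (hfr fr _ (by decide) (by decide) (by decide)), he.frame fr rfl, h.2⟩

/-- Test whether the candidate fits. -/
def fitLoop : Prog :=
  .setNat aOk 0 1 ;;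
  .for 43 (.var aN) (.when (.natLe 1 (.get aQ (.get aBase (.var aLen) + .var 43)))
    (.ite (.realLe (.get rD (.get 0 0 + .get aCid (.var 43)) - .get rD (.get aTop (.get aTag (.var aLen))))
      (.var rB + .var rb)) .skip (.setNat aOk 0 0)))

theorem fitLoop_spec {S : Scheme} {Z : ℕ} {s : Store} (hZ : Bounds S Z) (he : Env S s)
    (hp : Pool S s) :
    WP fitLoop s (Z ^ 4) fun s' => (1 ≤ s'.nat aOk 0 ↔ S.Fit (s.nat aTag s.len) (s.q S.n s.len)) := by
  have hb := hp.base s.len le_rfl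
  refine ((WP.run (p := .setNat aOk 0 1) (Q := fun s' => s'.nat aOk 0 = 1) rfl le_rfl
    (by simp [Prog.run])).seq (T₂ := Z ^ 3) fun s₁ fr₁ h₁ => ?_).mono (by
      have := pow_steps hZ.two
      simp only [Prog.size]; omega) fun _ _ h => h
  have f21 := fr₁.nat aLen rfl
  have f22 := fr₁.nat aBase rfl
  have f23 := fr₁.nat aTag rfl
  have f24 := fr₁.nat aQ rfl
  have he₁ := he.frame fr₁ rfl
  refine (WP.for (N := S.n) (T := 4) (fun k s' => 1 ≤ s'.nat aOk 0 ↔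
    ∀ x < k, 1 ≤ s.q S.n s.len x → S.FitC (s.nat aTag s.len) (S.cid x)) rfl ?_ ?_ ?_).mono
    (for_le_pow 1 hZ.two hZ.n (by have := pow_steps hZ.two; omega) (by omega)) fun _ _ h => h
  · intro s' fr
    simp [fr.nat aN rfl, he₁.n]
  · simp [h₁]
  · intro k hk s' fr hc hi
    have e21 := (fr.nat aLen rfl).trans f21
    have e22 := (fr.nat aBase rfl).trans f22
    have e23 := (fr.nat aTag rfl).trans f23
    have e24 := (fr.nat aQ rfl).trans f24
    have he' := he₁.frame fr rfl
    have hq : s.nat aQ (s.len * S.n + k) = s.q S.n s.len k := rfl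
    refine WP.when (T := 2) (fun ht => WP.ite (T := 1) (fun ht' => WP.skip ?_)
      fun ht' => WP.run rfl le_rfl ?_) fun ht => ?_
    all_goals
      simp only [Test.holds_natLe, Test.holds_realLe, NExpr.eval_add, NExpr.eval_get,
        NExpr.eval_ofNat, RExpr.eval_get, RExpr.eval_sub, RExpr.eval_add, e21, e22, e23, e24, hc, hb,
        he'.D, he'.nV, he'.b, he'.B, he'.cid, he'.top, hq] at ht
    · simp only [Test.holds_natLe, Test.holds_realLe, NExpr.eval_add, NExpr.eval_get,
        NExpr.eval_ofNat, RExpr.eval_get, RExpr.eval_sub, RExpr.eval_add, e21, e22, e23, e24, hc, hb,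
        he'.D, he'.nV, he'.b, he'.B, he'.cid, he'.top] at ht'
      rw [Nat.forall_lt_succ_right, ← hi]
      simp only [Scheme.FitC]
      simp [ht']
    · simp only [Test.holds_natLe, Test.holds_realLe, NExpr.eval_add, NExpr.eval_get,
        NExpr.eval_ofNat, RExpr.eval_get, RExpr.eval_sub, RExpr.eval_add, e21, e22, e23, e24, hc, hb,
        he'.D, he'.nV, he'.b, he'.B, he'.cid, he'.top] at ht'
      rw [Nat.forall_lt_succ_right]
      simp only [Scheme.FitC]
      simp [Prog.run, ht, ht']
    · rw [Nat.forall_lt_succ_right, ← hi]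
      simp [ht]

/-- Compare the class sums of the candidate and of member `44` of the pool. -/
def eqvLoop : Prog :=
  .setNat aEq 0 1 ;;
  .for 45 (.var aN) (.setNat 28 0 0 ;; .setNat 29 0 0 ;;
    .for 46 (.var aN) (.whenEq (.get aCid (.var 46)) (.get aCid (.var 45))
      (.setNat 28 0 (.var 28 + .get aQ (.get aBase (.var 44) + .var 46)) ;;
        .setNat 29 0 (.var 29 + .get aQ (.get aBase (.var aLen) + .var 46)))) ;;
    .ite (.natLe (.var 28) (.var 29)) (.ite (.natLe (.var 29) (.var 28)) .skip (.setNat aEq 0 0))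
      (.setNat aEq 0 0))

theorem eqvLoop_spec {S : Scheme} {Z : ℕ} {s : Store} (hZ : Bounds S Z) (he : Env S s)
    (hp : Pool S s) {j : ℕ} (hj : s.nat 44 0 = j) (hjl : j < s.len) :
    WP eqvLoop s (Z ^ 7) fun s' => (1 ≤ s'.nat aEq 0 ↔ S.Eqv (s.q S.n j) (s.q S.n s.len)) := by
  have hb := hp.base s.len le_rfl
  have hbj := hp.base j hjl.le
  have hZ2 := pow_steps hZ.two
  refine ((WP.run (p := .setNat aEq 0 1) (Q := fun s' => s'.nat aEq 0 = 1) rfl le_rfl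
    (by simp [Prog.run])).seq (T₂ := Z ^ 6) fun s₁ fr₁ h₁ => ?_).mono (by
      simp only [Prog.size]; omega) fun _ _ h => h
  have f21 := fr₁.nat aLen rfl
  have f22 := fr₁.nat aBase rfl
  have f24 := fr₁.nat aQ rfl
  have f44 := fr₁.nat 44 rfl
  have he₁ := he.frame fr₁ rfl
  refine (WP.for (N := S.n) (T := Z ^ 4) (fun k s' => 1 ≤ s'.nat aEq 0 ↔
    ∀ x < k, S.key (s.q S.n j) (S.cid x) = S.key (s.q S.n s.len) (S.cid x)) rfl ?_ ?_ ?_).mono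
    (for_le_pow 4 hZ.two hZ.n le_rfl (by omega)) fun _ _ h => h
  · intro s' fr
    simp [fr.nat aN rfl, he₁.n]
  · simp [h₁]
  · intro k hk s' fr hc hi
    refine ((WP.run (p := .setNat 28 0 0) (Q := fun s'' => s''.nat 28 0 = 0) rfl le_rfl
      (by simp [Prog.run])).seq (T₂ := 1 + (Z ^ 3 + 3)) fun s₂ fr₂ h28 =>
      (WP.run (p := .setNat 29 0 0) (Q := fun s'' => s''.nat 29 0 = 0) rfl le_rfl
      (by simp [Prog.run])).seq (T₂ := Z ^ 3 + 3) fun s₃ fr₃ h29 =>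
      WP.seq (T₁ := Z ^ 3) (T₂ := 3) (R := fun s'' =>
        s''.nat 28 0 = S.key (s.q S.n j) (S.cid k) ∧
        s''.nat 29 0 = S.key (s.q S.n s.len) (S.cid k)) ?_ fun s₄ fr₄ h4 => ?_).mono (by
      simp only [Prog.size]; omega) fun _ _ h => h
    · have e21 := (fr₃.nat aLen rfl).trans ((fr₂.nat aLen rfl).trans ((fr.nat aLen rfl).trans f21))
      have e22 := (fr₃.nat aBase rfl).trans ((fr₂.nat aBase rfl).trans ((fr.nat aBase rfl).trans f22))
      have e24 := (fr₃.nat aQ rfl).trans ((fr₂.nat aQ rfl).trans ((fr.nat aQ rfl).trans f24))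
      have e44 := (fr₃.nat 44 rfl).trans ((fr₂.nat 44 rfl).trans ((fr.nat 44 rfl).trans f44))
      have e45 := (fr₃.nat 45 rfl).trans (fr₂.nat 45 rfl)
      have he₃ := ((he₁.frame fr rfl).frame fr₂ rfl).frame fr₃ rfl
      refine (WP.for (N := S.n) (T := 6) (fun m s'' =>
        s''.nat 28 0 = (∑ y ∈ Finset.range m, if S.cid y = S.cid k then s.q S.n j y else 0) ∧
        s''.nat 29 0 = ∑ y ∈ Finset.range m, if S.cid y = S.cid k then s.q S.n s.len y else 0)
        rfl ?_ ?_ ?_).mono (for_le_pow 1 hZ.two hZ.n (by omega) (by omega)) fun _ _ h => h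
      · intro s'' fr'
        simp [fr'.nat aN rfl, he₃.n]
      · simp [h29, (fr₃.nat 28 rfl), h28]
      · rintro m hm s'' fr' hc' ⟨i1, i2⟩
        have g21 := (fr'.nat aLen rfl).trans e21
        have g22 := (fr'.nat aBase rfl).trans e22
        have g24 := (fr'.nat aQ rfl).trans e24
        have g44 := (fr'.nat 44 rfl).trans e44
        have g45 : s''.nat 45 0 = k := by rw [fr'.nat 45 rfl, e45, hc]
        have he'' := he₃.frame fr' rfl
        refine WP.whenEq (T := 2) (fun ht => WP.run rfl le_rfl ?_) fun ht => ?_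
        all_goals
          simp only [NExpr.eval_get, NExpr.eval_ofNat, he''.cid, g45, hc'] at ht
        · simp [Prog.run, g21, g22, g24, g44, hc', hj, hb, hbj, i1, i2, Finset.sum_range_succ, ht]
          exact ⟨rfl, rfl⟩
        · simp [i1, i2, Finset.sum_range_succ, ht]
    · have e27 : s₄.nat aEq = s'.nat aEq :=
        (fr₄.nat aEq rfl).trans ((fr₃.nat aEq rfl).trans (fr₂.nat aEq rfl))
      rw [← Nat.lt_add_one_iff, ← e27] at hi
      refine WP.ite (T := 2) (fun ht => WP.ite (T := 1) (fun ht' => WP.skip ?_)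
        fun ht' => WP.run rfl le_rfl ?_) fun ht => WP.run rfl (by decide) ?_
      · simp only [Test.holds_natLe, NExpr.eval_get, NExpr.eval_ofNat, h4] at ht ht'
        rw [Nat.forall_lt_succ_right, ← hi]
        simp [le_antisymm ht ht', Nat.one_le_iff_ne_zero, Nat.pos_iff_ne_zero]
      · simp only [Test.holds_natLe, NExpr.eval_get, NExpr.eval_ofNat, h4] at ht ht'
        rw [Nat.forall_lt_succ_right]
        simp [Prog.run]
        intro _ h
        omega
      · simp only [Test.holds_natLe, NExpr.eval_get, NExpr.eval_ofNat, h4] at ht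
        rw [Nat.forall_lt_succ_right]
        simp [Prog.run]
        intro _ h
        omega

/-- Test whether the candidate is equivalent to a member of the pool. -/
def dupLoop : Prog :=
  .for 44 (.var aLen) (.whenEq (.get aTag (.var 44)) (.get aTag (.var aLen))
    (eqvLoop ;; .when (.natLe 1 (.var aEq)) (.setNat aOk 0 0)))

theorem Store.q_eq {s s' : Store} (h : s'.nat aQ = s.nat aQ) : s'.q = s.q := by
  funext n j x; simp only [Store.q, h]

theorem Store.a_eq {s s' : Store} (h : s'.nat aA = s.nat aA) : s'.a = s.a := by
  funext n j x; simp only [Store.a, h]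

theorem dupLoop_spec {S : Scheme} {Z : ℕ} {s : Store} (hZ : Bounds S Z) (he : Env S s)
    (hp : Pool S s) :
    WP dupLoop s (Z ^ 10) fun s' => (1 ≤ s'.nat aOk 0 ↔ 1 ≤ s.nat aOk 0 ∧
      ∀ j < s.len, s.nat aTag j = s.nat aTag s.len → ¬ S.Eqv (s.q S.n j) (s.q S.n s.len)) := by
  have hZ2 := pow_steps hZ.two
  refine (WP.for (N := s.len) (T := Z ^ 8) (fun k s' => 1 ≤ s'.nat aOk 0 ↔ 1 ≤ s.nat aOk 0 ∧
      ∀ j < k, s.nat aTag j = s.nat aTag s.len → ¬ S.Eqv (s.q S.n j) (s.q S.n s.len))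
    rfl ?_ ?_ ?_).mono
    (for_le_pow 8 hZ.two (hZ.pool s hp) le_rfl (by omega)) fun _ _ h => h
  · intro s' fr
    simp [fr.nat aLen rfl]
  · simp
  · intro k hk s' fr hc hi
    have e21 := fr.nat aLen rfl
    have e22 := fr.nat aBase rfl
    have e23 := fr.nat aTag rfl
    have e24 := fr.nat aQ rfl
    have e25 := fr.nat aA rfl
    have he' := he.frame fr rfl
    have hp' := hp.of_ext (Ext.of_nat e21 e23 e24 e25) e21 e22
    refine (WP.whenEq (T := Z ^ 7 + 3) (fun ht =>
      (eqvLoop_spec hZ he' hp' hc (by simpa only [Store.len, e21] using hk)).seq (T₂ := 3)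
        fun s₁ fr₁ h₁ => ?_) fun ht => ?_).mono (by omega) fun _ _ h => h
    · simp only [NExpr.eval_get, NExpr.eval_ofNat, hc, e21, e23] at ht
      have f26 := fr₁.nat aOk rfl
      rw [Store.q_eq e24, Store.len, e21] at h₁
      refine WP.when (T := 1) (fun ht' => WP.run rfl le_rfl ?_) fun ht' => ?_
      · rw [Nat.forall_lt_succ_right]
        simp only [Test.holds_natLe, NExpr.eval_get, NExpr.eval_ofNat, h₁] at ht'
        simp [Prog.run]
        exact fun _ _ => ⟨ht, ht'⟩
      · rw [Nat.forall_lt_succ_right, ← and_assoc, ← hi]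
        simp only [Test.holds_natLe, NExpr.eval_get, NExpr.eval_ofNat, h₁] at ht'
        simp [f26, ht']
    · simp only [NExpr.eval_get, NExpr.eval_ofNat, hc, e21, e23] at ht
      rw [Nat.forall_lt_succ_right, ← and_assoc, ← hi]
      simp [ht]

/-- Add the candidate to the pool if it fits and is not equivalent to a member. -/
def addCand : Prog :=
  fitLoop ;; dupLoop ;; .when (.natLe 1 (.var aOk))
    (.setNat aBase (.var aLen + 1) (.get aBase (.var aLen) + .var aN) ;;
      .setNat aLen 0 (.var aLen + 1))

/-- The outcome of adding candidates. -/
structure Grow (S : Scheme) (s s' : Store) : Prop where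
  pool : Pool S s'
  env : Env S s'
  ext : Ext S.n s s'

theorem Grow.trans {S : Scheme} {s s' s'' : Store} (h : Grow S s s') (h' : Grow S s' s'') :
    Grow S s s'' := ⟨h'.pool, h'.env, h.ext.trans h'.ext⟩

/-- Afterwards the candidate is represented in any case: vacuously if it does not fit, by an earlier
member if it is a duplicate, and by itself if it was added. -/
theorem addCand_spec {S : Scheme} {Z : ℕ} {s : Store} (hZ : Bounds S Z) (he : Env S s)
    (hp : Pool S s) (hd : S.Der (s.nat aTag s.len) (s.q S.n s.len) (s.a S.n s.len)) :
    WP addCand s (Z ^ 11) fun s' => Grow S s s' ∧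
      S.Rep (s'.Has S.n) (s.nat aTag s.len) (s.q S.n s.len) := by
  have hZ2 := pow_steps hZ.two
  refine ((fitLoop_spec hZ he hp).seq (T₂ := Z ^ 10 + 4) fun s₁ fr₁ h₁ => ?_).mono (by omega)
    fun _ _ h => h
  have e21 := fr₁.nat aLen rfl
  have e22 := fr₁.nat aBase rfl
  have e23 := fr₁.nat aTag rfl
  have e24 := fr₁.nat aQ rfl
  have e25 := fr₁.nat aA rfl
  have he₁ := he.frame fr₁ rfl
  have hx₁ := Ext.of_nat (n := S.n) e21 e23 e24 e25
  have hp₁ := hp.of_ext hx₁ e21 e22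
  refine (dupLoop_spec hZ he₁ hp₁).seq (T₂ := 4) fun s₂ fr₂ h₂ => ?_
  simp only [h₁, Store.q_eq e24, e23, Store.len, e21] at h₂
  have g21 := (fr₂.nat aLen rfl).trans e21
  have g22 := (fr₂.nat aBase rfl).trans e22
  have g23 := (fr₂.nat aTag rfl).trans e23
  have g24 := (fr₂.nat aQ rfl).trans e24
  have g25 := (fr₂.nat aA rfl).trans e25
  have he₂ := he₁.frame fr₂ rfl
  have hx₂ := Ext.of_nat (n := S.n) g21 g23 g24 g25
  have hp₂ := hp.of_ext hx₂ g21 g22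
  have hb := hp.base s.len le_rfl
  refine WP.when (T := 2) (fun ht => WP.run rfl le_rfl ?_) fun ht => ?_
  · simp only [Test.holds_natLe, NExpr.eval_get, NExpr.eval_ofNat, h₂] at ht
    obtain ⟨hfit, hne⟩ := ht
    simp only [Prog.run, NExpr.eval_add, NExpr.eval_get, NExpr.eval_ofNat, g21, g22, hb, he₂.n,
      Store.nat_writeNat]
    set s₃ := (s₂.writeNat aBase (s.nat aLen 0 + 1) (s.nat aLen 0 * S.n + S.n)).writeNat aLen 0
      ((if aLen = aBase ∧ 0 = s.nat aLen 0 + 1 then s.nat aLen 0 * S.n + S.n else s.nat aLen 0) + 1)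
      with hs₃
    have l3 : s₃.len = s.len + 1 := by simp [hs₃, Store.len]
    have k23 : s₃.nat aTag = s.nat aTag := by funext j; simp [hs₃, g23]
    have k24 : s₃.nat aQ = s.nat aQ := by funext j; simp [hs₃, g24]
    have k25 : s₃.nat aA = s.nat aA := by funext j; simp [hs₃, g25]
    -- The address of the next candidate results from the last one by adding `n`.
    have kb : ∀ j, s₃.nat aBase j = if j = s.len + 1 then (s.len + 1) * S.n else s.nat aBase j := by
      intro j
      have : (s.len + 1) * S.n = s.len * S.n + S.n := by ring
      simp [hs₃, g22, this]
    have hx₃ : Ext S.n s s₃ := ⟨by omega, fun _ _ => by rw [k23], fun _ _ => by rw [k24],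
      fun _ _ => by rw [k25]⟩
    have he₃ : Env S s₃ := by
      constructor
      all_goals first
        | (funext j; simp [hs₃, he₂.nV, he₂.nU, he₂.nF, he₂.r, he₂.n, he₂.cid, he₂.mate, he₂.out,
            he₂.top, he₂.D, he₂.b, he₂.B])
        | simp [hs₃, he₂.nV, he₂.nU, he₂.nF, he₂.r, he₂.n, he₂.cid, he₂.mate, he₂.out, he₂.top,
            he₂.D, he₂.b, he₂.B]
    refine ⟨⟨⟨fun j hj => ?_, fun j hj => ?_, fun j hj => ?_, fun i j hij hj ht => ?_⟩, he₃, hx₃⟩,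
      fun _ => ⟨_, ⟨s.len, by omega, by rw [k23], fun x _ => rfl⟩, ?_⟩⟩
    · rw [kb]
      split_ifs with h
      · rw [h]
      · exact hp.base j (by omega)
    · rw [k23, Store.q_eq k24, Store.a_eq k25]
      rcases Nat.lt_succ_iff_lt_or_eq.1 (l3 ▸ hj) with h | rfl
      · exact hp.der j h
      · exact hd
    · rw [k23, Store.q_eq k24]
      rcases Nat.lt_succ_iff_lt_or_eq.1 (l3 ▸ hj) with h | rfl
      · exact hp.fit j h
      · exact hfit
    · rw [k23] at ht
      rw [Store.q_eq k24]
      rcases Nat.lt_succ_iff_lt_or_eq.1 (l3 ▸ hj) with h | rfl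
      · exact hp.ne i j hij h ht
      · exact hne i hij ht
    · rw [Store.q_eq k24]
      exact .refl _
  · simp only [Test.holds_natLe, NExpr.eval_get, NExpr.eval_ofNat, h₂] at ht
    refine ⟨⟨hp₂, he₂, hx₂⟩, fun hf => ?_⟩
    have : ∃ j < s.len, s.nat aTag j = s.nat aTag s.len ∧ S.Eqv (s.q S.n j) (s.q S.n s.len) := by
      by_contra! hc
      exact ht ⟨hf, hc⟩
    obtain ⟨j, hj, htag, heq⟩ := this
    exact ⟨_, Store.Has.mono ⟨j, hj, htag, fun _ _ => rfl⟩ hx₂, heq.symm⟩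

/-- Change one entry of the candidate. -/
def setCand (eI eQ eA : NExpr) : Prog :=
  .setNat aQ (.get aBase (.var aLen) + eI) eQ ;; .setNat aA (.get aBase (.var aLen) + eI) eA

theorem setCand_spec {S : Scheme} {s : Store} (he : Env S s) (hp : Pool S s) {eI eQ eA : NExpr}
    {i y z : ℕ} (hI : eI.eval s = i) (hI' : ∀ k, eI.eval (s.writeNat aQ k y) = i)
    (hQ : eQ.eval s = y) (hA : eA.eval (s.writeNat aQ (s.len * S.n + i) y) = z) :
    WP (setCand eI eQ eA) s 2 fun s' => Ext S.n s s' ∧ Pool S s' ∧ Env S s' ∧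
      ∀ x, s'.q S.n s.len x = (if x = i then y else s.q S.n s.len x) ∧
        s'.a S.n s.len x = if x = i then z else s.a S.n s.len x := by
  have hb := hp.base s.len le_rfl
  refine (WP.run (Q := fun s' => Ext S.n s s' ∧
      ∀ x, s'.q S.n s.len x = (if x = i then y else s.q S.n s.len x) ∧
        s'.a S.n s.len x = if x = i then z else s.a S.n s.len x) rfl le_rfl ?_).mono le_rfl ?_
  · simp only [setCand, Prog.run, NExpr.eval_add, NExpr.eval_get, NExpr.eval_ofNat, hI, hQ, hb, hI',
      Store.nat_writeNat_of_ne _ (show 21 ≠ 24 by decide),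
      Store.nat_writeNat_of_ne _ (show 22 ≠ 24 by decide), hA]
    refine ⟨⟨by simp, by simp, fun k hk => ?_, fun k hk => ?_⟩, fun x => ?_⟩
    · simp; omega
    · simp; omega
    · simp [Store.q, Store.a]
  · intro s' fr h
    have hfr : ∀ A, A ≠ aQ → A ≠ aA → s'.nat A = s.nat A := by
      intro A h1 h2
      refine fr.nat A ?_
      simp [setCand, Prog.writesNat, h1.symm, h2.symm]
    exact ⟨h.1, hp.of_ext h.1 (hfr _ (by decide) (by decide)) (hfr _ (by decide) (by decide)),
      he.frame fr rfl, h.2⟩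

theorem setTag_spec {S : Scheme} {s : Store} (he : Env S s) (hp : Pool S s) (eT : NExpr) :
    WP (.setNat aTag (.var aLen) eT) s 1 fun s' => Ext S.n s s' ∧ Pool S s' ∧ Env S s' ∧
      s'.nat aTag s.len = eT.eval s := by
  refine (WP.run (Q := fun s' => Ext S.n s s' ∧ s'.nat aTag s.len = eT.eval s) rfl le_rfl ?_).mono
    le_rfl ?_
  · simp only [Prog.run, NExpr.eval_get, NExpr.eval_ofNat]
    refine ⟨⟨by simp, fun j hj => ?_, by simp, by simp⟩, by simp⟩
    have : j ≠ s.nat aLen 0 := ne_of_lt hj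
    simp [this]
  · intro s' fr h
    exact ⟨h.1, hp.of_ext h.1 (fr.nat _ rfl) (fr.nat _ rfl), he.frame fr rfl, h.2⟩

/-! ### The rules for assignments and merges as programs -/

/-- Assign user `41` to facility `42` in member `34` of the pool, if possible. -/
def assignStep : Prog :=
  .when (.natLe 1 (.get aQ (.get aBase (.var 34) + .var 41)))
    (.when (.natLe 1 (.get aQ (.get aBase (.var 34) + (.get 0 2 + .var 42))))
      (.when (.realLe (.get rD (.get 0 0 + .get aCid (.var 41)) +
          .get rD (.get 0 0 + .get aCid (.get 0 2 + .var 42)) -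
          .get rD (.get aTop (.get aTag (.var 34))) - .get rD (.get aTop (.get aTag (.var 34))))
          (.var rB + .var rb + .var rb))
        (.setNat aTag (.var aLen) (.get aTag (.var 34)) ;;
          genCand (.get aQ (.get aBase (.var 34) + .var 40))
            (.get aA (.get aBase (.var 34) + .var 40)) ;;
          setCand (.var 41) (.get aQ (.get aBase (.var 34) + .var 41) - 1) (.var 42 + 1) ;;
          setCand (.get 0 2 + .var 42) (.get aQ (.get aBase (.var 34) + (.get 0 2 + .var 42)) - 1)
            (.get aA (.get aBase (.var 34) + (.get 0 2 + .var 42))) ;;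
          addCand)))

/-- This records that one rule has been applied to one fixed member. Members are never altered, so
the property survives every extension of the pool, and nothing has to be processed twice. -/
def Store.AssignRep (s : Store) (S : Scheme) (j u f : ℕ) : Prop :=
  1 ≤ s.q S.n j u → 1 ≤ s.q S.n j (S.nU + f) →
    S.Allow (s.nat aTag j) (S.cid u) (S.cid (S.nU + f)) →
    S.Rep (s.Has S.n) (s.nat aTag j)
      fun x => if x = u ∨ x = S.nU + f then s.q S.n j x - 1 else s.q S.n j x

def Store.MergeRep (s : Store) (S : Scheme) (i j : ℕ) : Prop :=
  1 ≤ S.out (s.nat aTag i) → S.mate (s.nat aTag i) = s.nat aTag j →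
    S.Rep (s.Has S.n) (S.out (s.nat aTag i)) fun x => s.q S.n i x + s.q S.n j x

theorem Store.AssignRep.mono {S : Scheme} {s s' : Store} {j u f : ℕ} (h : s.AssignRep S j u f)
    (he : Ext S.n s s') (hj : j < s.len) (hu : u < S.nU) (hf : f < S.nF) : s'.AssignRep S j u f := by
  have hq := fun x hx => (he.item (x := x) hj hx).1
  rw [Store.AssignRep, hq u (by simp only [Scheme.n]; omega),
    hq (S.nU + f) (by simp only [Scheme.n]; omega), he.tag j hj]
  intro h1 h2 h3
  refine rep_congr (rep_mono (h h1 h2 h3) he) fun x hx => ?_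
  rw [hq x hx]

theorem Store.MergeRep.mono {S : Scheme} {s s' : Store} {i j : ℕ} (h : s.MergeRep S i j)
    (he : Ext S.n s s') (hi : i < s.len) (hj : j < s.len) : s'.MergeRep S i j := by
  rw [Store.MergeRep, he.tag i hi, he.tag j hj]
  intro h1 h2
  refine rep_congr (rep_mono (h h1 h2) he) fun x hx => ?_
  rw [(he.item hi hx).1, (he.item hj hx).1]

theorem assignStep_spec {S : Scheme} {Z : ℕ} {s : Store} (hZ : Bounds S Z) (he : Env S s)
    (hp : Pool S s) {i u f : ℕ} (hi : s.nat 34 0 = i) (hil : i < s.len) (hu : s.nat 41 0 = u)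
    (huU : u < S.nU) (hf : s.nat 42 0 = f) (hfF : f < S.nF) :
    WP assignStep s (Z ^ 12) fun s' => Grow S s s' ∧ s'.AssignRep S i u f := by
  have hZ2 := pow_steps hZ.two
  have hun : u < S.n := by simp only [Scheme.n]; omega
  have hfn : S.nU + f < S.n := by simp only [Scheme.n]; omega
  have hbi := hp.base i hil.le
  have triv : ∀ h : ¬ (1 ≤ s.q S.n i u ∧ 1 ≤ s.q S.n i (S.nU + f) ∧
      S.Allow (s.nat aTag i) (S.cid u) (S.cid (S.nU + f))),
      Grow S s s ∧ s.AssignRep S i u f := fun h =>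
    ⟨⟨hp, he, .refl _ _⟩, fun h1 h2 h3 => absurd ⟨h1, h2, h3⟩ h⟩
  refine (WP.when (T := 1 + (Z ^ 3 + (2 + (2 + Z ^ 11))) + 2 + 2) (fun ht1 =>
    WP.when (fun ht2 => WP.when (fun ht3 =>
      (setTag_spec he hp _).seq fun s₁ fr₁ h₁ => ?_) fun ht3 => ?_) fun ht2 => ?_) fun ht1 => ?_).mono
    (by omega) fun _ _ h => h
  all_goals
    simp only [Test.holds_natLe, NExpr.eval_add, NExpr.eval_get, NExpr.eval_ofNat, hi, hu, hbi] at ht1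
  rotate_left 3
  · exact triv fun h => ht1 h.1
  all_goals
    simp only [Test.holds_natLe, NExpr.eval_add, NExpr.eval_get, NExpr.eval_ofNat, hi, hf, hbi,
      he.nU] at ht2
  rotate_left 2
  · exact triv fun h => ht2 h.2.1
  all_goals
    simp only [Test.holds_realLe, RExpr.eval_add, RExpr.eval_sub, RExpr.eval_get, NExpr.eval_add,
      NExpr.eval_get, NExpr.eval_ofNat, he.nV, he.nU, he.cid, he.top, he.D, he.b, he.B, hi, hu,
      hf] at ht3
  rotate_left 1
  · exact triv fun h => ht3 h.2.2
  obtain ⟨hx₁, hp₁, he₁, htag⟩ := h₁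
  simp only [NExpr.eval_get, NExpr.eval_ofNat, hi] at htag
  have l₁ : s₁.len = s.len := congrFun (fr₁.nat aLen rfl) 0
  refine (genCand_spec hZ he₁ hp₁ (fq := s.q S.n i) (fa := s.a S.n i) ?_ ?_).seq
    fun s₂ fr₂ h₂ => ?_
  · intro x hx s' hx' hex hfr
    simp only [NExpr.eval_get, NExpr.eval_add, NExpr.eval_ofNat, hx', hfr 34 (by decide) (by decide)
      (by decide), fr₁.nat 34 rfl, hi, hfr aBase (by decide) (by decide) (by decide),
      fr₁.nat aBase rfl, hbi]
    exact ((hx₁.trans hex).item hil hx).1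
  · intro x hx s' hx' hex hfr
    simp only [NExpr.eval_get, NExpr.eval_add, NExpr.eval_ofNat, hx', hfr 34 (by decide) (by decide)
      (by decide), fr₁.nat 34 rfl, hi, hfr aBase (by decide) (by decide) (by decide),
      fr₁.nat aBase rfl, hbi]
    exact ((hx₁.trans hex).item hil hx).2
  obtain ⟨hx₂, hp₂, he₂, hv₂⟩ := h₂
  have hx02 := hx₁.trans hx₂
  have l₂ : s₂.len = s.len := (congrFun (fr₂.nat aLen rfl) 0).trans l₁
  have g34 := (fr₂.nat 34 rfl).trans (fr₁.nat 34 rfl)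
  have g41 := (fr₂.nat 41 rfl).trans (fr₁.nat 41 rfl)
  have g42 := (fr₂.nat 42 rfl).trans (fr₁.nat 42 rfl)
  have g22 := (fr₂.nat aBase rfl).trans (fr₁.nat aBase rfl)
  refine (setCand_spec he₂ hp₂ (i := u) (y := s.q S.n i u - 1) (z := f + 1) ?_ ?_ ?_ ?_).seq
    fun s₃ fr₃ h₃ => ?_
  · simp [g41, hu]
  · simp [g41, hu]
  · simp only [NExpr.eval_get, NExpr.eval_add, NExpr.eval_sub, NExpr.eval_ofNat, g34, g41, g22, hi,
      hu, hbi]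
    rw [← (hx02.item hil hun).1, Store.q]
  · simp [g42, hf]
  obtain ⟨hx₃, hp₃, he₃, hv₃⟩ := h₃
  have hx03 := hx02.trans hx₃
  have l₃ : s₃.len = s.len := (congrFun (fr₃.nat aLen rfl) 0).trans l₂
  have k34 := (fr₃.nat 34 rfl).trans g34
  have k42 := (fr₃.nat 42 rfl).trans g42
  have k22 := (fr₃.nat aBase rfl).trans g22
  have hne : i * S.n + (S.nU + f) ≠ s₃.len * S.n + (S.nU + f) := by
    rw [l₃]
    have := mul_add_lt hil hfn
    omega
  refine (setCand_spec he₃ hp₃ (i := S.nU + f) (y := s.q S.n i (S.nU + f) - 1)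
    (z := s.a S.n i (S.nU + f)) ?_ ?_ ?_ ?_).seq fun s₄ fr₄ h₄ => ?_
  · simp [k42, hf, he₃.nU]
  · simp [k42, hf, he₃.nU]
  · simp only [NExpr.eval_get, NExpr.eval_add, NExpr.eval_sub, NExpr.eval_ofNat, k34, k42, k22, hi,
      hf, hbi, he₃.nU]
    rw [← (hx03.item hil hfn).1, Store.q]
  · simp [k34, k42, k22, hi, hf, hbi, he₃.nU]
    rw [← (hx03.item hil hfn).2, Store.a]
  obtain ⟨hx₄, hp₄, he₄, hv₄⟩ := h₄
  have hx04 := hx03.trans hx₄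
  have l₄ : s₄.len = s.len := (congrFun (fr₄.nat aLen rfl) 0).trans l₃
  have t₄ : s₄.nat aTag s₄.len = s.nat aTag i := by
    rw [l₄, fr₄.nat aTag rfl, fr₃.nat aTag rfl, fr₂.nat aTag rfl, htag]
  have hq : ∀ x < S.n, s₄.q S.n s₄.len x =
      if x = u ∨ x = S.nU + f then s.q S.n i x - 1 else s.q S.n i x := by
    intro x hx
    have h4 := (hv₄ x).1
    have h3 := (hv₃ x).1
    have h2 := (hv₂ x hx).1
    rw [l₃] at h4
    rw [l₂] at h3
    rw [l₁] at h2
    rw [l₄, h4, h3, h2]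
    by_cases e : x = S.nU + f
    · subst e; simp
    · by_cases e' : x = u
      · subst e'; simp [e]
      · simp [e, e']
  have ha : ∀ x < S.n, s₄.a S.n s₄.len x = if x = u then f + 1 else s.a S.n i x := by
    intro x hx
    have h4 := (hv₄ x).2
    have h3 := (hv₃ x).2
    have h2 := (hv₂ x hx).2
    rw [l₃] at h4
    rw [l₂] at h3
    rw [l₁] at h2
    rw [l₄, h4, h3, h2]
    by_cases e : x = S.nU + f
    · subst e; simp [show S.nU + f ≠ u by omega]
    · simp [e]
  refine (addCand_spec hZ he₄ hp₄ ?_).mono le_rfl fun s₅ _ h₅ => ?_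
  · rw [t₄]
    exact ((hp.der i hil).assign huU hfF ht1 ht2 ht3).congr (fun x hx => (hq x hx).symm)
      fun x hx => (ha x hx).symm
  · have hx05 := hx04.trans h₅.1.ext
    refine ⟨⟨h₅.1.pool, h₅.1.env, hx05⟩, fun _ _ _ => ?_⟩
    rw [hx05.tag i hil, ← t₄]
    refine rep_congr h₅.2 fun x hx => ?_
    rw [hq x hx, (hx05.item hil hx).1]

/-- Merge the members `32` and `33` of the pool, if their tags are mates. -/
def mergeStep : Prog :=
  .when (.natLe 1 (.get aOut (.get aTag (.var 32))))
    (.whenEq (.get aMate (.get aTag (.var 32))) (.get aTag (.var 33))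
      (.setNat aTag (.var aLen) (.get aOut (.get aTag (.var 32))) ;;
        genCand (.get aQ (.get aBase (.var 32) + .var 40) + .get aQ (.get aBase (.var 33) + .var 40))
          (.get aA (.get aBase (.var 32) + .var 40) + .get aA (.get aBase (.var 33) + .var 40)) ;;
        addCand))

theorem mergeStep_spec {S : Scheme} {Z : ℕ} {s : Store} (hZ : Bounds S Z) (he : Env S s)
    (hp : Pool S s) {i j : ℕ} (hi : s.nat 32 0 = i) (hil : i < s.len) (hj : s.nat 33 0 = j)
    (hjl : j < s.len) :
    WP mergeStep s (Z ^ 12) fun s' => Grow S s s' ∧ s'.MergeRep S i j := by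
  have hZ2 := pow_steps hZ.two
  have hbi := hp.base i hil.le
  have hbj := hp.base j hjl.le
  have triv : ∀ h : ¬ (1 ≤ S.out (s.nat aTag i) ∧ S.mate (s.nat aTag i) = s.nat aTag j),
      Grow S s s ∧ s.MergeRep S i j := fun h =>
    ⟨⟨hp, he, .refl _ _⟩, fun h1 h2 => absurd ⟨h1, h2⟩ h⟩
  refine (WP.when (T := 1 + (Z ^ 3 + Z ^ 11) + 4) (fun ht1 =>
    WP.whenEq (fun ht2 => (setTag_spec he hp _).seq fun s₁ fr₁ h₁ => ?_) fun ht2 => ?_)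
    fun ht1 => ?_).mono (by omega) fun _ _ h => h
  all_goals
    simp only [Test.holds_natLe, NExpr.eval_add, NExpr.eval_get, NExpr.eval_ofNat, hi, he.out] at ht1
  rotate_left 2
  · exact triv fun h => ht1 h.1
  all_goals
    simp only [Test.holds_natLe, NExpr.eval_add, NExpr.eval_get, NExpr.eval_ofNat, hi, hj,
      he.mate] at ht2
  rotate_left 1
  · exact triv fun h => ht2 h.2
  obtain ⟨hx₁, hp₁, he₁, htag⟩ := h₁
  simp only [NExpr.eval_get, NExpr.eval_ofNat, hi, he.out] at htag
  have l₁ : s₁.len = s.len := congrFun (fr₁.nat aLen rfl) 0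
  refine (genCand_spec hZ he₁ hp₁ (fq := fun x => s.q S.n i x + s.q S.n j x)
    (fa := fun x => s.a S.n i x + s.a S.n j x) ?_ ?_).seq fun s₂ fr₂ h₂ => ?_
  · intro x hx s' hx' hex hfr
    simp only [NExpr.eval_get, NExpr.eval_add, NExpr.eval_ofNat, hx', hfr 32 (by decide) (by decide)
      (by decide), hfr 33 (by decide) (by decide) (by decide), fr₁.nat 32 rfl, fr₁.nat 33 rfl, hi, hj,
      hfr aBase (by decide) (by decide) (by decide), fr₁.nat aBase rfl, hbi, hbj]
    rw [← ((hx₁.trans hex).item hil hx).1, ← ((hx₁.trans hex).item hjl hx).1, Store.q, Store.q]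
  · intro x hx s' hx' hex hfr
    simp only [NExpr.eval_get, NExpr.eval_add, NExpr.eval_ofNat, hx', hfr 32 (by decide) (by decide)
      (by decide), hfr 33 (by decide) (by decide) (by decide), fr₁.nat 32 rfl, fr₁.nat 33 rfl, hi, hj,
      hfr aBase (by decide) (by decide) (by decide), fr₁.nat aBase rfl, hbi, hbj]
    rw [← ((hx₁.trans hex).item hil hx).2, ← ((hx₁.trans hex).item hjl hx).2, Store.a, Store.a]
  obtain ⟨hx₂, hp₂, he₂, hv₂⟩ := h₂
  have hx02 := hx₁.trans hx₂
  have l₂ : s₂.len = s.len := (congrFun (fr₂.nat aLen rfl) 0).trans l₁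
  have t₂ : s₂.nat aTag s₂.len = S.out (s.nat aTag i) := by
    rw [l₂, fr₂.nat aTag rfl, htag]
  rw [l₁, ← l₂] at hv₂
  refine (addCand_spec hZ he₂ hp₂ ?_).mono le_rfl fun s₅ _ h₅ => ?_
  · rw [t₂]
    exact ((hp.der i hil).merge (ht2 ▸ hp.der j hjl) ht1).congr (fun x hx => (hv₂ x hx).1.symm)
      fun x hx => (hv₂ x hx).2.symm
  · have hx05 := hx02.trans h₅.1.ext
    refine ⟨⟨h₅.1.pool, h₅.1.env, hx05⟩, fun _ _ => ?_⟩
    rw [hx05.tag i hil, ← t₂]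
    refine rep_congr h₅.2 fun x hx => ?_
    rw [(hv₂ x hx).1, (hx05.item hil hx).1, (hx05.item hjl hx).1]

/-! ### Closing the pool under the rules -/

/-- Apply all rules to member `34` of the pool and to the previous members. -/
def expand : Prog :=
  .for 41 (.get 0 2) (.for 42 (.get 0 3) assignStep) ;;
  .for 47 (.var 34 + 1) (.setNat 32 0 (.var 34) ;; .setNat 33 0 (.var 47) ;; mergeStep ;;
    .setNat 32 0 (.var 47) ;; .setNat 33 0 (.var 34) ;; mergeStep)

theorem Pool.of_frame {S : Scheme} {s s' : Store} {p : Prog} (hp : Pool S s) (fr : Frame p s s')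
    (h : (p.writesNat aLen || p.writesNat aBase || p.writesNat aTag || p.writesNat aQ ||
      p.writesNat aA) = false) : Pool S s' ∧ Ext S.n s s' := by
  simp only [Bool.or_eq_false_iff] at h
  obtain ⟨⟨⟨⟨h1, h2⟩, h3⟩, h4⟩, h5⟩ := h
  have := Ext.of_nat (n := S.n) (fr.nat _ h1) (fr.nat _ h3) (fr.nat _ h4) (fr.nat _ h5)
  exact ⟨hp.of_ext this (fr.nat _ h1) (fr.nat _ h2), this⟩

theorem Grow.of_frame {S : Scheme} {s s' : Store} {p : Prog} (hp : Pool S s) (he : Env S s)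
    (fr : Frame p s s') (h : (p.writesNat aLen || p.writesNat aBase || p.writesNat aTag ||
      p.writesNat aQ || p.writesNat aA) = false) (h' : p.safe = true) : Grow S s s' :=
  ⟨(hp.of_frame fr h).1, he.frame fr h', (hp.of_frame fr h).2⟩

/-- Merges with members `j ≤ i` suffice, in both orders because only one of the two tags carries the
merge: every pair is treated when its larger index is expanded. Members added meanwhile have larger
indices. -/
theorem expand_spec {S : Scheme} {Z : ℕ} {s : Store} (hZ : Bounds S Z) (he : Env S s)
    (hp : Pool S s) {i : ℕ} (hi : s.nat 34 0 = i) (hil : i < s.len) :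
    WP expand s (Z ^ 17) fun s' => Grow S s s' ∧
      (∀ u < S.nU, ∀ f < S.nF, s'.AssignRep S i u f) ∧
      ∀ j ≤ i, s'.MergeRep S i j ∧ s'.MergeRep S j i := by
  have hZ2 := pow_steps hZ.two
  have hlen := hZ.pool s hp
  refine (WP.seq (T₁ := Z ^ 16) (T₂ := Z ^ 16) (R := fun s' => Grow S s s' ∧
      ∀ u < S.nU, ∀ f < S.nF, s'.AssignRep S i u f) ?_ ?_).mono (by omega) fun _ _ h => h
  · refine (WP.for (N := S.nU) (T := Z ^ 14) (fun k s' => Grow S s s' ∧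
      ∀ u < k, ∀ f < S.nF, s'.AssignRep S i u f) rfl ?_ ?_ ?_).mono
      (for_le_pow 14 hZ.two (by have := hZ.nU; omega) le_rfl le_rfl) fun _ _ h => h
    · intro s' fr
      simp [fr.nat 0 rfl, he.nU]
    · exact ⟨Grow.of_frame hp he (p := .setNat 41 0 0) (Exec.setNat _ _ _ _).frame rfl rfl, by simp⟩
    · rintro k hk s₁ fr₁ hc ⟨hg₁, h₁⟩
      have fi := (congrFun (fr₁.nat 34 rfl) 0).trans hi
      refine (WP.for (N := S.nF) (T := Z ^ 12) (fun m s' => Grow S s₁ s' ∧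
        ∀ f < m, s'.AssignRep S i k f) rfl ?_ ?_ ?_).mono
        (for_le_pow 12 hZ.two hZ.nF le_rfl le_rfl) ?_
      · intro s' fr
        simp [fr.nat 0 rfl, hg₁.env.nF]
      · exact ⟨Grow.of_frame hg₁.pool hg₁.env (p := .setNat 42 0 0) (Exec.setNat _ _ _ _).frame rfl
          rfl, by simp⟩
      · rintro m hm s₂ fr₂ hc₂ ⟨hg₂, h₂⟩
        have gi := (congrFun (fr₂.nat 34 rfl) 0).trans fi
        have g41 := (congrFun (fr₂.nat 41 rfl) 0).trans hc
        have hil₂ := (hil.trans_le hg₁.ext.len).trans_le hg₂.ext.len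
        refine (assignStep_spec hZ hg₂.env hg₂.pool gi hil₂ g41 hk hc₂ hm).mono le_rfl ?_
        rintro s₃ _ ⟨hg₃, h₃⟩
        have hw : Grow S s₃ (s₃.writeNat 42 0 (m + 1)) := Grow.of_frame hg₃.pool hg₃.env
          (p := .setNat 42 0 (.const (m + 1))) (Exec.setNat _ _ _ _).frame rfl rfl
        refine ⟨hg₂.trans (hg₃.trans hw), fun f hf => ?_⟩
        rcases Nat.lt_succ_iff_lt_or_eq.1 hf with h | rfl
        · exact (h₂ f h).mono (hg₃.trans hw).ext hil₂ hk (h.trans hm)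
        · exact h₃.mono hw.ext (hil₂.trans_le hg₃.ext.len) hk hm
      · rintro s₂ _ ⟨hg₂, h₂⟩
        have hw : Grow S s₂ (s₂.writeNat 41 0 (k + 1)) := Grow.of_frame hg₂.pool hg₂.env
          (p := .setNat 41 0 (.const (k + 1))) (Exec.setNat _ _ _ _).frame rfl rfl
        refine ⟨hg₁.trans (hg₂.trans hw), fun u hu f hf => ?_⟩
        rcases Nat.lt_succ_iff_lt_or_eq.1 hu with h | rfl
        · exact (h₁ u h f hf).mono (hg₂.trans hw).ext (hil.trans_le hg₁.ext.len) (h.trans hk) hf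
        · exact (h₂ f hf).mono hw.ext (hil.trans_le (hg₁.trans hg₂).ext.len) hk hf
  · rintro s₁ fr₁ ⟨hg₁, h₁⟩
    have fi := (congrFun (fr₁.nat 34 rfl) 0).trans hi
    have hil₁ := hil.trans_le hg₁.ext.len
    refine (WP.for (N := i + 1) (T := Z ^ 13) (fun k s' => Grow S s₁ s' ∧
      ∀ j < k, s'.MergeRep S i j ∧ s'.MergeRep S j i) rfl ?_ ?_ ?_).mono
      (for_le_pow 13 hZ.two (by omega) le_rfl (by omega)) ?_
    · intro s' fr
      simp [fr.nat 34 rfl, fi]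
    · exact ⟨Grow.of_frame hg₁.pool hg₁.env (p := .setNat 47 0 0) (Exec.setNat _ _ _ _).frame rfl
        rfl, by simp⟩
    · rintro k hk s₂ fr₂ hc ⟨hg₂, h₂⟩
      have gi := (congrFun (fr₂.nat 34 rfl) 0).trans fi
      have hil₂ := hil₁.trans_le hg₂.ext.len
      have hkl : k < s₂.len := by omega
      refine ((WP.run (p := .setNat 32 0 (.var 34)) (Q := fun s => s.nat 32 0 = i) rfl le_rfl
        (by simp [Prog.run, gi])).seq (T₂ := 1 + (Z ^ 12 + (1 + (1 + Z ^ 12)))) fun s₃ fr₃ h32 =>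
        (WP.run (p := .setNat 33 0 (.var 47)) (Q := fun s => s.nat 33 0 = k) rfl le_rfl
        (by simp [Prog.run, fr₃.nat 47 rfl, hc])).seq fun s₄ fr₄ h33 => ?_).mono
        (by simp only [Prog.size]; omega) fun _ _ h => h
      have hg₃ := Grow.of_frame hg₂.pool hg₂.env fr₃ rfl rfl
      have hg₄ := hg₃.trans (Grow.of_frame hg₃.pool hg₃.env fr₄ rfl rfl)
      have l34 : s₂.len ≤ s₄.len := hg₄.ext.len
      refine (mergeStep_spec hZ hg₄.env hg₄.pool (i := i) (j := k)
        ((congrFun (fr₄.nat 32 rfl) 0).trans h32) (by omega) h33 (by omega)).seq ?_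
      rintro s₅ fr₅ ⟨hg₅, h₅⟩
      have l5 : s₄.len ≤ s₅.len := hg₅.ext.len
      have c34 : s₅.nat 34 0 = i := by rw [fr₅.nat 34 rfl, fr₄.nat 34 rfl, fr₃.nat 34 rfl, gi]
      have c47 : s₅.nat 47 0 = k := by rw [fr₅.nat 47 rfl, fr₄.nat 47 rfl, fr₃.nat 47 rfl, hc]
      refine (WP.run (p := .setNat 32 0 (.var 47)) (Q := fun s => s.nat 32 0 = k) rfl le_rfl
        (by simp [Prog.run, c47])).seq fun s₆ fr₆ h32' =>
        (WP.run (p := .setNat 33 0 (.var 34)) (Q := fun s => s.nat 33 0 = i) rfl le_rfl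
        (by simp [Prog.run, fr₆.nat 34 rfl, c34])).seq fun s₇ fr₇ h33' => ?_
      have hg₆ := Grow.of_frame hg₅.pool hg₅.env fr₆ rfl rfl
      have hg₇ := hg₆.trans (Grow.of_frame hg₆.pool hg₆.env fr₇ rfl rfl)
      have l7 : s₅.len ≤ s₇.len := hg₇.ext.len
      refine (mergeStep_spec hZ hg₇.env hg₇.pool (i := k) (j := i)
        ((congrFun (fr₇.nat 32 rfl) 0).trans h32') (by omega) h33' (by omega)).mono le_rfl ?_
      rintro s₈ _ ⟨hg₈, h₈⟩
      have l8 : s₇.len ≤ s₈.len := hg₈.ext.len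
      have hw : Grow S s₈ (s₈.writeNat 47 0 (k + 1)) := Grow.of_frame hg₈.pool hg₈.env
        (p := .setNat 47 0 (.const (k + 1))) (Exec.setNat _ _ _ _).frame rfl rfl
      have hx5 := (hg₇.trans (hg₈.trans hw)).ext
      have hx2 := (hg₄.trans hg₅).ext.trans hx5
      refine ⟨hg₂.trans (hg₄.trans (hg₅.trans (hg₇.trans (hg₈.trans hw)))), fun j hj => ?_⟩
      rcases Nat.lt_succ_iff_lt_or_eq.1 hj with h | rfl
      · exact ⟨(h₂ j h).1.mono hx2 hil₂ (by omega), (h₂ j h).2.mono hx2 (by omega) hil₂⟩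
      · exact ⟨h₅.mono hx5 (by omega) (by omega), h₈.mono hw.ext (by omega) (by omega)⟩
    · rintro s₂ _ ⟨hg₂, h₂⟩
      exact ⟨hg₁.trans hg₂, fun u hu f hf => (h₁ u hu f hf).mono hg₂.ext hil₁ hu hf,
        fun j hj => h₂ j (by omega)⟩

/-- Close the pool under the rules. -/
def saturate : Prog :=
  .setNat 34 0 0 ;; .loop (.natLe (.var 34 + 1) (.var aLen)) (expand ;; .setNat 34 0 (.var 34 + 1))

/-- The pool is its own work list. The counter stays below the length of the pool, which never
exceeds `Z`; when it reaches the length, all members and all pairs have been treated. -/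
theorem saturate_spec {S : Scheme} {Z : ℕ} {s : Store} (hZ : Bounds S Z) (he : Env S s)
    (hp : Pool S s) :
    WP saturate s (Z ^ 21) fun s' => Grow S s s' ∧
      (∀ j < s'.len, ∀ u < S.nU, ∀ f < S.nF, s'.AssignRep S j u f) ∧
      ∀ i < s'.len, ∀ j < s'.len, s'.MergeRep S i j := by
  have hZ2 := pow_steps hZ.two
  refine ((WP.run (p := .setNat 34 0 0) (Q := fun s => s.nat 34 0 = 0) rfl le_rfl
    (by simp [Prog.run])).seq (T₂ := Z ^ 20) fun s₀ fr₀ h₀ => ?_).mono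
    (by simp only [Prog.size]; omega) fun _ _ h => h
  have hg₀ := Grow.of_frame hp he fr₀ rfl rfl
  refine (WP.loop (N := Z) (T := Z ^ 18) (Inv := fun k s' => Grow S s s' ∧ s'.nat 34 0 = k ∧
    k ≤ s'.len ∧ (∀ j < k, ∀ u < S.nU, ∀ f < S.nF, s'.AssignRep S j u f) ∧
      ∀ i < k, ∀ j < k, s'.MergeRep S i j) ?_ ?_).mono
      (loop_le_pow 18 hZ.two le_rfl le_rfl le_rfl) ?_
  · rintro k s₁ fr₁ ⟨hg₁, hk, hkl, h₁, h₁'⟩ ht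
    simp only [Test.holds_natLe, NExpr.eval_add, NExpr.eval_get, NExpr.eval_ofNat, hk] at ht
    have hkl' : k < s₁.len := ht
    have hlZ := hZ.pool s₁ hg₁.pool
    refine ⟨by omega, ((expand_spec hZ hg₁.env hg₁.pool hk hkl').seq (T₂ := 1) ?_).mono (by omega)
      fun _ _ h => h⟩
    rintro s₂ fr₂ ⟨hg₂, h₂, h₂'⟩
    refine (WP.run (Q := fun s => s.nat 34 0 = k + 1) rfl le_rfl
      (by simp [Prog.run, fr₂.nat 34 rfl, hk])).mono le_rfl fun s₃ fr₃ h₃ => ?_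
    have hg₃ := Grow.of_frame hg₂.pool hg₂.env fr₃ rfl rfl
    have hg13 := hg₂.trans hg₃
    have l2 : s₁.len ≤ s₂.len := hg₂.ext.len
    have l3 : s₁.len ≤ s₃.len := hg13.ext.len
    refine ⟨hg₁.trans hg13, h₃, by omega, fun j hj u hu f hf => ?_, fun i hi j hj => ?_⟩
    · rcases Nat.lt_succ_iff_lt_or_eq.1 hj with h | rfl
      · exact (h₁ j h u hu f hf).mono hg13.ext (by omega) hu hf
      · exact (h₂ u hu f hf).mono hg₃.ext (by omega) hu hf
    · by_cases hik : i = k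
      · subst hik
        exact (h₂' j (by omega)).1.mono hg₃.ext (by omega) (by omega)
      · by_cases hjk : j = k
        · subst hjk
          exact (h₂' i (by omega)).2.mono hg₃.ext (by omega) (by omega)
        · exact (h₁' i (by omega) j (by omega)).mono hg13.ext (by omega) (by omega)
  · exact ⟨hg₀, h₀, by omega, by simp, by simp⟩
  · rintro s₁ _ ⟨ht, k, _, hg₁, hk, hkl, h₁, h₁'⟩
    simp only [Test.holds_natLe, NExpr.eval_add, NExpr.eval_get, NExpr.eval_ofNat, hk] at ht
    have : k = s₁.len := le_antisymm hkl (by simp only [Store.len]; omega)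
    subst this
    exact ⟨hg₁, h₁, h₁'⟩

/-! ### The partial solutions of single nodes -/

/-- Add the candidate with tag `eT` and `eM` pending items at `eI`. -/
def baseCand (eT eI eM : NExpr) : Prog :=
  .setNat aTag (.var aLen) eT ;; genCand 0 0 ;; setCand eI eM 0 ;; addCand

theorem baseCand_spec {S : Scheme} {Z : ℕ} {s : Store} (hZ : Bounds S Z) (he : Env S s)
    (hp : Pool S s) {eT eI eM : NExpr} {t i m : ℕ} (hT : eT.eval s = t)
    (hev : ∀ s', (∀ A, A ≠ aTag → A ≠ aQ → A ≠ aA → A ≠ 40 → s'.nat A = s.nat A) →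
      eI.eval s' = i ∧ eM.eval s' = m)
    (hd : S.Der t (fun x => if x = i then m else 0) fun _ => 0) :
    WP (baseCand eT eI eM) s (Z ^ 12) fun s' => Grow S s s' ∧
      S.Rep (s'.Has S.n) t fun x => if x = i then m else 0 := by
  have hZ2 := pow_steps hZ.two
  refine (WP.mono (T := 1 + (Z ^ 3 + (2 + Z ^ 11))) ((setTag_spec he hp _).seq fun s₁ fr₁ h₁ => ?_)
    (by omega) fun _ _ h => h)
  obtain ⟨hx₁, hp₁, he₁, htag⟩ := h₁
  rw [hT] at htag
  have l₁ : s₁.len = s.len := congrFun (fr₁.nat aLen rfl) 0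
  refine (genCand_spec hZ he₁ hp₁ (fq := fun _ => 0) (fa := fun _ => 0) (fun _ _ _ _ _ _ => rfl)
    fun _ _ _ _ _ _ => rfl).seq fun s₂ fr₂ h₂ => ?_
  obtain ⟨hx₂, hp₂, he₂, hv₂⟩ := h₂
  have l₂ : s₂.len = s.len := (congrFun (fr₂.nat aLen rfl) 0).trans l₁
  have fr02 : ∀ A, A ≠ aTag → A ≠ aQ → A ≠ aA → A ≠ 40 → s₂.nat A = s.nat A := by
    intro A h1 h2 h3 h4
    rw [fr₂.nat A (by simp [genCand, Prog.for, Prog.writesNat, h2.symm, h3.symm, h4.symm]),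
      fr₁.nat A (by simp [Prog.writesNat, h1.symm])]
  refine (setCand_spec he₂ hp₂ (i := i) (y := m) (z := 0) (hev _ fr02).1 ?_ (hev _ fr02).2 rfl).seq
    fun s₃ fr₃ h₃ => ?_
  · intro k
    refine (hev _ fun A h1 h2 h3 h4 => ?_).1
    rw [Store.nat_writeNat_of_ne _ h2, fr02 A h1 h2 h3 h4]
  obtain ⟨hx₃, hp₃, he₃, hv₃⟩ := h₃
  have l₃ : s₃.len = s.len := (congrFun (fr₃.nat aLen (by simp [setCand, Prog.writesNat])) 0).trans l₂
  have t₃ : s₃.nat aTag s₃.len = t := by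
    rw [l₃, fr₃.nat aTag rfl, fr₂.nat aTag rfl, htag]
  have hqa : ∀ x < S.n, s₃.q S.n s₃.len x = (if x = i then m else 0) ∧ s₃.a S.n s₃.len x = 0 := by
    intro x hx
    have h3 := hv₃ x
    have h2 := hv₂ x hx
    rw [l₂] at h3
    rw [l₁] at h2
    rw [l₃, h3.1, h3.2, h2.1, h2.2]
    simp
  refine (addCand_spec hZ he₃ hp₃ ?_).mono le_rfl fun s₅ _ h₅ => ?_
  · rw [t₃]
    exact hd.congr (fun x hx => (hqa x hx).1.symm) fun x hx => (hqa x hx).2.symm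
  · refine ⟨⟨h₅.1.pool, h₅.1.env, ((hx₁.trans hx₂).trans hx₃).trans h₅.1.ext⟩, ?_⟩
    rw [← t₃]
    exact rep_congr h₅.2 fun x hx => (hqa x hx).1.symm

theorem Grow.refl {S : Scheme} {s : Store} (he : Env S s) (hp : Pool S s) : Grow S s s :=
  ⟨hp, he, .refl _ _⟩

theorem Grow.writeCounter {S : Scheme} {s s' : Store} (hg : Grow S s s') {i : ℕ} (hi : 40 ≤ i)
    (k : ℕ) : Grow S s (s'.writeNat i 0 k) := by
  refine hg.trans (Grow.of_frame hg.pool hg.env (p := .setNat i 0 (.const k))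
    (Exec.setNat _ _ _ _).frame ?_ ?_)
  · simp only [Prog.writesNat, Bool.or_eq_false_iff, beq_eq_false_iff_ne]; omega
  · simp only [Prog.safe, Prog.writesNat, Prog.writesReal, List.all_cons, List.all_nil,
      Bool.and_true, Bool.and_eq_true, Bool.not_eq_true', beq_eq_false_iff_ne, Bool.not_false,
      and_true]
    omega

/-- If `P` persists when the pool grows, what the rounds achieve accumulates. -/
theorem WP.growLoop {S : Scheme} {s : Store} {i : ℕ} {b : NExpr} {p : Prog} {N T : ℕ}
    (P : ℕ → Store → Prop) (hP : ∀ k s s', P k s → Ext S.n s s' → P k s') (hi : 40 ≤ i)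
    (hw : p.writesNat i = false) (hg : Grow S s s) (hb : ∀ s', Env S s' → b.eval s' = N)
    (hsafe : (Prog.for i b p).safe = true)
    (hbody : ∀ k < N, ∀ s', Frame (.for i b p) s s' → Grow S s s' → s'.nat i 0 = k →
      WP p s' T fun s'' => Grow S s' s'' ∧ P k s'') :
    WP (.for i b p) s (N * (T + 2) + 2) fun s' => Grow S s s' ∧ ∀ k < N, P k s' := by
  refine WP.for (fun k s' => Grow S s s' ∧ ∀ j < k, P j s') hw
    (fun s' fr => hb s' (hg.env.frame fr hsafe)) ⟨hg.writeCounter hi 0, by simp⟩ ?_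
  rintro k hk s₁ fr₁ hc ⟨hg₁, h₁⟩
  refine (hbody k hk s₁ fr₁ hg₁ hc).mono le_rfl ?_
  rintro s₂ _ ⟨hg₂, h₂⟩
  have hg₃ := hg₂.writeCounter hi (k + 1)
  refine ⟨hg₁.trans hg₃, fun j hj => ?_⟩
  rcases Nat.lt_succ_iff_lt_or_eq.1 hj with h | rfl
  · exact hP _ _ _ (h₁ j h) hg₃.ext
  · exact hP _ _ _ h₂ ((Grow.refl hg₂.env hg₂.pool).writeCounter hi (j + 1)).ext

def facilityCand : Prog :=
  baseCand (.get 0 0 + (.get 0 2 + .var 41)) (.get 0 2 + .var 41) (.var 42)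

/-- Start the pool with the partial solutions of single nodes. -/
def initPool : Prog :=
  .setNat aLen 0 0 ;; .setNat aBase 0 0 ;;
  .for 41 (.get 0 0) (baseCand (.var 41) 0 0) ;;
  .for 41 (.get 0 2) (baseCand (.get 0 0 + .var 41) (.var 41) 1) ;;
  .for 41 (.get 0 3) (.for 42 (.get 0 2 + 1) (.ite (.natLe (.var 42) 0) facilityCand
    (.when (.natLe (.get 0 4) (.var 42)) facilityCand)))

theorem facilityCand_spec {S : Scheme} {Z : ℕ} {s : Store} (hZ : Bounds S Z) (hg : Grow S s s)
    {f m : ℕ} (hf : s.nat 41 0 = f) (hfF : f < S.nF) (hm : s.nat 42 0 = m) (hmU : m ≤ S.nU)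
    (hr : m = 0 ∨ S.r ≤ m) :
    WP facilityCand s (Z ^ 12) fun s' => Grow S s s' ∧
      S.Rep (s'.Has S.n) (S.nV + (S.nU + f)) fun x => if x = S.nU + f then m else 0 := by
  refine baseCand_spec hZ hg.env hg.pool ?_ ?_ (.facility hfF hmU hr)
  · simp [hg.env.nV, hg.env.nU, hf]
  · intro s' h
    simp [h 0 (by decide) (by decide) (by decide) (by decide), h 41 (by decide) (by decide)
      (by decide) (by decide), h 42 (by decide) (by decide) (by decide) (by decide), hg.env.nU, hf, hm]

/-- Setting the length to zero discards what an earlier threshold has left behind, so nothing is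
assumed about the pool in `s`, and the result does not extend it. -/
theorem initPool_spec {S : Scheme} {Z : ℕ} {s : Store} (hZ : Bounds S Z) (he : Env S s) :
    WP initPool s (Z ^ 18) fun s' => Grow S s' s' ∧
      (∀ k < S.nV, S.Rep (s'.Has S.n) k fun _ => 0) ∧
      (∀ u < S.nU, S.Rep (s'.Has S.n) (S.nV + u) fun x => if x = u then 1 else 0) ∧
      ∀ f < S.nF, ∀ m < S.nU + 1, m = 0 ∨ S.r ≤ m →
        S.Rep (s'.Has S.n) (S.nV + (S.nU + f)) fun x => if x = S.nU + f then m else 0 := by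
  have hZ2 := pow_steps hZ.two
  refine (WP.seq (T₁ := 1) (T₂ := 1 + (Z ^ 14 + (Z ^ 14 + Z ^ 17))) (R := fun s' => s'.nat aLen 0 = 0)
    (WP.run rfl le_rfl (by simp [Prog.run])) fun s₁ fr₁ h₁ => WP.seq
    (R := fun s' => s'.nat aBase 0 = 0) (WP.run rfl le_rfl (by simp [Prog.run]))
      fun s₂ fr₂ h₂ => ?_).mono (by omega) fun _ _ h => h
  have l₂ : s₂.len = 0 := (congrFun (fr₂.nat aLen rfl) 0).trans h₁
  have hg₂ : Grow S s₂ s₂ := by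
    refine .refl ((he.frame fr₁ rfl).frame fr₂ rfl) ⟨fun j hj => ?_, ?_, ?_, ?_⟩
    · obtain rfl : j = 0 := by omega
      simp [h₂]
    all_goals intros; omega
  refine ((WP.growLoop (N := S.nV) (T := Z ^ 12) (fun k s' => S.Rep (s'.Has S.n) k fun _ => 0)
    (fun _ _ _ => rep_mono) (by omega) rfl hg₂ (fun s' h => by simp [h.nV]) rfl
    fun k hk s' _ hg hc => ?_).mono (for_le_pow 12 hZ.two hZ.nV le_rfl le_rfl)
      fun _ _ h => h).seq fun s₃ fr₃ h₃ => ?_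
  -- A vertex carries no items; writing `0` at index `0` leaves the candidate empty.
  · refine (baseCand_spec hZ hg.env hg.pool (t := k) (i := 0) (m := 0) (by simp [hc])
      (fun _ _ => ⟨rfl, rfl⟩) ?_).mono le_rfl fun s'' _ h => ⟨h.1, rep_congr h.2 (by simp)⟩
    exact (Scheme.Der.vertex hk).congr (by simp) fun _ _ => rfl
  have hg₃ : Grow S s₃ s₃ := .refl h₃.1.env h₃.1.pool
  refine ((WP.growLoop (N := S.nU) (T := Z ^ 12) (fun u s' => S.Rep (s'.Has S.n) (S.nV + u)
    fun x => if x = u then 1 else 0)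
    (fun _ _ _ => rep_mono) (by omega) rfl hg₃ (fun s' h => by simp [h.nU]) rfl
    fun k hk s' _ hg hc => ?_).mono (for_le_pow 12 hZ.two (by have := hZ.nU; omega) le_rfl le_rfl)
      fun _ _ h => h).seq fun s₄ fr₄ h₄ => ?_
  · refine baseCand_spec hZ hg.env hg.pool (t := S.nV + k) (i := k) (m := 1)
      (by simp [hc, hg.env.nV]) (fun s'' h => ?_) (.user hk)
    simp [h 41 (by decide) (by decide) (by decide) (by decide), hc]
  have hg₄ : Grow S s₄ s₄ := .refl h₄.1.env h₄.1.pool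
  refine (WP.growLoop (N := S.nF) (T := Z ^ 15) (fun f s' => ∀ m < S.nU + 1, m = 0 ∨ S.r ≤ m →
      S.Rep (s'.Has S.n) (S.nV + (S.nU + f)) fun x => if x = S.nU + f then m else 0)
    (fun _ _ _ h hx m hm hr => rep_mono (h m hm hr) hx) (by omega) rfl hg₄
    (fun s' h => by simp [h.nF]) rfl fun f hf s' _ hg hc => ?_).mono
      (for_le_pow 15 hZ.two hZ.nF le_rfl le_rfl) fun s₅ _ h₅ => ?_
  · have hg' : Grow S s' s' := .refl hg.env hg.pool
    refine (WP.growLoop (N := S.nU + 1) (T := Z ^ 13) (fun m s' => m = 0 ∨ S.r ≤ m →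
      S.Rep (s'.Has S.n) (S.nV + (S.nU + f)) fun x => if x = S.nU + f then m else 0)
      (fun _ _ _ h hx hr => rep_mono (h hr) hx) (by omega) rfl hg'
      (fun s' h => by simp [h.nU]) rfl fun m hm s'' fr'' hg hc' => ?_).mono
      (for_le_pow 13 hZ.two hZ.nU le_rfl le_rfl) fun _ _ h => h
    have hg'' : Grow S s'' s'' := .refl hg.env hg.pool
    have c41 := (congrFun (fr''.nat 41 rfl) 0).trans hc
    refine (WP.ite (T := Z ^ 12 + 2) (fun ht => ?_) fun ht => ?_).mono (by omega) fun _ _ h => h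
    · simp only [Test.holds_natLe, NExpr.eval_get, NExpr.eval_ofNat, hc', Nat.le_zero] at ht
      exact (facilityCand_spec hZ hg'' c41 hf hc' (by omega) (.inl ht)).mono (by omega)
        fun _ _ h => ⟨h.1, fun _ => h.2⟩
    · simp only [Test.holds_natLe, NExpr.eval_get, NExpr.eval_ofNat, hc', Nat.le_zero] at ht
      refine WP.when (fun ht' => ?_) fun ht' => ?_
      · simp only [Test.holds_natLe, NExpr.eval_get, NExpr.eval_ofNat, hc', hg.env.r] at ht'
        exact (facilityCand_spec hZ hg'' c41 hf hc' (by omega) (.inr ht')).mono le_rfl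
          fun _ _ h => ⟨h.1, fun _ => h.2⟩
      · simp only [Test.holds_natLe, NExpr.eval_get, NExpr.eval_ofNat, hc', hg.env.r] at ht'
        exact ⟨hg'', fun h => absurd h (by tauto)⟩
  · have hx := h₅.1.ext
    exact ⟨.refl h₅.1.env h₅.1.pool, fun k hk => rep_mono (rep_mono (h₃.2 k hk) h₄.1.ext) hx,
      fun u hu => rep_mono (h₄.2 u hu) hx, h₅.2⟩

/-! ### Reading off a solution -/

/-- The tag of the part that contains all items. -/
def Scheme.fin (S : Scheme) : ℕ := S.nV + S.n + (S.nV + S.n) - 2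

/-- Output the assignment of member `41` of the pool. -/
def copyOut : Prog :=
  .for 43 (.get 0 2) (.setNat 5 (.var 43) (.get aA (.get aBase (.var 41) + .var 43) - 1)) ;;
  .for 43 (.get 0 3) (.setNat 6 (.var 43) 0) ;;
  .for 43 (.get 0 2) (.setNat 6 (.get 5 (.var 43)) 1)

/-- The output arrays hold the assignment `σ`. -/
def Store.Writes (s : Store) (nU nF : ℕ) (σ : ℕ → ℕ) : Prop :=
  (∀ u < nU, s.nat 5 u = σ u) ∧
    ∀ f < nF, ((∃ u < nU, σ u = f) → s.nat 6 f = 1) ∧ ((¬ ∃ u < nU, σ u = f) → s.nat 6 f = 0)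

theorem copyOut_spec {S : Scheme} {Z : ℕ} {s : Store} (hZ : Bounds S Z) (he : Env S s)
    (hp : Pool S s) {j : ℕ} (hj : s.nat 41 0 = j) (hjl : j < s.len) :
    WP copyOut s (Z ^ 4) fun s' => s'.Writes S.nU S.nF fun u => s.a S.n j u - 1 := by
  have hZ2 := pow_steps hZ.two
  have hb := hp.base j hjl.le
  have hU : S.nU ≤ Z := by have := hZ.nU; omega
  refine (WP.seq (T₁ := Z ^ 3) (T₂ := Z ^ 3 + Z ^ 3) (R := fun s' => ∀ u < S.nU,
    s'.nat 5 u = s.a S.n j u - 1) ?_ fun s₁ fr₁ h₁ => WP.seq (R := fun s' => ∀ f < S.nF,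
    s'.nat 6 f = 0) ?_ fun s₂ fr₂ h₂ => ?_).mono (by omega) fun _ _ h => h
  · refine (WP.for (N := S.nU) (T := 1) (fun k s' => ∀ u < k, s'.nat 5 u = s.a S.n j u - 1) rfl
      ?_ ?_ ?_).mono (for_le_pow 1 hZ.two hU (by omega) le_rfl) fun _ _ h => h
    · intro s' fr; simp [fr.nat 0 rfl, he.nU]
    · simp
    · intro k hk s' fr hc h
      refine WP.run rfl le_rfl fun u hu => ?_
      simp only [Prog.run, NExpr.eval_add, NExpr.eval_sub, NExpr.eval_get, NExpr.eval_ofNat, hc, hj,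
        fr.nat 41 rfl, fr.nat aBase rfl, fr.nat aA rfl, hb, Store.nat_writeNat]
      by_cases e : u = k
      · simp [e, Store.a]
      · simpa [e] using h u (by omega)
  · have he₁ := he.frame fr₁ rfl
    refine (WP.for (N := S.nF) (T := 1) (fun k s' => ∀ u < k, s'.nat 6 u = 0) rfl
      ?_ ?_ ?_).mono (for_le_pow 1 hZ.two hZ.nF (by omega) le_rfl) fun _ _ h => h
    · intro s' fr; simp [fr.nat 0 rfl, he₁.nF]
    · simp
    · intro k hk s' fr hc h
      refine WP.run rfl le_rfl fun u hu => ?_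
      simp only [Prog.run, NExpr.eval_get, NExpr.eval_ofNat, hc, Store.nat_writeNat]
      by_cases e : u = k
      · simp [e]
      · simpa [e] using h u (by omega)
  · have he₂ := (he.frame fr₁ rfl).frame fr₂ rfl
    refine (WP.for (N := S.nU) (T := 1) (fun k s' => ∀ f < S.nF,
      ((∃ u < k, s.a S.n j u - 1 = f) → s'.nat 6 f = 1) ∧
      ((¬ ∃ u < k, s.a S.n j u - 1 = f) → s'.nat 6 f = 0)) rfl
      ?_ ?_ ?_).mono (for_le_pow 1 hZ.two hU (by omega) le_rfl) fun s' fr h => ⟨fun u hu => ?_, h⟩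
    · intro s' fr; simp [fr.nat 0 rfl, he₂.nU]
    · simpa using h₂
    · intro k hk s' fr hc h
      refine WP.run rfl le_rfl fun f hf => ?_
      have h5 : s'.nat 5 k = s.a S.n j k - 1 := by rw [fr.nat 5 rfl, fr₂.nat 5 rfl, h₁ k hk]
      simp only [Prog.run, NExpr.eval_get, NExpr.eval_ofNat, hc, Store.nat_writeNat, h5]
      by_cases e : s.a S.n j k - 1 = f
      · have : ∃ u < k + 1, s.a S.n j u - 1 = f := ⟨k, by omega, e⟩
        exact ⟨fun _ => by simp [e], fun h => absurd this h⟩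
      · have h' : (∃ u < k + 1, s.a S.n j u - 1 = f) ↔ ∃ u < k, s.a S.n j u - 1 = f :=
          ⟨fun ⟨u, hu, hv⟩ => ⟨u, by
            rcases Nat.lt_succ_iff_lt_or_eq.1 hu with h | rfl
            · exact h
            · exact absurd hv e, hv⟩, fun ⟨u, hu, hv⟩ => ⟨u, by omega, hv⟩⟩
        rw [h']
        simpa [Ne.symm e] using h f hf
    · rw [fr.nat 5 rfl, fr₂.nat 5 rfl, h₁ u hu]

/-- Search the pool for a solution. -/
def findSol : Prog :=
  .setNat 31 0 0 ;;
  .for 41 (.var aLen) (.whenEq (.get aTag (.var 41))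
    (.get 0 0 + .var aN + (.get 0 0 + .var aN) - 2)
    (.setNat aOk 0 1 ;;
      .for 42 (.var aN) (.when (.natLe 1 (.get aQ (.get aBase (.var 41) + .var 42)))
        (.setNat aOk 0 0)) ;;
      .when (.natLe 1 (.var aOk)) (copyOut ;; .setNat 31 0 1)))

/-- Member `j` of the pool is a solution. -/
def Store.Solves (s : Store) (S : Scheme) (j : ℕ) : Prop :=
  s.nat aTag j = S.fin ∧ ∀ x < S.n, s.q S.n j x = 0

/-- If several members are solutions, the last one is output, hence the existential over `j`. That
the output arrays are untouched after a failure preserves the solution found for a previous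
threshold. -/
theorem findSol_spec {S : Scheme} {Z : ℕ} {s : Store} (hZ : Bounds S Z) (he : Env S s)
    (hp : Pool S s) :
    WP findSol s (Z ^ 9) fun s' =>
      (1 ≤ s'.nat 31 0 ∧ ∃ j < s.len, s.Solves S j ∧ s'.Writes S.nU S.nF fun u => s.a S.n j u - 1) ∨
      (s'.nat 31 0 = 0 ∧ (¬ ∃ j < s.len, s.Solves S j) ∧ s'.nat 5 = s.nat 5 ∧
        s'.nat 6 = s.nat 6) := by
  have hZ2 := pow_steps hZ.two
  refine (WP.seq (T₁ := 1) (T₂ := Z ^ 8) (R := fun s' => s'.nat 31 0 = 0)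
    (WP.run rfl le_rfl (by simp [Prog.run])) fun s₁ fr₁ h₁ => ?_).mono (by omega) fun _ _ h => h
  have hg₁ := Grow.of_frame hp he fr₁ rfl rfl
  have e21 := fr₁.nat aLen rfl
  have e22 := fr₁.nat aBase rfl
  have e23 := fr₁.nat aTag rfl
  have e24 := fr₁.nat aQ rfl
  have e25 := fr₁.nat aA rfl
  refine (WP.for (N := s.len) (T := Z ^ 6) (fun k s' =>
      (1 ≤ s'.nat 31 0 ∧ ∃ j < s.len, s.Solves S j ∧ s'.Writes S.nU S.nF fun u => s.a S.n j u - 1) ∨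
      (s'.nat 31 0 = 0 ∧ (¬ ∃ j < k, s.Solves S j) ∧ s'.nat 5 = s.nat 5 ∧
        s'.nat 6 = s.nat 6)) rfl ?_ ?_ ?_).mono
      (for_le_pow 6 hZ.two (hZ.pool s hp) le_rfl le_rfl) fun _ _ h => h
  · intro s' fr; simp [fr.nat aLen rfl, e21]
  · refine .inr ⟨by simpa using h₁, by simp, ?_, ?_⟩
    · rw [Store.nat_writeNat_of_ne _ (by decide), fr₁.nat 5 rfl]
    · rw [Store.nat_writeNat_of_ne _ (by decide), fr₁.nat 6 rfl]
  · intro k hk s₂ fr₂ hc hinv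
    have hw : ∀ s' : Store, ∀ σ : ℕ → ℕ, (s'.writeNat 41 0 (k + 1)).Writes S.nU S.nF σ ↔
        s'.Writes S.nU S.nF σ := fun s' σ => by simp [Store.Writes]
    have w5 : ∀ s' : Store, (s'.writeNat 41 0 (k + 1)).nat 5 = s'.nat 5 := fun s' =>
      Store.nat_writeNat_of_ne _ (by decide) _ _
    have w6 : ∀ s' : Store, (s'.writeNat 41 0 (k + 1)).nat 6 = s'.nat 6 := fun s' =>
      Store.nat_writeNat_of_ne _ (by decide) _ _
    have w31 : ∀ s' : Store, (s'.writeNat 41 0 (k + 1)).nat 31 = s'.nat 31 := fun s' =>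
      Store.nat_writeNat_of_ne _ (by decide) _ _
    simp only [hw, w5, w6, w31]
    have hg₂ := hg₁.trans (Grow.of_frame hg₁.pool hg₁.env fr₂ rfl rfl)
    have f21 := (fr₂.nat aLen rfl).trans e21
    have f22 := (fr₂.nat aBase rfl).trans e22
    have f23 := (fr₂.nat aTag rfl).trans e23
    have f24 := (fr₂.nat aQ rfl).trans e24
    have f25 := (fr₂.nat aA rfl).trans e25
    have hkl₂ : k < s₂.len := hk.trans_le hg₂.ext.len
    have hb := hp.base k hk.le
    have hnot : ∀ s' : Store, s'.nat 31 = s₂.nat 31 → s'.nat 5 = s₂.nat 5 → s'.nat 6 = s₂.nat 6 →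
        ¬ s.Solves S k →
        (1 ≤ s'.nat 31 0 ∧ ∃ j < s.len, s.Solves S j ∧
          s'.Writes S.nU S.nF fun u => s.a S.n j u - 1) ∨
        (s'.nat 31 0 = 0 ∧ (¬ ∃ j < k + 1, s.Solves S j) ∧ s'.nat 5 = s.nat 5 ∧
          s'.nat 6 = s.nat 6) := by
      intro s' h1 h2 h3 hns
      rcases hinv with ⟨i1, j, hj, hs, hwr⟩ | ⟨i1, i2, i3, i4⟩
      · exact .inl ⟨by rwa [h1], j, hj, hs, by simpa only [Store.Writes, h2, h3] using hwr⟩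
      · refine .inr ⟨by rwa [h1], ?_, h2.trans i3, h3.trans i4⟩
        rintro ⟨j, hj, hs⟩
        rcases Nat.lt_succ_iff_lt_or_eq.1 hj with h | rfl
        · exact i2 ⟨j, h, hs⟩
        · exact hns hs
    refine (WP.whenEq (T := 1 + (Z ^ 3 + (Z ^ 4 + 1 + 2))) (fun ht => WP.seq (R := fun s' =>
      s'.nat aOk 0 = 1) (WP.run rfl le_rfl (by simp [Prog.run])) fun s₃ fr₃ h₃ =>
        WP.seq (R := fun s' => 1 ≤ s'.nat aOk 0 ↔ ∀ x < S.n, s.q S.n k x = 0) ?_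
          fun s₄ fr₄ h₄ => ?_) fun ht => ?_).mono (by omega) fun _ _ h => h
    · have he₃ := hg₂.env.frame fr₃ rfl
      refine (WP.for (N := S.n) (T := 3) (fun m s' => 1 ≤ s'.nat aOk 0 ↔
        ∀ x < m, s.q S.n k x = 0) rfl ?_ ?_ ?_).mono
        (for_le_pow 1 hZ.two hZ.n (by omega) le_rfl) fun _ _ h => h
      · intro s' fr; simp [fr.nat aN rfl, he₃.n]
      · simp [h₃]
      · intro m hm s' fr hc' hi
        have hq : s.nat aQ (k * S.n + m) = s.q S.n k m := rfl
        refine WP.when (T := 1) (fun ht' => WP.run rfl le_rfl ?_) fun ht' => ?_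
        all_goals
          simp only [Test.holds_natLe, NExpr.eval_add, NExpr.eval_get, NExpr.eval_ofNat, hc',
            fr.nat 41 rfl, fr₃.nat 41 rfl, hc, fr.nat aBase rfl, fr₃.nat aBase rfl, f22, hb,
            fr.nat aQ rfl, fr₃.nat aQ rfl, f24, hq] at ht'
        · rw [Nat.forall_lt_succ_right]
          simp [Prog.run]
          intro _
          omega
        · rw [Nat.forall_lt_succ_right, ← hi]
          simp
          omega
    · have hg₃ := hg₂.trans (Grow.of_frame hg₂.pool hg₂.env fr₃ rfl rfl)
      have hg₄ := hg₃.trans (Grow.of_frame hg₃.pool hg₃.env fr₄ rfl rfl)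
      simp only [NExpr.eval_get, NExpr.eval_add, NExpr.eval_sub, NExpr.eval_ofNat, hc, f23,
        hg₂.env.nV, hg₂.env.n] at ht
      refine WP.when (fun ht' => WP.seq (copyOut_spec hZ hg₄.env hg₄.pool (j := k) ?_
        (hk.trans_le hg₄.ext.len)) fun s₅ fr₅ h₅ => WP.run rfl le_rfl ?_) fun ht' => ?_
      · rw [fr₄.nat 41 rfl, fr₃.nat 41 rfl, hc]
      · simp only [Test.holds_natLe, NExpr.eval_get, NExpr.eval_ofNat, h₄] at ht'
        rw [Store.a_eq ((fr₄.nat aA rfl).trans ((fr₃.nat aA rfl).trans f25))] at h₅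
        refine .inl ⟨by simp [Prog.run], k, hk, ⟨ht, ht'⟩, ?_⟩
        simpa [Prog.run, Store.Writes] using h₅
      · simp only [Test.holds_natLe, NExpr.eval_get, NExpr.eval_ofNat, h₄] at ht'
        exact hnot s₄ ((fr₄.nat 31 rfl).trans (fr₃.nat 31 rfl))
          ((fr₄.nat 5 rfl).trans (fr₃.nat 5 rfl)) ((fr₄.nat 6 rfl).trans (fr₃.nat 6 rfl))
          fun h => ht' h.2
    · simp only [NExpr.eval_get, NExpr.eval_add, NExpr.eval_sub, NExpr.eval_ofNat, hc, f23,
        hg₂.env.nV, hg₂.env.n] at ht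
      exact hnot s₂ rfl rfl rfl fun h => ht h.1

/-! ### Grouping the items into classes -/

/-- The items `x` and `y` are close and on the same side. -/
def Scheme.Near (S : Scheme) (x y : ℕ) : Prop :=
  (x < S.nU ↔ y < S.nU) ∧ |S.D (S.nV + x) - S.D (S.nV + y)| ≤ S.b

/-- `cid` maps every item to a nearby centre, and no two centres are near. -/
structure IsNet (S : Scheme) (k : ℕ) (cid : ℕ → ℕ) : Prop where
  le : ∀ x < k, cid x ≤ x
  idem : ∀ x < k, cid (cid x) = cid x
  near : ∀ x < k, S.Near x (cid x)
  far : ∀ x < k, ∀ y < x, cid x = x → cid y = y → ¬ S.Near x y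

/-- Items are treated in order; an item joins an earlier centre near it or becomes a centre itself.
With truncated subtraction, `1 - (x + 1 - nU)` is `1` for users and `0` for facilities, and the two
real comparisons replace the absolute value. -/
def net : Prog :=
  .for 41 (.var aN) (.setNat aCid (.var 41) (.var 41) ;;
    .for 42 (.var 41) (.when (.natLe (.var 42) (.get aCid (.var 42)))
      (.whenEq (1 - (.var 41 + 1 - .get 0 2)) (1 - (.var 42 + 1 - .get 0 2))
        (.when (.realLe (.get rD (.get 0 0 + .var 41) - .get rD (.get 0 0 + .var 42)) (.var rb))
          (.when (.realLe (.get rD (.get 0 0 + .var 42) - .get rD (.get 0 0 + .var 41)) (.var rb))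
            (.setNat aCid (.var 41) (.var 42)))))))

theorem net_spec {S : Scheme} {Z : ℕ} {s : Store} (hZ : 16 ≤ Z) (hn : S.n ≤ Z) (he : Env S s)
    (hb : 0 ≤ S.b) :
    WP net s (Z ^ 6) fun s' => Env { S with cid := s'.nat aCid } s' ∧ IsNet S S.n (s'.nat aCid) := by
  have hZ2 := pow_steps hZ
  refine (WP.for (N := S.n) (T := Z ^ 4) (fun k s' => IsNet S k (s'.nat aCid)) rfl ?_ ?_ ?_).mono
    (for_le_pow 4 hZ hn le_rfl le_rfl) fun s' fr h => ⟨?_, h⟩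
  · intro s' fr; simp [fr.nat aN rfl, he.n]
  · constructor <;> simp
  · intro k hk s₁ fr₁ hc hi
    refine (WP.seq (T₁ := 1) (T₂ := Z ^ 3) (R := fun s' => s'.nat aCid k = k ∧
      ∀ x < k, s'.nat aCid x = s₁.nat aCid x) (WP.run rfl le_rfl ?_) fun s₂ fr₂ h₂ => ?_).mono
      (by omega) fun _ _ h => h
    · simp only [Prog.run, NExpr.eval_get, NExpr.eval_ofNat, hc, Store.nat_writeNat]
      refine ⟨by simp, fun x hx => ?_⟩
      simp [hx.ne]
    · have c41 := (congrFun (fr₂.nat 41 rfl) 0).trans hc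
      -- The inner loop does not stop at the first near centre; a later one overwrites it, and any
      -- near centre is good enough.
      refine (WP.for (N := k) (T := 11) (fun m s' => (∀ x < k, s'.nat aCid x = s₁.nat aCid x) ∧
        ((s'.nat aCid k = k ∧ ∀ y < m, s₁.nat aCid y = y → ¬ S.Near k y) ∨
          ∃ y < k, s₁.nat aCid y = y ∧ S.Near k y ∧ s'.nat aCid k = y)) rfl ?_ ?_ ?_).mono
        (for_le_pow 1 hZ (by omega) (by omega) le_rfl) ?_
      · intro s' fr; simp [fr.nat 41 rfl, c41]
      · exact ⟨by simpa using h₂.2, .inl ⟨by simpa using h₂.1, by simp⟩⟩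
      · rintro m hm s₃ fr₃ hc₃ ⟨i1, i2⟩
        have d41 := (congrFun (fr₃.nat 41 rfl) 0).trans c41
        have d0 := (fr₃.nat 0 rfl).trans ((fr₂.nat 0 rfl).trans (fr₁.nat 0 rfl))
        have r3 := (fr₃.real rD rfl).trans ((fr₂.real rD rfl).trans (fr₁.real rD rfl))
        have r4 := (fr₃.real rb rfl).trans ((fr₂.real rb rfl).trans (fr₁.real rb rfl))
        have cm := i1 m hm
        have hout : ¬ (s₁.nat aCid m = m ∧ S.Near k m) →
            (∀ x < k, s₃.nat aCid x = s₁.nat aCid x) ∧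
            ((s₃.nat aCid k = k ∧ ∀ y < m + 1, s₁.nat aCid y = y → ¬ S.Near k y) ∨
              ∃ y < k, s₁.nat aCid y = y ∧ S.Near k y ∧ s₃.nat aCid k = y) := by
          refine fun h => ⟨i1, i2.imp (fun h' => ⟨h'.1, fun y hy hy' hn => ?_⟩) id⟩
          rcases Nat.lt_succ_iff_lt_or_eq.1 hy with hy | rfl
          · exact h'.2 y hy hy' hn
          · exact h ⟨hy', hn⟩
        have hcm := hi.le m hm
        have side : S.Near k m ↔ (1 - (k + 1 - S.nU) = 1 - (m + 1 - S.nU)) ∧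
            S.D (S.nV + k) - S.D (S.nV + m) ≤ S.b ∧ S.D (S.nV + m) - S.D (S.nV + k) ≤ S.b := by
          rw [Scheme.Near, abs_le]
          refine and_congr (by
            by_cases h1 : k < S.nU <;> by_cases h2 : m < S.nU <;>
              simp only [h1, h2, iff_true, iff_false, true_iff, false_iff] <;> omega) 
            ⟨fun h => ⟨h.2, by linarith [h.1]⟩, fun h => ⟨by linarith [h.2], h.1⟩⟩
        have frz : ∀ Q : Prop, ((∀ x < k, (s₃.writeNat 42 0 (m + 1)).nat aCid x = s₁.nat aCid x) ∧
            (((s₃.writeNat 42 0 (m + 1)).nat aCid k = k ∧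
              ∀ y < m + 1, s₁.nat aCid y = y → ¬ S.Near k y) ∨
              ∃ y < k, s₁.nat aCid y = y ∧ S.Near k y ∧
                (s₃.writeNat 42 0 (m + 1)).nat aCid k = y) ↔ Q) ↔
            ((∀ x < k, s₃.nat aCid x = s₁.nat aCid x) ∧
            ((s₃.nat aCid k = k ∧ ∀ y < m + 1, s₁.nat aCid y = y → ¬ S.Near k y) ∨
              ∃ y < k, s₁.nat aCid y = y ∧ S.Near k y ∧ s₃.nat aCid k = y) ↔ Q) := by
          intro Q
          simp only [Store.nat_writeNat_of_ne _ (show 20 ≠ 42 by decide)]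
        have hout' := fun h => ((frz _).2 Iff.rfl).2 (hout h)
        refine (WP.when (T := 9) (fun ht1 => WP.whenEq (T := 5) (fun ht2 => WP.when (T := 3)
          (fun ht3 => WP.when (T := 1) (fun ht4 => WP.run rfl le_rfl ?_) fun ht4 => ?_) fun ht3 => ?_)
          fun ht2 => ?_) fun ht1 => ?_).mono (by omega) fun _ _ h => h
        all_goals
          simp only [Test.holds_natLe, NExpr.eval_get, NExpr.eval_ofNat, hc₃, cm] at ht1
        rotate_left 4
        · exact hout' fun h => ht1 h.1.ge
        all_goals
          simp only [NExpr.eval_add, NExpr.eval_sub, NExpr.eval_get, NExpr.eval_ofNat, hc₃, d41, d0,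
            he.nU] at ht2
        rotate_left 3
        · exact hout' fun h => ht2 (side.1 h.2).1
        all_goals
          simp only [Test.holds_realLe, RExpr.eval_sub, RExpr.eval_get, NExpr.eval_add,
            NExpr.eval_get, NExpr.eval_ofNat, hc₃, d41, d0, r3, r4, he.nV, he.D, he.b] at ht3
        rotate_left 2
        · exact hout' fun h => ht3 (side.1 h.2).2.1
        all_goals
          simp only [Test.holds_realLe, RExpr.eval_sub, RExpr.eval_get, NExpr.eval_add,
            NExpr.eval_get, NExpr.eval_ofNat, hc₃, d41, d0, r3, r4, he.nV, he.D, he.b] at ht4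
        rotate_left 1
        · exact hout' fun h => ht4 (side.1 h.2).2.2
        simp only [Prog.run, NExpr.eval_get, NExpr.eval_ofNat, d41, hc₃,
          Store.nat_writeNat_of_ne _ (show 20 ≠ 42 by decide)]
        refine ⟨fun x hx => ?_, .inr ⟨m, hm, le_antisymm hcm ht1, side.2 ⟨ht2, ht3, ht4⟩, by simp⟩⟩
        simp [hx.ne, i1 x hx]
      · rintro s₃ fr₃ ⟨i1, i2⟩
        rw [Store.nat_writeNat_of_ne _ (show 20 ≠ 41 by decide)]
        refine ⟨fun x hx => ?_, fun x hx => ?_, fun x hx => ?_, fun x hx y hyx hcx hcy => ?_⟩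
        · rcases Nat.lt_succ_iff_lt_or_eq.1 hx with h | rfl
          · rw [i1 x h]; exact hi.le x h
          · rcases i2 with h | ⟨y, hy, _, _, h⟩
            · exact h.1.le
            · omega
        · rcases Nat.lt_succ_iff_lt_or_eq.1 hx with h | rfl
          · rw [i1 x h, i1 _ ((hi.le x h).trans_lt h)]; exact hi.idem x h
          · rcases i2 with h | ⟨y, hy, hc', _, h⟩
            · rw [h.1, h.1]
            · rw [h, i1 y hy, hc']
        · rcases Nat.lt_succ_iff_lt_or_eq.1 hx with h | rfl
          · rw [i1 x h]; exact hi.near x h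
          · rcases i2 with h | ⟨y, hy, hc', hn, h⟩
            · rw [h.1]; exact ⟨Iff.rfl, by simpa using hb⟩
            · rw [h]; exact hn
        · rcases Nat.lt_succ_iff_lt_or_eq.1 hx with h | rfl
          · rw [i1 x h] at hcx
            rw [i1 y (hyx.trans h)] at hcy
            exact hi.far x h y hyx hcx hcy
          · rw [i1 y hyx] at hcy
            rcases i2 with h | ⟨y', hy', _, _, h⟩
            · exact h.2 y hyx hcy
            · omega
  · exact ⟨by rw [fr.nat 0 rfl, he.nV], by rw [fr.nat 0 rfl, he.nU], by rw [fr.nat 0 rfl, he.nF],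
      by rw [fr.nat 0 rfl, he.r], by rw [fr.nat aN rfl, he.n], rfl, by rw [fr.nat aMate rfl, he.mate],
      by rw [fr.nat aOut rfl, he.out], by rw [fr.nat aTop rfl, he.top], by rw [fr.real rD rfl, he.D],
      by rw [fr.real rb rfl, he.b], by rw [fr.real rB rfl, he.B]⟩

/-- Few pairwise distant centres fit into a short interval. -/
theorem card_le_of_separated {C : Finset ℕ} {E : ℕ → ℝ} {α b : ℝ} {m : ℕ} (hb : 0 ≤ b)
    (h1 : ∀ c ∈ C, α ≤ E c) (h2 : ∀ c ∈ C, E c ≤ α + m * b)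
    (h3 : ∀ c ∈ C, ∀ c' ∈ C, c < c' → b < |E c' - E c|) : C.card ≤ m + 1 := by
  -- For `b = 0` the interval is a point, and two distinct centres would have positive distance.
  rcases hb.eq_or_lt with rfl | hb
  · refine (Finset.card_le_one.2 fun c hc c' hc' => ?_).trans (by omega)
    have e : ∀ c ∈ C, E c = α := fun c hc => le_antisymm (by simpa using h2 c hc) (h1 c hc)
    rcases lt_trichotomy c c' with h | h | h
    · have := h3 c hc c' hc' h; simp [e c hc, e c' hc'] at this
    · exact h
    · have := h3 c' hc' c hc h; simp [e c hc, e c' hc'] at this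
  · rw [← Finset.card_range (m + 1)]
    -- Cells of width `b` contain at most one centre each, and their indices range from `0` to `m`.
    refine Finset.card_le_card_of_injOn (fun c => ⌊(E c - α) / b⌋₊) (fun c hc => ?_) ?_
    · have hc : c ∈ C := hc
      simp only [Finset.coe_range, Set.mem_Iio]
      refine Nat.lt_succ_of_le (Nat.floor_le_of_le ?_)
      rw [div_le_iff₀ hb]
      linarith [h2 c hc]
    · have key : ∀ c ∈ C, ∀ c' ∈ C, ⌊(E c - α) / b⌋₊ = ⌊(E c' - α) / b⌋₊ → |E c' - E c| ≤ b := by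
        intro c hc c' hc' h
        have p1 := Nat.floor_le (div_nonneg (sub_nonneg.2 (h1 c hc)) hb.le)
        have p2 := Nat.floor_le (div_nonneg (sub_nonneg.2 (h1 c' hc')) hb.le)
        have q1 := Nat.lt_floor_add_one ((E c - α) / b)
        have q2 := Nat.lt_floor_add_one ((E c' - α) / b)
        rw [h] at p1 q1
        rw [le_div_iff₀ hb] at p1 p2
        rw [div_lt_iff₀ hb] at q1 q2
        rw [abs_le]
        constructor <;> linarith
      intro c hc c' hc' h
      rcases lt_trichotomy c c' with hl | hl | hl
      · exact absurd (h3 c hc c' hc' hl) (not_lt.2 (key c hc c' hc' h))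
      · exact hl
      · exact absurd (h3 c' hc' c hc hl) (not_lt.2 (key c' hc' c hc h.symm))

/-! ### Rooted trees given by parent functions -/

/-- `a` is an ancestor of `k`. -/
def Anc (pp : ℕ → ℕ) (a k : ℕ) : Prop := ∃ i, pp^[i] k = a

/-- Nodes `0, …, nV - 1` are vertices, and the nodes `nV + x` with `x < n` are items, which are
leaves; every node but the root `0` comes after its parent. -/
structure Rooted (nV n : ℕ) (pp : ℕ → ℕ) : Prop where
  pos : 0 < nV
  zero : pp 0 = 0
  lt : ∀ k, 0 < k → k < nV + n → pp k < k
  item : ∀ x < n, pp (nV + x) < nV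

section Rooted

variable {nV n : ℕ} {pp : ℕ → ℕ}

theorem Anc.refl (k : ℕ) : Anc pp k k := ⟨0, rfl⟩

theorem Anc.step {a k : ℕ} (h : Anc pp a (pp k)) : Anc pp a k := by
  obtain ⟨i, h⟩ := h
  exact ⟨i + 1, by rwa [Function.iterate_succ_apply]⟩

theorem Anc.trans {a b c : ℕ} (h : Anc pp a b) (h' : Anc pp b c) : Anc pp a c := by
  obtain ⟨i, rfl⟩ := h
  obtain ⟨j, rfl⟩ := h'
  exact ⟨i + j, by rw [Function.iterate_add_apply]⟩

theorem Anc.eq_or {a k : ℕ} (h : Anc pp a k) : a = k ∨ Anc pp a (pp k) := by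
  obtain ⟨i, h⟩ := h
  cases i with
  | zero => exact .inl h.symm
  | succ i => exact .inr ⟨i, by rwa [Function.iterate_succ_apply] at h⟩

theorem Anc.total {a b k : ℕ} (h : Anc pp a k) (h' : Anc pp b k) : Anc pp a b ∨ Anc pp b a := by
  obtain ⟨i, rfl⟩ := h
  obtain ⟨j, rfl⟩ := h'
  rcases le_total i j with hij | hij
  · refine .inr ⟨j - i, ?_⟩
    rw [← Function.iterate_add_apply, Nat.sub_add_cancel hij]
  · refine .inl ⟨i - j, ?_⟩
    rw [← Function.iterate_add_apply, Nat.sub_add_cancel hij]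

theorem Rooted.pp_le (h : Rooted nV n pp) {k : ℕ} (hk : k < nV + n) : pp k ≤ k := by
  rcases Nat.eq_zero_or_pos k with rfl | hp
  · rw [h.zero]
  · exact (h.lt k hp hk).le

theorem Rooted.pp_lt_nV (h : Rooted nV n pp) {k : ℕ} (hk : k < nV + n) : pp k < nV := by
  rcases lt_or_ge k nV with hv | hv
  · exact (h.pp_le hk).trans_lt hv
  · obtain ⟨x, rfl⟩ := Nat.exists_eq_add_of_le hv
    exact h.item x (by omega)

theorem Rooted.anc_le (h : Rooted nV n pp) {a k : ℕ} (ha : Anc pp a k) (hk : k < nV + n) :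
    a ≤ k := by
  obtain ⟨i, rfl⟩ := ha
  induction i with
  | zero => exact le_rfl
  | succ i ih =>
    rw [Function.iterate_succ_apply']
    exact (h.pp_le (ih.trans_lt hk)).trans ih

theorem Rooted.anc_zero (h : Rooted nV n pp) {k : ℕ} (hk : k < nV + n) : Anc pp 0 k := by
  induction k using Nat.strong_induction_on with
  | _ k ih =>
    rcases Nat.eq_zero_or_pos k with rfl | hp
    · exact .refl _
    · have := h.lt k hp hk
      exact (ih _ this (this.trans hk)).step

/-- An ancestor of `k` other than `k` has a child that is an ancestor of `k`. -/
theorem Rooted.exists_child (h : Rooted nV n pp) {a k : ℕ} (ha : Anc pp a k) (hk : k < nV + n)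
    (hne : a ≠ k) : ∃ c, 0 < c ∧ c < nV + n ∧ pp c = a ∧ Anc pp c k := by
  induction k using Nat.strong_induction_on with
  | _ k ih =>
    have hp : 0 < k := by
      by_contra h0
      have := h.anc_le ha hk
      omega
    have hlt := h.lt k hp hk
    by_cases e : a = pp k
    · exact ⟨k, hp, hk, e.symm, .refl _⟩
    · obtain ⟨c, h1, h2, h3, h4⟩ := ih _ hlt (ha.eq_or.resolve_left hne) (hlt.trans hk) e
      exact ⟨c, h1, h2, h3, h4.step⟩

/-- Two ancestors of one node are comparable; were one sibling properly above the other, it would be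
an ancestor of its own parent, against the numbering. -/
theorem Rooted.siblings (h : Rooted nV n pp) {c c' k : ℕ} (hc : 0 < c) (hk : k < nV + n)
    (hp : pp c = pp c') (h1 : Anc pp c k) (h2 : Anc pp c' k) (hc' : 0 < c') : c = c' := by
  have l1 := h.anc_le h1 hk
  have l2 := h.anc_le h2 hk
  rcases h1.total h2 with ha | ha
  · rcases ha.eq_or with e | ha
    · exact e
    · rw [← hp] at ha
      have := h.lt c hc (by omega)
      have := h.anc_le ha (by omega)
      omega
  · rcases ha.eq_or with e | ha
    · exact e.symm
    · rw [hp] at ha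
      have := h.lt c' hc' (by omega)
      have := h.anc_le ha (by omega)
      omega

theorem Rooted.mono (h : Rooted nV n pp) {D : ℕ → ℝ} (hD : ∀ k < nV + n, D (pp k) ≤ D k) {a k : ℕ}
    (ha : Anc pp a k) (hk : k < nV + n) : D a ≤ D k := by
  obtain ⟨i, rfl⟩ := ha
  induction i with
  | zero => exact le_rfl
  | succ i ih =>
    rw [Function.iterate_succ_apply']
    exact (hD _ ((h.anc_le ⟨i, rfl⟩ hk).trans_lt hk)).trans ih

/-! ### The tree of merges -/

/-- The current tags of the nodes after `t` merges, with `N` nodes. -/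
def curTag (pp : ℕ → ℕ) (N : ℕ) : ℕ → ℕ → ℕ
  | 0 => id
  | t + 1 => Function.update (curTag pp N t) (pp (N - 1 - t)) (N + t)

/-- Merge `t` absorbs the part of node `N - 1 - t` into the part of its parent. Going through the
nodes backwards, each node is absorbed after all of its children. The merge is stored at the tag of
the parent's part; `out x = 0` means that none is stored at `x`. -/
structure IsPlan (N : ℕ) (pp mate out top : ℕ → ℕ) (T : ℕ) : Prop where
  mate_eq : ∀ t < T, mate (curTag pp N t (pp (N - 1 - t))) = curTag pp N t (N - 1 - t)
  out_eq : ∀ t < T, out (curTag pp N t (pp (N - 1 - t))) = N + t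
  exists_of_out : ∀ x, out x ≠ 0 → ∃ t < T, x = curTag pp N t (pp (N - 1 - t))
  top_base : ∀ k < N, top k = k
  top_out : ∀ t < T, top (N + t) = pp (N - 1 - t)

theorem curTag_lt {N t v : ℕ} (hv : v < N) : curTag pp N t v < N + t := by
  induction t with
  | zero => simpa [curTag] using hv
  | succ t ih =>
    simp only [curTag, Function.update_apply]
    split_ifs <;> omega

theorem curTag_inj {N t v w : ℕ} (hv : v < N) (hw : w < N) (h : curTag pp N t v = curTag pp N t w) :
    v = w := by
  induction t with
  | zero => simpa [curTag] using h
  | succ t ih =>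
    have h1 := curTag_lt (pp := pp) (t := t) hv
    have h2 := curTag_lt (pp := pp) (t := t) hw
    simp only [curTag, Function.update_apply] at h
    split_ifs at h with e1 e2 e2
    · rw [e1, e2]
    · omega
    · omega
    · exact ih h

/-- A tag that has been merged is not current any more. -/
theorem curTag_ne {N t t' v : ℕ} (hp : ∀ k < N, pp k < N) (hv : v < N) (h : t' < t) :
    curTag pp N t v ≠ curTag pp N t' (pp (N - 1 - t')) := by
  have hN : ∀ s, pp (N - 1 - s) < N := fun s => hp _ (by omega)
  induction t with
  | zero => omega
  | succ t ih =>
    have h1 := curTag_lt (pp := pp) (t := t') (hN t')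
    simp only [curTag, Function.update_apply]
    split_ifs with e
    · omega
    · rcases Nat.lt_succ_iff_lt_or_eq.1 h with h' | rfl
      · exact ih h'
      · exact fun hh => e (curTag_inj hv (hN _) hh)

/-- After `t` merges, item `y` belongs to the current part of node `v`. -/
def Below (nV n : ℕ) (pp : ℕ → ℕ) (t v y : ℕ) : Prop :=
  v = nV + y ∨ ∃ c, nV + n - t ≤ c ∧ c < nV + n ∧ 0 < c ∧ pp c = v ∧ Anc pp c (nV + y)

/-- Item `y` belongs to the part with tag `T`. -/
def Cov (nV n : ℕ) (pp : ℕ → ℕ) (T y : ℕ) : Prop :=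
  y < n ∧ T < nV + n + (nV + n - 1) ∧ if T < nV + n then T = nV + y else
    Below nV n pp (T - (nV + n) + 1) (pp (nV + n - 1 - (T - (nV + n)))) y

theorem cov_base {T y : ℕ} (hT : T < nV + n) : Cov nV n pp T y ↔ y < n ∧ T = nV + y := by
  rw [Cov, if_pos hT]
  exact and_congr_right fun hy => and_iff_right (by omega)

theorem cov_out {t y : ℕ} (ht : t < nV + n - 1) : Cov nV n pp (nV + n + t) y ↔
    y < n ∧ Below nV n pp (t + 1) (pp (nV + n - 1 - t)) y := by
  rw [Cov, if_neg (by omega), Nat.add_sub_cancel_left]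
  exact and_congr_right fun hy => and_iff_right (by omega)

theorem below_succ {t v y : ℕ} (ht : t < nV + n - 1) :
    Below nV n pp (t + 1) v y ↔ Below nV n pp t v y ∨
      (v = pp (nV + n - 1 - t) ∧ Anc pp (nV + n - 1 - t) (nV + y)) := by
  constructor
  · rintro (h1 | ⟨c, h1, h2, h3, h4, h5⟩)
    · exact .inl (.inl h1)
    · by_cases e : c = nV + n - 1 - t
      · subst e; exact .inr ⟨h4.symm, h5⟩
      · exact .inl (.inr ⟨c, by omega, h2, h3, h4, h5⟩)
  · rintro ((h1 | ⟨c, h1, h2, h3, h4, h5⟩) | ⟨h1, h2⟩)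
    · exact .inl h1
    · exact .inr ⟨c, by omega, h2, h3, h4, h5⟩
    · exact .inr ⟨_, by omega, by omega, by omega, h1.symm, h2⟩

/-- This identifies the tags, which change recursively, with the explicit description of the parts:
merge `t` changes the tag of the parent of node `N - 1 - t` only. -/
theorem cov_curTag {t v y : ℕ} (ht : t ≤ nV + n - 1) (hv : v < nV + n)
    (hy : y < n) : Cov nV n pp (curTag pp (nV + n) t v) y ↔ Below nV n pp t v y := by
  induction t with
  | zero =>
    simp only [curTag, id, cov_base hv, hy, true_and, Below]
    refine ⟨.inl, ?_⟩
    rintro (h1 | ⟨c, h1, h2, _⟩)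
    · exact h1
    · omega
  | succ t ih =>
    simp only [curTag, Function.update_apply]
    split_ifs with e
    · rw [cov_out (by omega), e]; simp [hy]
    · rw [ih (by omega), below_succ (by omega)]
      simp [e]

/-- Children have larger numbers than their parents, so when node `nV + n - 1 - t` is absorbed, its
part is its whole subtree. -/
theorem below_full (h : Rooted nV n pp) {t y : ℕ} (hy : y < n) :
    Below nV n pp t (nV + n - 1 - t) y ↔ Anc pp (nV + n - 1 - t) (nV + y) := by
  constructor
  · rintro (h1 | ⟨c, h1, h2, h3, h4, h5⟩)
    · rw [h1]; exact .refl _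
    · exact (Anc.step (h4 ▸ .refl _)).trans h5
  · intro ha
    by_cases e : nV + n - 1 - t = nV + y
    · exact .inl e
    · obtain ⟨c, h1, h2, h3, h4⟩ := h.exists_child ha (by omega) e
      have := h.lt c h1 h2
      exact .inr ⟨c, by omega, h2, h1, h3, h4⟩

theorem top_curTag {mate out top : ℕ → ℕ}
    (hI : IsPlan (nV + n) pp mate out top (nV + n - 1)) {t v : ℕ} (ht : t ≤ nV + n - 1)
    (hv : v < nV + n) : top (curTag pp (nV + n) t v) = v := by
  induction t with
  | zero => exact hI.top_base v hv
  | succ t ih =>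
    simp only [curTag, Function.update_apply]
    split_ifs with e
    · rw [hI.top_out t (by omega), e]
    · exact ih (by omega)

theorem cov_top {mate out top : ℕ → ℕ}
    (hI : IsPlan (nV + n) pp mate out top (nV + n - 1)) {T y : ℕ}
    (hc : Cov nV n pp T y) : Anc pp (top T) (nV + y) := by
  have hT := hc.2.1
  rcases lt_or_ge T (nV + n) with hk | hk
  · rw [cov_base hk] at hc
    rw [hI.top_base T hk, hc.2]
    exact .refl _
  · obtain ⟨t, rfl⟩ := Nat.exists_eq_add_of_le hk
    rw [hI.top_out t (by omega)]
    obtain ⟨_, h1 | ⟨c, h1, h2, h3, h4, h5⟩⟩ := (cov_out (by omega)).1 hc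
    · rw [h1]; exact .refl _
    · exact (Anc.step (h4 ▸ .refl _)).trans h5

/-- The common ancestors of an item of a part and an item outside are above the top. -/
theorem anc_top {mate out top : ℕ → ℕ}
    (hI : IsPlan (nV + n) pp mate out top (nV + n - 1)) {T x y w : ℕ}
    (hy : y < n) (hc : Cov nV n pp T x) (hc' : ¬ Cov nV n pp T y)
    (hx : Anc pp w (nV + x)) (hw : Anc pp w (nV + y)) : Anc pp w (top T) := by
  have hT := hc.2.1
  rcases lt_or_ge T (nV + n) with hk | hk
  · rw [cov_base hk] at hc
    rw [hI.top_base T hk, hc.2]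
    exact hx
  · obtain ⟨t, rfl⟩ := Nat.exists_eq_add_of_le hk
    rw [hI.top_out t (by omega)]
    rw [cov_out (by omega)] at hc hc'
    obtain ⟨_, h1 | ⟨c, h1, h2, h3, h4, h5⟩⟩ := hc
    · rw [h1]; exact hx
    -- Here `c` is an absorbed child of the top with `x` below it. Its entire subtree belongs to the
    -- part, so `w`, being above the outside item `y`, is neither `c` nor below `c`.
    · have hcy : ¬ Anc pp c (nV + y) := fun ha => hc' ⟨hy, .inr ⟨c, h1, h2, h3, h4, ha⟩⟩
      rcases hx.total h5 with ha | ha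
      · rcases ha.eq_or with rfl | ha
        · exact absurd hw hcy
        · rwa [h4] at ha
      · exact absurd (ha.trans hw) hcy

/-- With `N = nV + n` nodes, the merges are numbered from `0` to `N - 2`. The last one absorbs node
`1` into the root, and then all children of the root have been absorbed. -/
theorem cov_fin (h : Rooted nV n pp) {y : ℕ} (hy : y < n) :
    Cov nV n pp (nV + n + (nV + n) - 2) y := by
  have h0 := h.pos
  have e : nV + n + (nV + n) - 2 = nV + n + (nV + n - 2) := by omega
  rw [e, cov_out (by omega)]
  have e' : nV + n - 1 - (nV + n - 2) = 1 := by omega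
  have hp : pp 1 = 0 := by have := h.lt 1 (by omega) (by omega); omega
  rw [e', hp]
  obtain ⟨c, h1, h2, h3, h4⟩ := h.exists_child (h.anc_zero (k := nV + y) (by omega)) (by omega)
    (by omega)
  exact ⟨hy, .inr ⟨c, by omega, h2, h1, h3, h4⟩⟩

end Rooted

/-- What the search needs to know about the tree of merges and the scaled depths. -/
structure Scheme.Geo (S : Scheme) (pp : ℕ → ℕ) (K : ℕ) : Prop where
  rooted : Rooted S.nV S.n pp
  plan : IsPlan (S.nV + S.n) pp S.mate S.out S.top (S.nV + S.n - 1)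
  mono : ∀ k < S.nV + S.n, S.D (pp k) ≤ S.D k
  B_eq : S.B = K * S.b
  b_nonneg : 0 ≤ S.b

namespace Scheme

variable {S : Scheme} {pp : ℕ → ℕ} {K : ℕ}

/-- The items `x` and `y` are, in scaled distance, at most `β` apart. -/
def Close (S : Scheme) (pp : ℕ → ℕ) (β : ℝ) (x y : ℕ) : Prop :=
  ∃ w, Anc pp w (S.nV + x) ∧ Anc pp w (S.nV + y) ∧
    S.D (S.nV + x) + S.D (S.nV + y) - S.D w - S.D w ≤ β

/-- The parts that are merged are disjoint, since the parent's part consists of the subtrees of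
children that come later in the numbering than the one being absorbed. -/
theorem Geo.isPlan (h : S.Geo pp K) : S.Plan (Cov S.nV S.n pp) := by
  have hR := h.rooted
  have h0 := hR.pos
  have hP := h.plan
  have hN : ∀ s, pp (S.nV + S.n - 1 - s) < S.nV + S.n := fun s =>
    (hR.pp_lt_nV (by omega)).trans_le (by omega)
  have hex := hP.exists_of_out
  refine ⟨fun k hk x hc => ?_, fun x hx y => ?_, fun t ho y => ?_,
    fun t ho y hc hc' => ?_, fun t ho => ?_⟩
  · have := ((cov_base (by omega)).1 hc).2; omega
  · rw [cov_base (by omega)]; omega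
  · obtain ⟨i, hi, rfl⟩ := hex t (by omega)
    rw [hP.out_eq i hi, hP.mate_eq i hi, cov_out hi]
    by_cases hy : y < S.n
    · rw [cov_curTag hi.le (hN i) hy, cov_curTag hi.le (by omega) hy, below_full hR hy,
        below_succ hi]
      simp [hy]
    · simp [hy, Cov]
  · obtain ⟨i, hi, rfl⟩ := hex t (by omega)
    have hy := hc.1
    rw [hP.mate_eq i hi, cov_curTag hi.le (by omega) hy, below_full hR hy] at hc'
    rw [cov_curTag hi.le (hN i) hy] at hc
    rcases hc with h1 | ⟨c, h1, h2, h3, h4, h5⟩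
    · have := hR.pp_lt_nV (k := S.nV + S.n - 1 - i) (by omega)
      omega
    · have := hR.siblings h3 (k := S.nV + y) (by omega) h4 h5 hc' (by omega)
      omega
  · obtain ⟨i, hi, rfl⟩ := hex t (by omega)
    rw [hP.out_eq i hi]; omega

theorem Geo.tags (h : S.Geo pp K) (t : ℕ) (ht : t < S.nV + S.n + (S.nV + S.n - 1)) :
    t < S.nV + S.n ∨ ∃ t' < t, S.mate t' < t ∧ 1 ≤ S.out t' ∧ S.out t' = t := by
  have hR := h.rooted
  have h0 := hR.pos
  rcases lt_or_ge t (S.nV + S.n) with hk | hk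
  · exact .inl hk
  · obtain ⟨i, rfl⟩ := Nat.exists_eq_add_of_le hk
    have hi : i < S.nV + S.n - 1 := by omega
    refine .inr ⟨_, curTag_lt (pp := pp) ?_, ?_, ?_, h.plan.out_eq i hi⟩
    · exact (hR.pp_lt_nV (k := S.nV + S.n - 1 - i) (by omega)).trans_le (by omega)
    · rw [h.plan.mate_eq i hi]; exact curTag_lt (by omega)
    · rw [h.plan.out_eq i hi]; omega

theorem Geo.out_lt (h : S.Geo pp K) {t : ℕ} (ho : 1 ≤ S.out t) :
    t < S.nV + S.n + (S.nV + S.n - 1) ∧ S.out t < S.nV + S.n + (S.nV + S.n - 1) ∧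
      S.top (S.out t) = S.top t := by
  have hR := h.rooted
  have h0 := hR.pos
  obtain ⟨i, hi, rfl⟩ := h.plan.exists_of_out t (by omega)
  have hN : pp (S.nV + S.n - 1 - i) < S.nV + S.n := (hR.pp_lt_nV (by omega)).trans_le (by omega)
  have := curTag_lt (pp := pp) (t := i) hN
  rw [h.plan.out_eq i hi, h.plan.top_out i hi, top_curTag h.plan hi.le hN]
  exact ⟨by omega, by omega, rfl⟩

/-- A solution with assignment `σ` in which users are at most `β` away from their facilities. -/
structure Sol (S : Scheme) (pp : ℕ → ℕ) (β : ℝ) (σ : ℕ → ℕ) : Prop where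
  lt : ∀ u < S.nU, σ u < S.nF
  close : ∀ u < S.nU, S.Close pp β u (S.nU + σ u)
  load : ∀ f < S.nF, ((Finset.range S.nU).filter fun u => σ u = f).card = 0 ∨
    S.r ≤ ((Finset.range S.nU).filter fun u => σ u = f).card

/-- If exactly one end of a pair lies in a part, the common ancestor `w` that witnesses closeness is
above the top. Replacing `w` by the deeper top only decreases the expression, so it stays at most
`B`. Passing to class centres adds `b` for each end, which is the slack in `FitC` and `Allow`. -/
theorem Geo.target (h : S.Geo pp K) (hN : IsNet S S.n S.cid) {σ : ℕ → ℕ} (hσ : S.Sol pp S.B σ) :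
    S.Target (Cov S.nV S.n pp) σ := by
  have hR := h.rooted
  have hnear : ∀ x < S.n, S.D (S.nV + S.cid x) ≤ S.D (S.nV + x) + S.b := fun x hx => by
    have := abs_le.1 (hN.near x hx).2
    linarith [this.1]
  have hmono : ∀ {w k}, Anc pp w k → k < S.nV + S.n → S.D w ≤ S.D k := fun ha hk =>
    hR.mono h.mono ha hk
  have hU : ∀ u < S.nU, u < S.n ∧ S.nU + σ u < S.n := fun u hu => by
    have := hσ.lt u hu
    simp only [n]; omega
  -- the key estimate: the part's top is below the common ancestor
  have key : ∀ t, ∀ u < S.nU, (Cov S.nV S.n pp t u ∧ ¬ Cov S.nV S.n pp t (S.nU + σ u)) ∨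
      (¬ Cov S.nV S.n pp t u ∧ Cov S.nV S.n pp t (S.nU + σ u)) →
      S.D (S.nV + u) + S.D (S.nV + (S.nU + σ u)) - S.D (S.top t) - S.D (S.top t) ≤ S.B ∧
      S.D (S.nV + u) - S.D (S.top t) ≤ S.B ∧
      S.D (S.nV + (S.nU + σ u)) - S.D (S.top t) ≤ S.B := by
    intro t u hu hc
    obtain ⟨w, h1, h2, h3⟩ := hσ.close u hu
    have ha : Anc pp w (S.top t) := by
      rcases hc with hc | hc
      · exact anc_top h.plan (hU u hu).2 hc.1 hc.2 h1 h2
      · exact anc_top h.plan (hU u hu).1 hc.2 hc.1 h2 h1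
    have ht : S.top t < S.nV + S.n := by
      rcases hc with hc | hc
      · exact (hR.anc_le (cov_top h.plan hc.1) (by have := (hU u hu).1; omega)).trans_lt
          (by have := (hU u hu).1; omega)
      · exact (hR.anc_le (cov_top h.plan hc.2) (by have := (hU u hu).2; omega)).trans_lt
          (by have := (hU u hu).2; omega)
    have e1 := hmono ha ht
    have e2 := hmono h1 (by have := (hU u hu).1; omega)
    have e3 := hmono h2 (by have := (hU u hu).2; omega)
    refine ⟨by linarith, by linarith, by linarith⟩
  have hPl := h.isPlan
  refine ⟨hσ.lt, hσ.load, fun t u hu hc hc' => ?_, fun t u hu hc hc' => ?_, fun t ho u hu hc => ?_⟩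
  · have := key t u hu (.inl ⟨hc, hc'⟩)
    have := hnear u (hU u hu).1
    simp only [FitC]; linarith
  · have := key t u hu (.inr ⟨hc, hc'⟩)
    have := hnear _ (hU u hu).2
    simp only [FitC]; linarith
  · have hk := key t u hu (hc.imp (fun hc => ⟨hc.1, fun hh => hPl.disj t ho _ hh hc.2⟩)
      fun hc => ⟨fun hh => hPl.disj t ho _ hh hc.1, hc.2⟩)
    have e1 := hnear u (hU u hu).1
    have e2 := hnear _ (hU u hu).2
    simp only [FitC, Allow, (h.out_lt ho).2.2]
    refine ⟨by linarith, by linarith, by linarith⟩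

/-- The test through the top guarantees `B + 2 * b` for the centres; returning to the items costs
`b` for each end. This is the entire approximation error. -/
theorem Geo.close_of_allow (h : S.Geo pp K) (hN : IsNet S S.n S.cid) {t u f : ℕ} (hu : u < S.nU)
    (hf : f < S.nF) (hc : Cov S.nV S.n pp t u) (hc' : Cov S.nV S.n pp t (S.nU + f))
    (ha : S.Allow t (S.cid u) (S.cid (S.nU + f))) : S.Close pp (S.B + 4 * S.b) u (S.nU + f) := by
  refine ⟨S.top t, cov_top h.plan hc, cov_top h.plan hc', ?_⟩
  have e1 := (abs_le.1 (hN.near u (by simp only [n]; omega)).2).2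
  have e2 := (abs_le.1 (hN.near (S.nU + f) (by simp only [n]; omega)).2).2
  simp only [Allow] at ha
  linarith

-- Relevant centres have depths from `D top - b`, since their items lie below the top, to `D top + B
-- + b`, by `FitC`. As `B = K * b`, this interval has length `(K + 2) * b` and holds at most `K + 3`
-- separated centres, for users and for facilities separately.
open Classical in
theorem Geo.card_le (h : S.Geo pp K) (hN : IsNet S S.n S.cid) (t : ℕ) :
    (((Finset.range S.n).filter fun x => Cov S.nV S.n pp t x ∧ S.FitC t (S.cid x)).image
      S.cid).card ≤ 2 * (K + 3) := by
  set C := ((Finset.range S.n).filter fun x => Cov S.nV S.n pp t x ∧ S.FitC t (S.cid x)).image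
    S.cid with hC
  have hmem : ∀ c ∈ C, c < S.n ∧ S.cid c = c ∧ S.D (S.top t) - S.b ≤ S.D (S.nV + c) ∧
      S.D (S.nV + c) ≤ S.D (S.top t) - S.b + (K + 2 : ℕ) * S.b := by
    intro c hc
    obtain ⟨x, hx, rfl⟩ := Finset.mem_image.1 hc
    simp only [Finset.mem_filter, Finset.mem_range] at hx
    obtain ⟨hx, hcov, hfit⟩ := hx
    have h1 := h.rooted.mono h.mono (cov_top h.plan hcov) (by omega)
    have h2 := (abs_le.1 (hN.near x hx).2).2
    simp only [FitC, h.B_eq] at hfit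
    refine ⟨(hN.le x hx).trans_lt hx, hN.idem x hx, by linarith, ?_⟩
    push_cast
    linarith
  have hsep : ∀ c ∈ C, ∀ c' ∈ C, c < c' → (c' < S.nU ↔ c < S.nU) →
      S.b < |S.D (S.nV + c') - S.D (S.nV + c)| := by
    intro c hc c' hc' hlt hs
    by_contra hle
    exact hN.far c' (hmem c' hc').1 c hlt (hmem c' hc').2.1 (hmem c hc).2.1 ⟨hs, not_lt.1 hle⟩
  have hpart : ∀ p : ℕ → Prop, (∀ c c', p c → p c' → (c' < S.nU ↔ c < S.nU)) →
      (C.filter p).card ≤ K + 2 + 1 := by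
    intro p hp
    refine card_le_of_separated (E := fun c => S.D (S.nV + c)) h.b_nonneg
      (fun c hc => (hmem c (Finset.mem_filter.1 hc).1).2.2.1)
      (fun c hc => (hmem c (Finset.mem_filter.1 hc).1).2.2.2) fun c hc c' hc' hlt => ?_
    rw [Finset.mem_filter] at hc hc'
    exact hsep c hc.1 c' hc'.1 hlt (hp c c' hc.2 hc'.2)
  have h1 := hpart (fun c => c < S.nU) fun c c' h h' => by simp [h, h']
  have h2 := hpart (fun c => ¬ c < S.nU) fun c c' h h' => by simp [h, h']
  have h3 := Finset.card_filter_add_card_filter_not (s := C) fun c => c < S.nU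
  rw [← h3]
  refine (Nat.add_le_add (le_of_eq ?_ |>.trans h1) (le_of_eq ?_ |>.trans h2)).trans (by omega)
  · congr!
  · congr!

end Scheme

/-! ### The search for one threshold -/

/-- Search for a solution of cost about `b`. -/
def decide : Prog := net ;; initPool ;; saturate ;; findSol

/-- A decision with a gap: success yields a solution for `B + 4 * b`, failure excludes solutions for
`B`; in between either may happen. -/
theorem decide_spec {S : Scheme} {pp : ℕ → ℕ} {K Z : ℕ} {s : Store} (he : Env S s)
    (hG : S.Geo pp K) (hn0 : 0 < S.n) (h16 : 16 ≤ Z) (hn : S.n ≤ Z) (hnV : S.nV ≤ Z) (hnU : S.nU + 1 ≤ Z)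
    (hnF : S.nF ≤ Z) (hM : 2 * (S.nV + S.n) * (S.n * S.nU + 1) ^ (2 * (K + 3)) ≤ Z) :
    WP decide s (Z ^ 22) fun s' =>
      (1 ≤ s'.nat 31 0 ∧ ∃ σ, S.Sol pp (S.B + 4 * S.b) σ ∧ s'.Writes S.nU S.nF σ) ∨
      (s'.nat 31 0 = 0 ∧ (¬ ∃ σ, S.Sol pp S.B σ) ∧ s'.nat 5 = s.nat 5 ∧ s'.nat 6 = s.nat 6) := by
  have hZ2 := pow_steps h16
  refine ((net_spec h16 hn he hG.b_nonneg).seq (T₂ := Z ^ 18 + (Z ^ 21 + Z ^ 9))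
    fun s₁ fr₁ h₁ => ?_).mono (by omega) fun _ _ h => h
  obtain ⟨he₁, hN⟩ := h₁
  -- The classes are those that `net` has just computed, and `S'` differs from `S` only in them.
  set S' : Scheme := { S with cid := s₁.nat aCid } with hS'
  have hG' : S'.Geo pp K := ⟨hG.rooted, hG.plan, hG.mono, hG.B_eq, hG.b_nonneg⟩
  have hN' : IsNet S' S'.n S'.cid := ⟨hN.le, hN.idem, hN.near, hN.far⟩
  have hPl := hG'.isPlan
  have hval : ∀ {t q a}, S'.Der t q a →
      S'.Valid (Cov S'.nV S'.n pp) (fun u f => S'.Close pp (S'.B + 4 * S'.b) u (S'.nU + f)) t q a :=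
    fun hd => hd.valid hPl fun t u f hu hf hc hc' ha => hG'.close_of_allow hN' hu hf hc hc' ha
  have hB : Bounds S' Z := by
    refine ⟨h16, hn, hnV, hnU, hnF, fun s hp => le_trans ?_ hM⟩
    exact Scheme.card_le (S := S') (fun j hj => hval (hp.der j hj)) hp.fit hp.ne
      fun t => hG'.card_le hN' t
  have hside : ∀ x < S'.n, ∀ y < S'.n, S'.cid x = S'.cid y → (x < S'.nU ↔ y < S'.nU) := by
    intro x hx y hy hxy
    rw [(hN'.near x hx).1, (hN'.near y hy).1, hxy]
  refine (initPool_spec hB he₁).seq fun s₂ fr₂ h₂ => ?_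
  obtain ⟨hg₂, hv, hu, hf⟩ := h₂
  refine (saturate_spec hB hg₂.env hg₂.pool).seq fun s₃ fr₃ h₃ => ?_
  obtain ⟨hg₃, ha, hm⟩ := h₃
  have hx := hg₃.ext
  have hClosed : S'.Closed (s₃.Has S'.n) := by
    refine ⟨fun k hk => rep_mono (hv k hk) hx, fun u hu' => rep_mono (hu u hu') hx,
      fun f hf' m hm' hr => rep_mono (hf f hf' m (by omega) hr) hx, ?_, ?_⟩
    · rintro t q ⟨j, hj, rfl, hq⟩ u hu' f hf' hqu hqf hal
      have hun : u < S'.n := by simp only [Scheme.n]; omega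
      have hfn : S'.nU + f < S'.n := by simp only [Scheme.n]; omega
      refine rep_congr (ha j hj u hu' f hf' (hq u hun ▸ hqu) (hq _ hfn ▸ hqf) hal) fun x hx' => ?_
      rw [hq x hx']
    · rintro t q q' ⟨i, hi, rfl, hq⟩ ⟨j, hj, ht, hq'⟩ ho
      refine rep_congr (hm i hi j hj ho ht.symm) fun x hx' => ?_
      rw [hq x hx', hq' x hx']
  refine (findSol_spec hB hg₃.env hg₃.pool).mono le_rfl ?_
  rintro s₄ fr₄ (⟨h31, j, hj, hsol, hw⟩ | ⟨h31, hno, h5, h6⟩)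
  · refine .inl ⟨h31, _, ?_, hw⟩
    have hV := hval (hg₃.pool.der j hj)
    have hst : ∀ u < S'.nU, ∃ f < S'.nF, s₃.a S'.n j u = f + 1 ∧
        S'.Close pp (S'.B + 4 * S'.b) u (S'.nU + f) := by
      intro u hu'
      have hun : u < S'.n := by simp only [Scheme.n]; omega
      have hcov := cov_fin hG'.rooted hun
      have h0 := hsol.2 u hun
      rcases hV.user u hu' with h | h | ⟨_, _, f, hf', _, h1, h2⟩
      · rw [hsol.1] at h; exact absurd hcov h.1
      · omega
      · exact ⟨f, hf', h1, h2⟩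
    refine ⟨fun u hu' => ?_, fun u hu' => ?_, fun f hf' => ?_⟩
    · obtain ⟨f, hf', h1, _⟩ := hst u hu'
      simp only [h1, Nat.add_sub_cancel]
      exact hf'
    · obtain ⟨f, hf', h1, h2⟩ := hst u hu'
      simp only [h1, Nat.add_sub_cancel]
      exact h2
    · have h1 := hV.load f hf'
      have h2 := hsol.2 (S'.nU + f) (Nat.add_lt_add_left hf' _)
      rw [h2, zero_add] at h1
      -- Truncation in `a u - 1` would confuse an unassigned user with a user of facility `0`, but
      -- every user is assigned by `hst`.
      have h3 : S'.load (s₃.a S'.n j) f =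
          ((Finset.range S.nU).filter fun u => s₃.a S'.n j u - 1 = f).card := by
        rw [Scheme.load, Finset.card_filter]
        refine Finset.sum_congr rfl fun u hu' => ?_
        obtain ⟨g, hg, h1, _⟩ := hst u (Finset.mem_range.1 hu')
        rw [h1]
        simp
      rw [← h3]
      exact h1
  · refine .inr ⟨h31, ?_, ?_, ?_⟩
    · rintro ⟨σ, hσ⟩
      have hσ' : S'.Sol pp S'.B σ := ⟨hσ.lt, hσ.close, hσ.load⟩
      have hpos := hG'.rooted.pos
      have hn0' : 0 < S'.n := hn0
      obtain ⟨q, ⟨j, hj, ht, hq⟩, h0⟩ := Scheme.exists_complete hClosed hPl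
        (hG'.target hN' hσ') hside (hG'.tags) (t := S'.fin) (by simp only [Scheme.fin]; omega)
        fun x hx' => cov_fin hG'.rooted hx'
      exact hno ⟨j, hj, ht, fun x hx' => by rw [← hq x hx', h0 x hx']⟩
    · rw [h5, fr₃.nat 5 rfl, fr₂.nat 5 rfl, fr₁.nat 5 rfl]
    · rw [h6, fr₃.nat 6 rfl, fr₂.nat 6 rfl, fr₁.nat 6 rfl]

/-! ### Exploring a tree given by its edges -/

/-- A list of `nE` edges on the vertices `0, …, nV - 1`. -/
structure Edges where
  nV : ℕ
  nE : ℕ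
  src : ℕ → ℕ
  dst : ℕ → ℕ
  len : ℕ → ℝ

namespace Edges

structure Mem (G : Edges) (s : Store) : Prop where
  nV : s.nat 0 0 = G.nV
  nE : s.nat 0 1 = G.nE
  src : s.nat 1 = G.src
  dst : s.nat 2 = G.dst
  len : s.real 1 = G.len

theorem Mem.frame {G : Edges} {s s' : Store} {p : Prog} (h : G.Mem s) (hf : Frame p s s')
    (h0 : p.writesNat 0 = false) (h1 : p.writesNat 1 = false) (h2 : p.writesNat 2 = false)
    (h3 : p.writesReal 1 = false) : G.Mem s' :=
  ⟨by rw [hf.nat _ h0, h.nV], by rw [hf.nat _ h0, h.nE], by rw [hf.nat _ h1, h.src],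
    by rw [hf.nat _ h2, h.dst], by rw [hf.real _ h3, h.len]⟩

/-- The edge `e` joins `x` and `y`. -/
def Joins (G : Edges) (e x y : ℕ) : Prop :=
  (G.src e = x ∧ G.dst e = y) ∨ (G.src e = y ∧ G.dst e = x)

/-- The vertices that can be reached from vertex `0` along at most the given number of edges. -/
def Reach (G : Edges) : ℕ → ℕ → Prop
  | 0, v => v = 0
  | j + 1, v => G.Reach j v ∨ ∃ e < G.nE, ∃ w, G.Reach j w ∧ G.Joins e w v

/-- `cnt` vertices have been found: `vert k` is the vertex at position `k`, `vis v` is one more than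
the position of `v`, or `0`, and `pp` and `dep` are the parents and the depths of positions. -/
structure Explored (G : Edges) (vis vert pp : ℕ → ℕ) (dep : ℕ → ℝ) (cnt : ℕ) : Prop where
  pos : 0 < cnt
  root : vis 0 = 1
  pp_root : pp 0 = 0
  dep_root : dep 0 = 0
  vert_ok : ∀ k < cnt, vert k < G.nV ∧ vis (vert k) = k + 1
  vis_ok : ∀ v < G.nV, vis v ≠ 0 → vis v - 1 < cnt ∧ vert (vis v - 1) = v
  parent : ∀ k, 0 < k → k < cnt → pp k < k ∧
    ∃ e < G.nE, dep k = dep (pp k) + G.len e ∧ G.Joins e (vert (pp k)) (vert k)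

abbrev Expl (G : Edges) (s : Store) : Prop :=
  G.Explored (s.nat 10) (s.nat 11) (s.nat 12) (s.real 2) (s.nat 13 0)

theorem Explored.cnt_le {G : Edges} {vis vert pp : ℕ → ℕ} {dep : ℕ → ℝ} {cnt : ℕ}
    (h : G.Explored vis vert pp dep cnt) : cnt ≤ G.nV := by
  have := Finset.card_le_card_of_injOn (s := Finset.range cnt) (t := Finset.range G.nV) vert
    (fun k hk => by simpa using (h.vert_ok k (by simpa using hk)).1)
    (fun k hk l hl e => by
      have h1 := (h.vert_ok k (by simpa using hk)).2
      have h2 := (h.vert_ok l (by simpa using hl)).2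
      rw [e] at h1; omega)
  simpa using this

theorem Explored.cnt_eq {G : Edges} {vis vert pp : ℕ → ℕ} {dep : ℕ → ℝ} {cnt : ℕ}
    (h : G.Explored vis vert pp dep cnt) (ha : ∀ v < G.nV, vis v ≠ 0) : cnt = G.nV := by
  refine le_antisymm h.cnt_le ?_
  have := Finset.card_le_card_of_injOn (s := Finset.range G.nV) (t := Finset.range cnt)
    (fun v => vis v - 1)
    (fun k hk => by
      have hk : k < G.nV := by simpa using hk
      simpa using (h.vis_ok k hk (ha k hk)).1)
    (fun k hk l hl e => by
      have hk : k < G.nV := by simpa using hk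
      have hl : l < G.nV := by simpa using hl
      have e : vis k - 1 = vis l - 1 := e
      rw [← (h.vis_ok k hk (ha k hk)).2, ← (h.vis_ok l hl (ha l hl)).2, e])
  simpa using this

theorem Explored.step {G : Edges} {vis vert pp : ℕ → ℕ} {dep : ℕ → ℝ} {cnt e x y : ℕ}
    (h : G.Explored vis vert pp dep cnt) (hx : x < G.nV) (hy : y < G.nV) (he : e < G.nE)
    (hj : G.Joins e x y) (h1 : 1 ≤ vis x) (h2 : vis y = 0) :
    G.Explored (Function.update vis y (cnt + 1)) (Function.update vert cnt y)
      (Function.update pp cnt (vis x - 1))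
      (Function.update dep cnt (dep (vis x - 1) + G.len e)) (cnt + 1) := by
  have hp := h.pos
  have hxv := h.vis_ok x hx (by omega)
  have hy0 : y ≠ 0 := fun e => by rw [e, h.root] at h2; omega
  have hyv : ∀ k < cnt, vert k ≠ y := fun k hk e => by
    have := (h.vert_ok k hk).2; rw [e, h2] at this; omega
  refine ⟨by omega, ?_, ?_, ?_, fun k hk => ?_, fun v hv hne => ?_, fun k hk0 hk => ?_⟩
  · rw [Function.update_of_ne hy0.symm, h.root]
  · rw [Function.update_of_ne hp.ne, h.pp_root]
  · rw [Function.update_of_ne hp.ne, h.dep_root]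
  · rcases Nat.lt_succ_iff_lt_or_eq.1 hk with hk | rfl
    · rw [Function.update_of_ne hk.ne, Function.update_of_ne (hyv k hk)]
      exact h.vert_ok k hk
    · simp [hy]
  · by_cases e : v = y
    · subst e; simp
    · rw [Function.update_of_ne e] at hne ⊢
      have := h.vis_ok v hv hne
      rw [Function.update_of_ne this.1.ne]
      exact ⟨by omega, this.2⟩
  · rcases Nat.lt_succ_iff_lt_or_eq.1 hk with hk | rfl
    · obtain ⟨h3, e', he', h4, h5⟩ := h.parent k hk0 hk
      rw [Function.update_of_ne hk.ne, Function.update_of_ne hk.ne,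
        Function.update_of_ne (by omega), Function.update_of_ne hk.ne,
        Function.update_of_ne (by omega)]
      exact ⟨h3, e', he', h4, h5⟩
    · rw [Function.update_self, Function.update_self, Function.update_self,
        Function.update_of_ne hxv.1.ne, Function.update_of_ne hxv.1.ne, hxv.2]
      exact ⟨hxv.1, e, he, rfl, hj⟩

end Edges

/-- Enter a new vertex along the current edge, whose ends are given in the arrays `A` and `B`. -/
def enter (A B : ℕ) : Prog :=
  .setNat 12 (.var 13) (.get 10 (.get A (.var 52)) - 1) ;;
  .setReal 2 (.var 13) (.get 2 (.get 10 (.get A (.var 52)) - 1) + .get 1 (.var 52)) ;;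
  .setNat 11 (.var 13) (.get B (.var 52)) ;;
  .setNat 10 (.get B (.var 52)) (.var 13 + 1) ;;
  .setNat 13 0 (.var 13 + 1)

/-- Go along the current edge, whose ends are given in the arrays `A` and `B`. -/
def goAlong (A B : ℕ) : Prog :=
  .when (.natLe 1 (.get 10 (.get A (.var 52)))) <|
    .when (.natLe (.get 10 (.get B (.var 52))) 0) (enter A B)

theorem goAlong_spec {G : Edges} {s : Store} {A B e : ℕ} (hG : G.Mem s)
    (hE : G.Expl s) (hx : s.nat A e < G.nV) (hy : s.nat B e < G.nV) (he : e < G.nE)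
    (hj : G.Joins e (s.nat A e) (s.nat B e)) (hc : s.nat 52 0 = e)
    (hA : A = 1 ∨ A = 2) (hB : B = 1 ∨ B = 2) :
    WP (goAlong A B) s 9 fun s' => G.Expl s' ∧ (∀ v, s.nat 10 v ≠ 0 → s'.nat 10 v ≠ 0) ∧
      (s.nat 10 (s.nat A e) ≠ 0 → s'.nat 10 (s.nat B e) ≠ 0) := by
  refine WP.when (T := 7) (fun h1 => WP.when (T := 5) (fun h2 => WP.run rfl le_rfl ?_) fun h2 => ?_)
    fun h1 => ?_
  all_goals simp only [Test.holds_natLe, NExpr.eval_get, NExpr.eval_ofNat, hc] at h1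
  rotate_left 1
  · simp only [Test.holds_natLe, NExpr.eval_get, NExpr.eval_ofNat, hc] at h2
    exact ⟨hE, fun _ h => h, fun _ => by omega⟩
  · exact ⟨hE, fun _ h => h, fun _ => by omega⟩
  simp only [Test.holds_natLe, NExpr.eval_get, NExpr.eval_ofNat, hc] at h2
  have hst := hE.step hx hy he hj h1 (by omega)
  have n10 : 10 ≠ A := by omega
  have n12 : A ≠ 12 := by omega
  have n11 : A ≠ 11 := by omega
  have m12 : B ≠ 12 := by omega
  have m11 : B ≠ 11 := by omega
  have m10 : B ≠ 10 := by omega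
  have hR : ((enter A B).run s).nat 10 = Function.update (s.nat 10) (s.nat B e) (s.nat 13 0 + 1)
    ∧ ((enter A B).run s).nat 11 = Function.update (s.nat 11) (s.nat 13 0) (s.nat B e)
    ∧ ((enter A B).run s).nat 12 =
      Function.update (s.nat 12) (s.nat 13 0) (s.nat 10 (s.nat A e) - 1)
    ∧ ((enter A B).run s).nat 13 0 = s.nat 13 0 + 1
    ∧ ((enter A B).run s).real 2 = Function.update (s.real 2) (s.nat 13 0)
      (s.real 2 (s.nat 10 (s.nat A e) - 1) + G.len e) := by
    have hl := congrFun hG.len e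
    refine ⟨?_, ?_, ?_, ?_, ?_⟩ <;> try funext j
    all_goals
      simp [enter, Prog.run, hc, n12, n11, m12, m11, m10, hl, Function.update_apply]
  obtain ⟨r10, r11, r12, r13, r2⟩ := hR
  refine ⟨?_, fun v hv => ?_, fun _ => ?_⟩
  · show G.Explored _ _ _ _ _
    rw [r10, r11, r12, r13, r2]
    exact hst
  · rw [r10, Function.update_apply]; split_ifs <;> omega
  · rw [r10, Function.update_self]; omega

/-- Find all vertices from vertex `0`. -/
def explore : Prog :=
  .setNat 10 0 1 ;; .setNat 13 0 1 ;;
  .for 51 (.get 0 0) (.for 52 (.get 0 1) (goAlong 1 2 ;; goAlong 2 1))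

/-- After `j` rounds over the edge list, all vertices within `j` edges of vertex `0` have been
found, whatever the order and the orientation of the edges; `nV` rounds suffice. A vertex is entered
only from one already found, so parents come first. -/
theorem explore_spec {G : Edges} {s : Store} {Z : ℕ} (hZ : 16 ≤ Z) (hV : G.nV ≤ Z) (hnE : G.nE ≤ Z)
    (hG : G.Mem s) (hpos : 0 < G.nV) (hends : ∀ e < G.nE, G.src e < G.nV ∧ G.dst e < G.nV)
    (hreach : ∀ v < G.nV, G.Reach G.nV v) (h10 : ∀ i, s.nat 10 i = 0)
    (h12 : ∀ i, s.nat 12 i = 0) (h11 : ∀ i, s.nat 11 i = 0) (h2 : ∀ i, s.real 2 i = 0) :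
    WP explore s (Z ^ 7) fun s' =>
      G.Explored (s'.nat 10) (s'.nat 11) (s'.nat 12) (s'.real 2) G.nV ∧
      ∀ v < G.nV, s'.nat 10 v ≠ 0 := by
  have hZ2 := pow_steps hZ
  refine (WP.seq (T₁ := 1) (T₂ := 1 + Z ^ 6) (R := fun s' => s' = s.writeNat 10 0 1)
    (WP.run rfl le_rfl rfl) fun s₁ fr₁ e₁ => WP.seq (R := fun s' => s' = s₁.writeNat 13 0 1)
    (WP.run rfl le_rfl rfl) fun s₂ fr₂ e₂ => ?_).mono (by omega) fun _ _ h => h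
  have hG₂ : G.Mem s₂ := (hG.frame fr₁ rfl rfl rfl rfl).frame fr₂ rfl rfl rfl rfl
  have hE₂ : G.Expl s₂ := by
    subst e₂ e₁
    refine ⟨by simp, by simp, by simp [h12], by simp [h2], fun k hk => ?_, fun v hv hne => ?_,
      fun k hk hk' => ?_⟩
    · simp only [Store.nat_writeNat] at hk
      obtain rfl : k = 0 := by simpa using hk
      simp [h11, hpos]
    · by_cases e : v = 0
      · subst e; simp [h11]
      · simp [e, h10] at hne
    · simp at hk'; omega
  refine (WP.for (N := G.nV) (T := Z ^ 4)
    (fun j s' => G.Expl s' ∧ ∀ v < G.nV, G.Reach j v → s'.nat 10 v ≠ 0) rfl ?_ ?_ ?_).mono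
    (for_le_pow 4 hZ hV le_rfl le_rfl) ?_
  · intro s' fr; simp [fr.nat 0 rfl, hG₂.nV]
  · refine ⟨hE₂, fun v hv h => ?_⟩
    rw [show v = 0 from h]
    have := hE₂.root
    simp [this]
  · rintro j hj s₃ fr₃ hc₃ ⟨hE₃, hr₃⟩
    refine (WP.for (N := G.nE) (T := 18)
      (fun i s' => G.Expl s' ∧ (∀ v, s₃.nat 10 v ≠ 0 → s'.nat 10 v ≠ 0) ∧
        ∀ e < i, ∀ x y, G.Joins e x y → s₃.nat 10 x ≠ 0 → s'.nat 10 y ≠ 0) rfl ?_ ?_ ?_).mono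
      (for_le_pow 2 hZ hnE (by have : Z ^ 2 = Z * Z := by ring
                               nlinarith) le_rfl) ?_
    · intro s' fr; simp [fr.nat 0 rfl, fr₃.nat 0 rfl, hG₂.nE]
    · exact ⟨hE₃, fun _ h => h, by simp⟩
    · rintro i hi s₄ fr₄ hc₄ ⟨hE₄, hm₄, hr₄⟩
      have hG₄ : G.Mem s₄ := (hG₂.frame fr₃ rfl rfl rfl rfl).frame fr₄ rfl rfl rfl rfl
      have en := hends i hi
      refine (goAlong_spec hG₄ hE₄ (by rw [hG₄.src]; exact en.1) (by rw [hG₄.dst]; exact en.2)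
        hi (.inl ⟨by rw [hG₄.src], by rw [hG₄.dst]⟩) hc₄ (.inl rfl) (.inr rfl)).seq (T₂ := 9)
        fun s₅ fr₅ h₅ => ?_
      obtain ⟨hE₅, hm₅, hr₅⟩ := h₅
      have hG₅ : G.Mem s₅ := hG₄.frame fr₅ rfl rfl rfl rfl
      refine (goAlong_spec hG₅ hE₅ (by rw [hG₅.dst]; exact en.2) (by rw [hG₅.src]; exact en.1)
        hi (.inr ⟨by rw [hG₅.src], by rw [hG₅.dst]⟩) (by rw [fr₅.nat 52 rfl, hc₄]) (.inr rfl)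
        (.inl rfl)).mono le_rfl fun s₆ fr₆ h₆ => ?_
      obtain ⟨hE₆, hm₆, hr₆⟩ := h₆
      rw [hG₅.src, hG₅.dst] at hr₆
      rw [hG₄.src, hG₄.dst] at hr₅
      refine ⟨hE₆, fun v hv => hm₆ _ (hm₅ _ (hm₄ v hv)), fun e he x y hj hx => ?_⟩
      rw [Store.nat_writeNat_of_ne _ (by decide)]
      rcases Nat.lt_succ_iff_lt_or_eq.1 he with he | rfl
      · exact hm₆ _ (hm₅ _ (hr₄ e he x y hj hx))
      · rcases hj with ⟨rfl, rfl⟩ | ⟨rfl, rfl⟩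
        · exact hm₆ _ (hr₅ (hm₄ _ hx))
        · exact hr₆ (hm₅ _ (hm₄ _ hx))
    · rintro s₄ fr₄ ⟨hE₄, hm₄, hr₄⟩
      refine ⟨hE₄, fun v hv h => ?_⟩
      rw [Store.nat_writeNat_of_ne _ (by decide)]
      rcases h with h | ⟨e, he, w, hw, hj⟩
      · exact hm₄ _ (hr₃ v hv h)
      · refine hr₄ e he w v hj (hr₃ w ?_ hw)
        have := hends e he
        rcases hj with ⟨rfl, _⟩ | ⟨_, rfl⟩
        · exact this.1
        · exact this.2
  · rintro s₃ fr₃ ⟨hE₃, hr₃⟩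
    have ha : ∀ v < G.nV, s₃.nat 10 v ≠ 0 := fun v hv => hr₃ v hv (hreach v hv)
    exact ⟨hE₃.cnt_eq ha ▸ hE₃, ha⟩

/-! ### Items, scaled depths, and the tree of merges -/

theorem Edges.Explored.congr {G : Edges} {vis vert pp pp' : ℕ → ℕ} {dep dep' : ℕ → ℝ} {cnt : ℕ}
    (h : G.Explored vis vert pp dep cnt) (hp : ∀ k < cnt, pp' k = pp k)
    (hd : ∀ k < cnt, dep' k = dep k) : G.Explored vis vert pp' dep' cnt := by
  refine ⟨h.pos, h.root, by rw [hp 0 h.pos, h.pp_root], by rw [hd 0 h.pos, h.dep_root], h.vert_ok,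
    h.vis_ok, fun k hk0 hk => ?_⟩
  obtain ⟨h1, h2⟩ := h.parent k hk0 hk
  rw [hp k hk, hd k hk, hd _ (h1.trans hk)]
  exact ⟨h1, h2⟩

/-- Add nodes from position `nat 14 0` on for the items that are located according to array `A`; the
number of these items is found in array `0`. -/
def place (A c : ℕ) : Prog :=
  .for 51 (.get 0 (.const c)) <|
    .setNat 12 (.var 14 + .var 51) (.get 10 (.get A (.var 51)) - 1) ;;
    .setReal 2 (.var 14 + .var 51) (.get 2 (.get 10 (.get A (.var 51)) - 1))

/-- Items become leaves joined to their vertices by edges of length zero, so that each item has its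
own node. The loop reads only positions below `m` and writes from `m` on. -/
theorem place_spec {s : Store} {A c m N Z : ℕ} (hZ : 16 ≤ Z) (hNZ : N ≤ Z) (hA : A = 3 ∨ A = 4)
    (hN : s.nat 0 c = N) (hm : s.nat 14 0 = m) (hl : ∀ i < N, s.nat 10 (s.nat A i) - 1 < m) :
    WP (place A c) s (Z ^ 3) fun s' => (∀ k < m, s'.nat 12 k = s.nat 12 k ∧ s'.real 2 k = s.real 2 k) ∧
      ∀ i < N, s'.nat 12 (m + i) = s.nat 10 (s.nat A i) - 1 ∧
        s'.real 2 (m + i) = s.real 2 (s.nat 10 (s.nat A i) - 1) := by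
  have n12 : A ≠ 12 := by omega
  have hZ2 := pow_steps hZ
  refine (WP.for (N := N) (T := 2)
    (fun j s' => (∀ k < m, s'.nat 12 k = s.nat 12 k ∧ s'.real 2 k = s.real 2 k) ∧
      ∀ i < j, s'.nat 12 (m + i) = s.nat 10 (s.nat A i) - 1 ∧
        s'.real 2 (m + i) = s.real 2 (s.nat 10 (s.nat A i) - 1)) rfl ?_ ?_ ?_).mono
    (for_le_pow 1 hZ hNZ (by omega) le_rfl) fun _ _ h => h
  · intro s' fr; simp [fr.nat 0 rfl, hN]
  · simp
  · rintro j hj s₁ fr hc ⟨h1, h2⟩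
    have e14 := (congrFun (fr.nat 14 rfl) 0).trans hm
    have e10 := fr.nat 10 rfl
    have eA : s₁.nat A = s.nat A := fr.nat A (by rcases hA with rfl | rfl <;> rfl)
    have hlt := hl j hj
    refine WP.run rfl le_rfl ⟨fun k hk => ?_, fun i hi => ?_⟩
    · have : k ≠ m + j := by omega
      simp [Prog.run, e14, hc, this, h1 k hk]
    · rcases Nat.lt_succ_iff_lt_or_eq.1 hi with hi | rfl
      · simp [Prog.run, e14, hc, hi.ne, h2 i hi]
      · simp [Prog.run, e14, hc, eA, e10, n12, h1 _ hlt]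

/-- Find out how often the accuracy has to be added up in order to exceed `4`. -/
def countK : Prog :=
  .loop (.realLe (.var 7) (.one + .one + .one + .one))
    (.setReal 7 0 (.var 7 + .var 0) ;; .setNat 9 0 (.var 9 + 1))

/-- Without division, `K` is found as the least number of copies of `ε` whose sum exceeds `4`; this
gives `4 / K < ε`. -/
theorem countK_spec {s : Store} {ε : ℝ} {Z : ℕ} (hε : 0 < ε) (h0 : s.real 0 0 = ε)
    (h7 : s.real 7 0 = 0) (h9 : s.nat 9 0 = 0) (hZ : 16 ≤ Z) (hK : ⌊4 / ε⌋₊ + 1 ≤ Z) :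
    WP countK s (Z ^ 3) fun s' => s'.nat 9 0 = ⌊4 / ε⌋₊ + 1 := by
  have hZ2 := pow_steps hZ
  refine (WP.loop (N := ⌊4 / ε⌋₊ + 1) (T := 2)
    (Inv := fun k s' => s'.nat 9 0 = k ∧ s'.real 7 0 = k * ε) ?_ ?_).mono
    (loop_le_pow 1 hZ hK (by omega) le_rfl) ?_
  · rintro k s' fr ⟨h1, h2⟩ ht
    have e0 := (congrFun (fr.real 0 rfl) 0).trans h0
    simp only [Test.holds_realLe, RExpr.eval_get, NExpr.eval_ofNat, RExpr.eval_add, RExpr.eval_one,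
      h2] at ht
    refine ⟨Nat.lt_succ_of_le (Nat.le_floor ?_), WP.run rfl le_rfl ?_⟩
    · rw [le_div_iff₀ hε]; linarith
    · simp [Prog.run, h1, h2, e0]; ring
  · simp [h9, h7]
  · rintro s' fr ⟨ht, k, hk, h1, h2⟩
    simp only [Test.holds_realLe, RExpr.eval_get, NExpr.eval_ofNat, RExpr.eval_add, RExpr.eval_one,
      h2] at ht
    rw [h1]
    refine le_antisymm hk (Nat.succ_le_of_lt ((Nat.floor_lt (by positivity)).2 ?_))
    rw [div_lt_iff₀ hε]; linarith

/-- Multiply the depths by the number in `nat 9 0`. -/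
def scale : Prog :=
  .for 51 (.get 0 0 + .var aN) <|
    .setReal rD (.var 51) .zero ;;
    .for 52 (.var 9) (.setReal rD (.var 51) (.get rD (.var 51) + .get 2 (.var 51)))

/-- Classes of radius `b / K` would require a division. With depths multiplied by `K`, the radius is
`b` itself and the threshold is `K * b`, a combination of scaled depths. -/
theorem scale_spec {s : Store} {nV n K Z : ℕ} (hZ : 16 ≤ Z) (hNZ : nV + n ≤ Z) (hKZ : K ≤ Z)
    (hV : s.nat 0 0 = nV) (hn : s.nat aN 0 = n) (hK : s.nat 9 0 = K) :
    WP scale s (Z ^ 6) fun s' => ∀ k < nV + n, s'.real rD k = K * s.real 2 k := by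
  have hZ2 := pow_steps hZ
  refine (WP.for (N := nV + n) (T := Z ^ 4) (fun j s' => ∀ k < j, s'.real rD k = K * s.real 2 k)
    rfl ?_ ?_ ?_).mono (for_le_pow 4 hZ hNZ le_rfl le_rfl) fun _ _ h => h
  · intro s' fr; simp [fr.nat 0 rfl, fr.nat aN rfl, hV, hn]
  · simp
  · intro j hj s₁ fr hc hi
    refine (WP.seq (T₁ := 1) (T₂ := Z ^ 3) (R := fun s' => s' = s₁.writeReal rD j 0)
      (WP.run rfl le_rfl (by simp [Prog.run, hc])) fun s₂ fr₂ e₂ => ?_).mono (by omega) fun _ _ h => h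
    refine (WP.for (N := K) (T := 1) (fun i s' => (∀ k < j, s'.real rD k = s₁.real rD k) ∧
      s'.real rD j = i * s.real 2 j) rfl ?_ ?_ ?_).mono (for_le_pow 1 hZ hKZ (by omega) le_rfl) ?_
    · intro s' fr'; simp [fr'.nat 9 rfl, fr₂.nat 9 rfl, fr.nat 9 rfl, hK]
    · subst e₂
      refine ⟨fun k hk => by simp [hk.ne], by simp⟩
    · rintro i hi s₃ fr₃ hc₃ ⟨i1, i2⟩
      have e2 : s₃.real 2 = s.real 2 := by rw [fr₃.real 2 rfl, fr₂.real 2 rfl, fr.real 2 rfl]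
      have e51 : s₃.nat 51 0 = j := by rw [fr₃.nat 51 rfl, fr₂.nat 51 rfl, hc]
      refine WP.run rfl le_rfl ⟨fun k hk => ?_, ?_⟩
      · simp [Prog.run, e51, hk.ne, i1 k hk]
      · simp [Prog.run, e51, i2, e2]; ring
    · rintro s₃ fr₃ ⟨i1, i2⟩ k hk
      rcases Nat.lt_succ_iff_lt_or_eq.1 hk with hk | rfl
      · simp [i1 k hk, hi k hk]
      · simp [i2]

/-- Compute the tree of merges. -/
def plan : Prog :=
  .for 51 (.get 0 0 + .var aN) (.setNat 15 (.var 51) (.var 51) ;; .setNat aTop (.var 51) (.var 51)) ;;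
  .for 51 (.get 0 0 + .var aN - 1) (
    .setNat aMate (.get 15 (.get 12 (.get 0 0 + .var aN - 1 - .var 51)))
      (.get 15 (.get 0 0 + .var aN - 1 - .var 51)) ;;
    .setNat aOut (.get 15 (.get 12 (.get 0 0 + .var aN - 1 - .var 51)))
      (.get 0 0 + .var aN + .var 51) ;;
    .setNat aTop (.get 0 0 + .var aN + .var 51) (.get 12 (.get 0 0 + .var aN - 1 - .var 51)) ;;
    -- Array `15` holds the current tags. This update comes last because the writes above use the
    -- old tag of the parent as index.
    .setNat 15 (.get 12 (.get 0 0 + .var aN - 1 - .var 51)) (.get 0 0 + .var aN + .var 51))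

theorem IsPlan.step {N t : ℕ} {pp mate out top mate' out' top' : ℕ → ℕ}
    (h : IsPlan N pp mate out top t) (hp : ∀ k < N, pp k < N) (ht : t < N - 1)
    (hm : mate' = Function.update mate (curTag pp N t (pp (N - 1 - t))) (curTag pp N t (N - 1 - t)))
    (ho : out' = Function.update out (curTag pp N t (pp (N - 1 - t))) (N + t))
    (htop : top' = Function.update top (N + t) (pp (N - 1 - t))) :
    IsPlan N pp mate' out' top' (t + 1) := by
  subst hm ho htop
  have hne : ∀ t' < t, curTag pp N t' (pp (N - 1 - t')) ≠ curTag pp N t (pp (N - 1 - t)) :=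
    fun t' h' => (curTag_ne hp (hp _ (by omega)) h').symm
  refine ⟨fun i hi => ?_, fun i hi => ?_, fun x hx => ?_, fun k hk => ?_, fun i hi => ?_⟩
  · rcases Nat.lt_succ_iff_lt_or_eq.1 hi with hi | rfl
    · rw [Function.update_of_ne (hne i hi), h.mate_eq i hi]
    · rw [Function.update_self]
  · rcases Nat.lt_succ_iff_lt_or_eq.1 hi with hi | rfl
    · rw [Function.update_of_ne (hne i hi), h.out_eq i hi]
    · rw [Function.update_self]
  · by_cases e : x = curTag pp N t (pp (N - 1 - t))
    · exact ⟨t, by omega, e⟩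
    · rw [Function.update_of_ne e] at hx
      obtain ⟨i, hi, e⟩ := h.exists_of_out x hx
      exact ⟨i, by omega, e⟩
  · rw [Function.update_of_ne (by omega), h.top_base k hk]
  · rcases Nat.lt_succ_iff_lt_or_eq.1 hi with hi | rfl
    · rw [Function.update_of_ne (by omega), h.top_out i hi]
    · rw [Function.update_self]

theorem plan_spec {s : Store} {nV n Z : ℕ} (hZ : 16 ≤ Z) (hNZ : nV + n ≤ Z) (hV : s.nat 0 0 = nV)
    (hn : s.nat aN 0 = n) (hp : ∀ k < nV + n, s.nat 12 k < nV + n) (h17 : ∀ i, s.nat aOut i = 0) :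
    WP plan s (Z ^ 4) fun s' =>
      IsPlan (nV + n) (s.nat 12) (s'.nat aMate) (s'.nat aOut) (s'.nat aTop) (nV + n - 1) := by
  have hZ2 := pow_steps hZ
  refine (WP.seq (T₁ := Z ^ 3) (T₂ := Z ^ 3)
    (R := fun s' => ∀ k < nV + n, s'.nat 15 k = k ∧ s'.nat aTop k = k) ?_
    fun s₁ fr₁ h₁ => ?_).mono (by omega) fun _ _ h => h
  · refine (WP.for (N := nV + n) (T := 2) (fun j s' => ∀ k < j, s'.nat 15 k = k ∧ s'.nat aTop k = k)
      rfl ?_ ?_ ?_).mono (for_le_pow 1 hZ hNZ (by omega) le_rfl) fun _ _ h => h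
    · intro s' fr; simp [fr.nat 0 rfl, fr.nat aN rfl, hV, hn]
    · simp
    · intro j hj s' fr hc hi
      refine WP.run rfl le_rfl fun k hk => ?_
      rcases Nat.lt_succ_iff_lt_or_eq.1 hk with hk | rfl
      · simp [Prog.run, hc, hk.ne, hi k hk]
      · simp [Prog.run, hc]
  · refine (WP.for (N := nV + n - 1) (T := 4) (fun t s' =>
      (∀ v < nV + n, s'.nat 15 v = curTag (s.nat 12) (nV + n) t v) ∧
      IsPlan (nV + n) (s.nat 12) (s'.nat aMate) (s'.nat aOut) (s'.nat aTop) t)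
      rfl ?_ ?_ ?_).mono (for_le_pow 1 hZ (by omega) (by omega) le_rfl) fun _ _ h => h.2
    · intro s' fr; simp [fr.nat 0 rfl, fr.nat aN rfl, fr₁.nat 0 rfl, fr₁.nat aN rfl, hV, hn]
    · refine ⟨fun v hv => by simp [h₁ v hv, curTag], by simp, by simp, fun x hx => ?_,
        fun k hk => by simp [h₁ k hk], by simp⟩
      simp [fr₁.nat aOut rfl, h17] at hx
    · rintro t ht s₂ fr₂ hc ⟨hcur, hP⟩
      have e0 : s₂.nat 0 0 = nV := by rw [fr₂.nat 0 rfl, fr₁.nat 0 rfl, hV]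
      have e7 : s₂.nat aN 0 = n := by rw [fr₂.nat aN rfl, fr₁.nat aN rfl, hn]
      have e12 : s₂.nat 12 = s.nat 12 := by rw [fr₂.nat 12 rfl, fr₁.nat 12 rfl]
      have hk : nV + n - 1 - t < nV + n := by omega
      have c1 := hcur _ (hp _ hk)
      have c2 := hcur _ hk
      refine WP.run rfl le_rfl ⟨fun v hv => ?_, hP.step hp ht ?_ ?_ ?_⟩
      · simp only [curTag, Function.update_apply, ← hcur v hv]
        simp [Prog.run, hc, e0, e7, e12]
      · funext j
        simp [Prog.run, hc, e0, e7, e12, c1, c2, Function.update_apply]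
      · funext j
        simp [Prog.run, hc, e0, e7, e12, c1, c2, Function.update_apply]
      · funext j
        simp [Prog.run, hc, e0, e7, e12, c1, c2, Function.update_apply]

/-! ### The preparation of the search -/

def prepare : Prog :=
  explore ;;
  (.setNat aN 0 (.get 0 2 + .get 0 3) ;; .setNat 14 0 (.get 0 0)) ;; place 3 2 ;;
  .setNat 14 0 (.get 0 0 + .get 0 2) ;; place 4 3 ;;
  countK ;; scale ;; plan

/-- The arrays after the preparation; the items are located at the vertices `loc 0`, …. -/
structure Edges.Layout (G : Edges) (n K : ℕ) (loc : ℕ → ℕ) (s : Store) : Prop where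
  explored : G.Explored (s.nat 10) (s.nat 11) (s.nat 12) (s.real 2) G.nV
  all : ∀ v < G.nV, s.nat 10 v ≠ 0
  pp_item : ∀ x < n, s.nat 12 (G.nV + x) = s.nat 10 (loc x) - 1
  dep_item : ∀ x < n, s.real 2 (G.nV + x) = s.real 2 (s.nat 10 (loc x) - 1)
  plan : IsPlan (G.nV + n) (s.nat 12) (s.nat aMate) (s.nat aOut) (s.nat aTop) (G.nV + n - 1)
  scaled : ∀ k < G.nV + n, s.real rD k = K * s.real 2 k

theorem Edges.Explored.rooted {G : Edges} {vis vert pp loc : ℕ → ℕ} {dep : ℕ → ℝ} {n : ℕ}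
    (h : G.Explored vis vert pp dep G.nV) (ha : ∀ v < G.nV, vis v ≠ 0)
    (hl : ∀ x < n, loc x < G.nV) (hi : ∀ x < n, pp (G.nV + x) = vis (loc x) - 1) :
    Rooted G.nV n pp := by
  have hit : ∀ x < n, pp (G.nV + x) < G.nV := fun x hx => by
    rw [hi x hx]; exact (h.vis_ok _ (hl x hx) (ha _ (hl x hx))).1
  refine ⟨h.pos, h.pp_root, fun k hk hkn => ?_, hit⟩
  rcases lt_or_ge k G.nV with hv | hv
  · exact (h.parent k hk hv).1
  · obtain ⟨x, rfl⟩ := Nat.exists_eq_add_of_le hv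
    have := hit x (by omega)
    omega

theorem prepare_spec {G : Edges} {s : Store} {nU nF Z : ℕ} {ε : ℝ} (hZ : 16 ≤ Z)
    (hN : G.nV + (nU + nF) ≤ Z) (hnE : G.nE ≤ Z) (hKZ : ⌊4 / ε⌋₊ + 1 ≤ Z) (hG : G.Mem s)
    (hU : s.nat 0 2 = nU) (hF : s.nat 0 3 = nF) (hpos : 0 < G.nV)
    (hends : ∀ e < G.nE, G.src e < G.nV ∧ G.dst e < G.nV)
    (hreach : ∀ v < G.nV, G.Reach G.nV v) (hu : ∀ u < nU, s.nat 3 u < G.nV)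
    (hf : ∀ f < nF, s.nat 4 f < G.nV) (hε : 0 < ε) (h0 : s.real 0 0 = ε)
    (hnat : ∀ A, 7 ≤ A → ∀ i, s.nat A i = 0) (hreal : ∀ A, 2 ≤ A → ∀ i, s.real A i = 0) :
    WP prepare s (Z ^ 8) fun s' => s'.nat aN 0 = nU + nF ∧
      G.Layout (nU + nF) (⌊4 / ε⌋₊ + 1) (fun x => if x < nU then s.nat 3 x else s.nat 4 (x - nU)) s' := by
  have hZ2 := pow_steps hZ
  refine ((explore_spec hZ (by omega) hnE hG hpos hends hreach (hnat 10 (by omega))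
    (hnat 12 (by omega)) (hnat 11 (by omega)) (hreal 2 (by omega))).seq (T₂ := 2 + (Z ^ 3 +
      (1 + (Z ^ 3 + (Z ^ 3 + (Z ^ 6 + Z ^ 4)))))) fun s₁ fr₁ h₁ => ?_).mono (by omega) fun _ _ h => h
  obtain ⟨hE₁, ha₁⟩ := h₁
  have hvis : ∀ v < G.nV, s₁.nat 10 v - 1 < G.nV := fun v hv => (hE₁.vis_ok v hv (ha₁ v hv)).1
  refine WP.seq (R := fun s' => s'.nat aN 0 = nU + nF ∧ s'.nat 14 0 = G.nV)
    (WP.run rfl le_rfl (by simp [Prog.run, fr₁.nat 0 rfl, hU, hF, hG.nV])) fun s₂ fr₂ h₂ => ?_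
  have a0 : s₂.nat 0 = s.nat 0 := by rw [fr₂.nat 0 rfl, fr₁.nat 0 rfl]
  have a3 : s₂.nat 3 = s.nat 3 := by rw [fr₂.nat 3 rfl, fr₁.nat 3 rfl]
  have a10 : s₂.nat 10 = s₁.nat 10 := fr₂.nat 10 rfl
  refine (place_spec (N := nU) (m := G.nV) hZ (by omega) (.inl rfl) (by rw [a0, hU]) h₂.2
    fun i hi => by rw [a10, a3]; exact hvis _ (hu i hi)).seq fun s₃ fr₃ h₃ => ?_
  refine WP.seq (R := fun s' => s'.nat 14 0 = G.nV + nU)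
    (WP.run rfl le_rfl (by simp [Prog.run, fr₃.nat 0 rfl, a0, hU, hG.nV])) fun s₄ fr₄ h₄ => ?_
  have b0 : s₄.nat 0 = s.nat 0 := by rw [fr₄.nat 0 rfl, fr₃.nat 0 rfl, a0]
  have b4 : s₄.nat 4 = s.nat 4 := by
    rw [fr₄.nat 4 rfl, fr₃.nat 4 rfl, fr₂.nat 4 rfl, fr₁.nat 4 rfl]
  have b10 : s₄.nat 10 = s₁.nat 10 := by rw [fr₄.nat 10 rfl, fr₃.nat 10 rfl, a10]
  refine (place_spec (N := nF) (m := G.nV + nU) hZ (by omega) (.inr rfl) (by rw [b0, hF]) h₄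
    fun i hi => by
      rw [b10, b4]; exact (hvis _ (hf i hi)).trans_le (by omega)).seq fun s₅ fr₅ h₅ => ?_
  have c0 : s₅.nat 0 = s.nat 0 := by rw [fr₅.nat 0 rfl, b0]
  have c9 : s₅.nat 9 0 = 0 := by
    rw [fr₅.nat 9 rfl, fr₄.nat 9 rfl, fr₃.nat 9 rfl, fr₂.nat 9 rfl, fr₁.nat 9 rfl, hnat 9 (by omega)]
  have c7 : s₅.real 7 0 = 0 := by
    rw [fr₅.real 7 rfl, fr₄.real 7 rfl, fr₃.real 7 rfl, fr₂.real 7 rfl, fr₁.real 7 rfl,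
      hreal 7 (by omega)]
  have cr0 : s₅.real 0 0 = ε := by
    rw [fr₅.real 0 rfl, fr₄.real 0 rfl, fr₃.real 0 rfl, fr₂.real 0 rfl, fr₁.real 0 rfl, h0]
  have cN : s₅.nat aN 0 = nU + nF := by rw [fr₅.nat aN rfl, fr₄.nat aN rfl, fr₃.nat aN rfl, h₂.1]
  have c17 : ∀ i, s₅.nat aOut i = 0 := by
    rw [fr₅.nat aOut rfl, fr₄.nat aOut rfl, fr₃.nat aOut rfl, fr₂.nat aOut rfl, fr₁.nat aOut rfl]
    exact hnat _ (by omega)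
  have c10 : s₅.nat 10 = s₁.nat 10 := by rw [fr₅.nat 10 rfl, b10]
  have c11 : s₅.nat 11 = s₁.nat 11 := by
    rw [fr₅.nat 11 rfl, fr₄.nat 11 rfl, fr₃.nat 11 rfl, fr₂.nat 11 rfl]
  have hlow : ∀ k < G.nV, s₅.nat 12 k = s₁.nat 12 k ∧ s₅.real 2 k = s₁.real 2 k := fun k hk => by
    have h := h₅.1 k (by omega)
    have h' := h₃.1 k hk
    rw [fr₄.nat 12 rfl, fr₄.real 2 rfl] at h
    rw [fr₂.nat 12 rfl, fr₂.real 2 rfl] at h'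
    exact ⟨h.1.trans h'.1, h.2.trans h'.2⟩
  set loc : ℕ → ℕ := fun x => if x < nU then s.nat 3 x else s.nat 4 (x - nU) with hloc
  have hlocV : ∀ x < nU + nF, loc x < G.nV := fun x hx => by
    simp only [hloc]
    split_ifs with h
    · exact hu x h
    · exact hf _ (by omega)
  have hit : ∀ x < nU + nF, s₅.nat 12 (G.nV + x) = s₁.nat 10 (loc x) - 1 ∧
      s₅.real 2 (G.nV + x) = s₁.real 2 (s₁.nat 10 (loc x) - 1) := fun x hx => by
    simp only [hloc]
    split_ifs with h
    · have h1 := h₅.1 (G.nV + x) (by omega)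
      have h2 := h₃.2 x h
      rw [fr₄.nat 12 rfl, fr₄.real 2 rfl] at h1
      rw [a10, a3, fr₂.real 2 rfl] at h2
      exact ⟨h1.1.trans h2.1, h1.2.trans h2.2⟩
    · have h1 := h₅.2 (x - nU) (by omega)
      have e : G.nV + nU + (x - nU) = G.nV + x := by omega
      rw [b10, b4, fr₄.real 2 rfl, e] at h1
      have h2 := (h₃.1 _ (hvis _ (hf (x - nU) (by omega)))).2
      rw [fr₂.real 2 rfl] at h2
      exact ⟨h1.1, h1.2.trans h2⟩
  have hE₅ : G.Explored (s₅.nat 10) (s₅.nat 11) (s₅.nat 12) (s₅.real 2) G.nV := by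
    rw [c10, c11]
    exact hE₁.congr (fun k hk => (hlow k hk).1) fun k hk => (hlow k hk).2
  have ha₅ : ∀ v < G.nV, s₅.nat 10 v ≠ 0 := by rw [c10]; exact ha₁
  have hR := hE₅.rooted ha₅ hlocV fun x hx => by rw [(hit x hx).1, c10]
  refine (countK_spec hε cr0 c7 c9 hZ hKZ).seq fun s₆ fr₆ h₆ => ?_
  refine (scale_spec hZ hN hKZ (by rw [fr₆.nat 0 rfl, c0, hG.nV]) (by rw [fr₆.nat aN rfl, cN])
    h₆).seq fun s₇ fr₇ h₇ => ?_
  have d12 : s₇.nat 12 = s₅.nat 12 := by rw [fr₇.nat 12 rfl, fr₆.nat 12 rfl]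
  refine (plan_spec hZ hN (by rw [fr₇.nat 0 rfl, fr₆.nat 0 rfl, c0, hG.nV])
    (by rw [fr₇.nat aN rfl, fr₆.nat aN rfl, cN]) (fun k hk => by
      rw [d12]; exact (hR.pp_lt_nV hk).trans_le (by omega))
    (by rw [fr₇.nat aOut rfl, fr₆.nat aOut rfl]; exact c17)).mono le_rfl fun s₈ fr₈ h₈ => ?_
  have e10 : s₈.nat 10 = s₅.nat 10 := by rw [fr₈.nat 10 rfl, fr₇.nat 10 rfl, fr₆.nat 10 rfl]
  have e11 : s₈.nat 11 = s₅.nat 11 := by rw [fr₈.nat 11 rfl, fr₇.nat 11 rfl, fr₆.nat 11 rfl]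
  have e12 : s₈.nat 12 = s₅.nat 12 := by rw [fr₈.nat 12 rfl, d12]
  have er2 : s₈.real 2 = s₅.real 2 := by rw [fr₈.real 2 rfl, fr₇.real 2 rfl, fr₆.real 2 rfl]
  refine ⟨by rw [fr₈.nat aN rfl, fr₇.nat aN rfl, fr₆.nat aN rfl, cN], ?_, ?_, ?_, ?_, ?_, ?_⟩
  · rw [e10, e11, e12, er2]; exact hE₅
  · rw [e10]; exact ha₅
  · intro x hx; rw [e12, e10, c10, (hit x hx).1]
  · intro x hx
    rw [er2, e10, c10, (hit x hx).2, (hlow _ (hvis _ (hlocV x hx))).2]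
  · rw [e12, ← d12]; exact h₈
  · intro k hk; rw [fr₈.real rD rfl, er2, h₇ k hk, fr₆.real 2 rfl]

/-! ### The search over all thresholds -/

/-- Try the threshold that belongs to vertex `nat 50 0`, user `nat 51 0` and facility `nat 52 0`. -/
def tryTriple : Prog :=
  .setReal rb 0 (.get 2 (.get 0 0 + .var 51) + .get 2 (.get 0 0 + (.get 0 2 + .var 52)) -
    .get 2 (.var 50) - .get 2 (.var 50)) ;;
  .setReal rB 0 (.get rD (.get 0 0 + .var 51) + .get rD (.get 0 0 + (.get 0 2 + .var 52)) -
    .get rD (.var 50) - .get rD (.var 50)) ;;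
  .when (.realLe .zero (.var rb)) (
    -- As long as nothing has been found, the record is set to the current threshold, so that the
    -- comparison below succeeds.
    .when (.natLe (.var 30) 0) (.setReal 6 0 (.var rb)) ;;
    .when (.realLe (.var rb) (.var 6)) (
      decide ;; .when (.natLe 1 (.var 31)) (.setNat 30 0 1 ;; .setReal 6 0 (.var rb))))

def search : Prog :=
  .for 50 (.get 0 0) <| .for 51 (.get 0 2) <| .for 52 (.get 0 3) tryTriple

namespace Scheme

variable {S : Scheme} {pp : ℕ → ℕ} {dep : ℕ → ℝ} {K : ℕ} {done : ℕ → ℕ → ℕ → Prop} {s : Store}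

/-- The distance between user `u` and facility `f` if position `a` is where their paths meet. -/
def span (S : Scheme) (dep : ℕ → ℝ) (a u f : ℕ) : ℝ :=
  dep (S.nV + u) + dep (S.nV + (S.nU + f)) - dep a - dep a

def Solvable (S : Scheme) (pp : ℕ → ℕ) (K : ℕ) (b : ℝ) : Prop := 0 ≤ b ∧ ∃ σ, S.Sol pp (K * b) σ

/-- The store holds the best solution that has been found with the thresholds in `done`. -/
def Best (S : Scheme) (pp : ℕ → ℕ) (dep : ℕ → ℝ) (K : ℕ) (done : ℕ → ℕ → ℕ → Prop) (s : Store) :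
    Prop :=
  (s.nat 30 0 = 0 ∧ ∀ a u f, done a u f → ¬ S.Solvable pp K (S.span dep a u f)) ∨
  (1 ≤ s.nat 30 0 ∧ 0 ≤ s.real 6 0 ∧
    (∃ σ, S.Sol pp (K * s.real 6 0 + 4 * s.real 6 0) σ ∧ s.Writes S.nU S.nF σ) ∧
    ∀ a u f, done a u f → S.Solvable pp K (S.span dep a u f) → s.real 6 0 ≤ S.span dep a u f)

theorem Best.congr {s' : Store} {done' : ℕ → ℕ → ℕ → Prop} (h : S.Best pp dep K done s)
    (h30 : s'.nat 30 = s.nat 30) (h5 : s'.nat 5 = s.nat 5) (h6 : s'.nat 6 = s.nat 6)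
    (hr : s'.real 6 = s.real 6) (hd : ∀ a u f, done' a u f → done a u f) :
    S.Best pp dep K done' s' := by
  rw [Best, h30, hr]
  simp only [Store.Writes, h5, h6]
  exact h.imp (fun h => ⟨h.1, fun a u f hd' => h.2 a u f (hd a u f hd')⟩)
    fun h => ⟨h.1, h.2.1, h.2.2.1, fun a u f hd' => h.2.2.2 a u f (hd a u f hd')⟩

end Scheme

/-- What the search over all thresholds needs to know. -/
structure Ready (S : Scheme) (pp : ℕ → ℕ) (dep : ℕ → ℝ) (K Z : ℕ) (s : Store) : Prop where
  env : Env S s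
  dep_eq : s.real 2 = dep
  rooted : Rooted S.nV S.n pp
  plan : IsPlan (S.nV + S.n) pp S.mate S.out S.top (S.nV + S.n - 1)
  mono : ∀ k < S.nV + S.n, dep (pp k) ≤ dep k
  scaled : ∀ k < S.nV + S.n, S.D k = K * dep k
  pos : 0 < S.n
  two : 16 ≤ Z
  n_le : S.n ≤ Z
  nV_le : S.nV ≤ Z
  nU_le : S.nU + 1 ≤ Z
  nF_le : S.nF ≤ Z
  pool : 2 * (S.nV + S.n) * (S.n * S.nU + 1) ^ (2 * (K + 3)) ≤ Z

/-- The threshold need not be a distance, since `decide` is correct for every `b ≥ 0`. Rejecting it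
is harmless in each case: it is negative, or it exceeds the record, or `decide` has shown that no
solution meets it. A success replaces the record by a value that is not larger. -/
theorem tryTriple_spec {S : Scheme} {pp : ℕ → ℕ} {dep : ℕ → ℝ} {K Z : ℕ} {s₀ s : Store}
    {done : ℕ → ℕ → ℕ → Prop} (h : Ready S pp dep K Z s₀) (fr : Frame search s₀ s) {a u f : ℕ}
    (ha : a < S.nV) (hu : u < S.nU) (hf : f < S.nF) (h50 : s.nat 50 0 = a) (h51 : s.nat 51 0 = u)
    (h52 : s.nat 52 0 = f) (hb : S.Best pp dep K done s) :
    WP tryTriple s (Z ^ 23)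
      (S.Best pp dep K fun a' u' f' => done a' u' f' ∨ (a' = a ∧ u' = u ∧ f' = f)) := by
  have hZ2 := pow_steps h.two
  have he := h.env
  have e0 := fr.nat 0 rfl
  have e2 := fr.real 2 rfl
  have e3 := fr.real rD rfl
  have nu : S.nV + u < S.nV + S.n := by simp only [Scheme.n]; omega
  have nf : S.nV + (S.nU + f) < S.nV + S.n := by simp only [Scheme.n]; omega
  set v := S.span dep a u f with hv
  have hB : S.D (S.nV + u) + S.D (S.nV + (S.nU + f)) - S.D a - S.D a = K * v := by
    rw [h.scaled _ nu, h.scaled _ nf, h.scaled a (by omega), hv, Scheme.span]; ring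
  refine (WP.seq (T₁ := 1) (T₂ := 1 + (Z ^ 22 + 13)) (R := fun s' => s' = s.writeReal rb 0 v)
    (WP.run rfl le_rfl ?_) fun s₁ fr₁ e₁ =>
    WP.seq (R := fun s' => s' = s₁.writeReal rB 0 (K * v)) (WP.run rfl le_rfl ?_)
    fun s₂ fr₂ e₂ => ?_).mono (by omega) fun _ _ h => h
  · simp [Prog.run, h50, h51, h52, e0, he.nV, he.nU, e2, h.dep_eq, hv, Scheme.span]
  · simp [Prog.run, fr₁.nat 50 rfl, fr₁.nat 51 rfl, fr₁.nat 52 rfl, h50, h51, h52, fr₁.nat 0 rfl,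
      fr₁.real rD rfl, e0, he.nV, he.nU, e3, he.D, hB]
  have v4 : s₂.real rb 0 = v := by subst e₂ e₁; simp
  have v5 : s₂.real rB 0 = K * v := by subst e₂; simp
  have hb₂ : S.Best pp dep K done s₂ := hb.congr (by rw [fr₂.nat 30 rfl, fr₁.nat 30 rfl])
    (by rw [fr₂.nat 5 rfl, fr₁.nat 5 rfl]) (by rw [fr₂.nat 6 rfl, fr₁.nat 6 rfl])
    (by rw [fr₂.real 6 rfl, fr₁.real 6 rfl]) fun _ _ _ h => h
  have hskip : ∀ s', S.Best pp dep K done s' → ¬ S.Solvable pp K v →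
      S.Best pp dep K (fun a' u' f' => done a' u' f' ∨ (a' = a ∧ u' = u ∧ f' = f)) s' := by
    refine fun s' hb hn => hb.imp (fun hb => ⟨hb.1, ?_⟩) fun hb => ⟨hb.1, hb.2.1, hb.2.2.1, ?_⟩
    · rintro a' u' f' (hd | ⟨rfl, rfl, rfl⟩)
      · exact hb.2 _ _ _ hd
      · exact hn
    · rintro a' u' f' (hd | ⟨rfl, rfl, rfl⟩)
      · exact hb.2.2.2 _ _ _ hd
      · exact fun h => absurd h hn
  refine (WP.when (T := Z ^ 22 + 10) (fun ht => ?_) fun ht => ?_).mono (by omega) fun _ _ h => h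
  all_goals
    simp only [Test.holds_realLe, RExpr.eval_zero, RExpr.eval_get, NExpr.eval_ofNat, v4] at ht
  rotate_left 1
  · exact hskip _ hb₂ fun h => ht h.1
  refine (WP.seq (T₁ := 3) (T₂ := Z ^ 22 + 6) (R := fun s' => S.Best pp dep K done s' ∧
    (s'.nat 30 0 = 0 → s'.real 6 0 = v)) ?_ fun s₃ fr₃ h₃ => ?_).mono (by omega) fun _ _ h => h
  · refine WP.when (T := 1) (fun h0 => WP.run rfl le_rfl ?_) fun h0 => ⟨hb₂, fun h0' => ?_⟩
    all_goals
      simp only [Test.holds_natLe, NExpr.eval_get, NExpr.eval_ofNat] at h0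
    · have h0' : s₂.nat 30 0 = 0 := by omega
      refine ⟨.inl ⟨h0', (hb₂.resolve_right fun h => ?_).2⟩, fun _ => by simp [Prog.run, v4]⟩
      have := h.1
      omega
    · omega
  obtain ⟨hb₃, h6⟩ := h₃
  have w4 : s₃.real rb 0 = v := by rw [fr₃.real rb rfl, v4]
  refine (WP.when (T := Z ^ 22 + 4) (fun ht' => ?_) fun ht' => ?_).mono (by omega) fun _ _ h => h
  all_goals
    simp only [Test.holds_realLe, RExpr.eval_get, NExpr.eval_ofNat, w4] at ht'
  rotate_left 1
  · refine .inr ?_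
    rcases hb₃ with hb₃ | hb₃
    · rw [h6 hb₃.1] at ht'
      exact absurd le_rfl ht'
    · refine ⟨hb₃.1, hb₃.2.1, hb₃.2.2.1, ?_⟩
      rintro a' u' f' (hd | ⟨rfl, rfl, rfl⟩)
      · exact hb₃.2.2.2 _ _ _ hd
      · exact fun _ => (not_le.1 ht').le
  have n0 : s₃.nat 0 = s₀.nat 0 := by rw [fr₃.nat 0 rfl, fr₂.nat 0 rfl, fr₁.nat 0 rfl, e0]
  set S' : Scheme := { S with cid := s₃.nat aCid, b := v, B := K * v } with hS'
  have he' : Env S' s₃ := by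
    refine ⟨by rw [n0, he.nV], by rw [n0, he.nU], by rw [n0, he.nF], by rw [n0, he.r], ?_, rfl,
      ?_, ?_, ?_, ?_, w4, ?_⟩
    · rw [fr₃.nat aN rfl, fr₂.nat aN rfl, fr₁.nat aN rfl, fr.nat aN rfl, he.n]
    · rw [fr₃.nat aMate rfl, fr₂.nat aMate rfl, fr₁.nat aMate rfl, fr.nat aMate rfl, he.mate]
    · rw [fr₃.nat aOut rfl, fr₂.nat aOut rfl, fr₁.nat aOut rfl, fr.nat aOut rfl, he.out]
    · rw [fr₃.nat aTop rfl, fr₂.nat aTop rfl, fr₁.nat aTop rfl, fr.nat aTop rfl, he.top]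
    · rw [fr₃.real rD rfl, fr₂.real rD rfl, fr₁.real rD rfl, e3, he.D]
    · rw [fr₃.real rB rfl, v5]
  have hG' : S'.Geo pp K := by
    refine ⟨h.rooted, h.plan, fun k hk => ?_, rfl, ht⟩
    have hk' : k < S.nV + S.n := hk
    have h1 := h.scaled k hk'
    have h2 := h.scaled (pp k) ((h.rooted.pp_lt_nV hk').trans_le (by omega))
    show S.D (pp k) ≤ S.D k
    rw [h1, h2]
    exact mul_le_mul_of_nonneg_left (h.mono k hk') (Nat.cast_nonneg _)
  refine ((decide_spec he' hG' h.pos h.two h.n_le h.nV_le h.nU_le h.nF_le h.pool).seq (T₂ := 4)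
    fun s₄ fr₄ h₄ => ?_).mono (by omega) fun _ _ h => h
  have x4 : s₄.real rb 0 = v := by rw [fr₄.real rb rfl, w4]
  rcases h₄ with ⟨h31, σ, hσ, hw⟩ | ⟨h31, hno, h5, h6'⟩
  · refine WP.when (T := 2) (fun _ => WP.run rfl le_rfl ?_) fun hn => absurd h31 hn
    refine .inr ⟨by simp [Prog.run], by simpa [Prog.run, x4] using ht, ⟨σ, ?_, ?_⟩, ?_⟩
    · simp only [Prog.run, Store.real_writeReal, NExpr.eval_ofNat, RExpr.eval_get,
        Store.real_writeNat, x4, and_self, if_true]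
      exact ⟨hσ.lt, hσ.close, hσ.load⟩
    · simpa [Prog.run, Store.Writes] using hw
    · have e : ∀ a' u' f', done a' u' f' → S.Solvable pp K (S.span dep a' u' f') →
          v ≤ S.span dep a' u' f' := fun a' u' f' hd hs => by
        rcases hb₃ with hb₃ | hb₃
        · exact absurd hs (hb₃.2 _ _ _ hd)
        · exact ht'.trans (hb₃.2.2.2 _ _ _ hd hs)
      simp only [Prog.run, Store.real_writeReal, NExpr.eval_ofNat, RExpr.eval_get,
        Store.real_writeNat, x4, and_self, if_true]
      rintro a' u' f' (hd | ⟨rfl, rfl, rfl⟩) hs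
      · exact e _ _ _ hd hs
      · exact le_rfl
  · refine WP.when (T := 2) (fun hn => ?_) fun _ => ?_
    · simp only [Test.holds_natLe, NExpr.eval_get, NExpr.eval_ofNat, h31] at hn
      omega
    · refine hskip _ (hb₃.congr (fr₄.nat 30 rfl) h5 h6' (fr₄.real 6 rfl) fun _ _ _ h => h) ?_
      rintro ⟨_, σ, hσ⟩
      exact hno ⟨σ, hσ.lt, hσ.close, hσ.load⟩

theorem search_spec {S : Scheme} {pp : ℕ → ℕ} {dep : ℕ → ℝ} {K Z : ℕ} {s : Store}
    (h : Ready S pp dep K Z s) (h30 : s.nat 30 0 = 0) :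
    WP search s (Z ^ 29)
      (S.Best pp dep K fun a u f => a < S.nV ∧ u < S.nU ∧ f < S.nF) := by
  have hU := h.nU_le
  refine (WP.for (N := S.nV) (T := Z ^ 27)
    (fun j => S.Best pp dep K fun a u f => a < j ∧ u < S.nU ∧ f < S.nF) rfl ?_ ?_ ?_).mono
    (for_le_pow 27 h.two h.nV_le le_rfl le_rfl) fun _ _ h => h
  · intro s' fr; simp [fr.nat 0 rfl, h.env.nV]
  · exact .inl ⟨by simpa using h30, by simp⟩
  · intro j hj s₁ fr₁ hc₁ hb₁
    refine (WP.for (N := S.nU) (T := Z ^ 25)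
      (fun i => S.Best pp dep K fun a u f => (a < j ∧ u < S.nU ∧ f < S.nF) ∨
        (a = j ∧ u < i ∧ f < S.nF)) rfl ?_ ?_ ?_).mono
      (for_le_pow 25 h.two (by omega) le_rfl le_rfl) fun s' fr' hb => ?_
    · intro s' fr; simp [fr.nat 0 rfl, fr₁.nat 0 rfl, h.env.nU]
    · exact hb₁.congr (Store.nat_writeNat_of_ne _ (by decide) _ _)
        (Store.nat_writeNat_of_ne _ (by decide) _ _) (Store.nat_writeNat_of_ne _ (by decide) _ _) rfl
        fun a u f => by omega
    · intro i hi s₂ fr₂ hc₂ hb₂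
      refine (WP.for (N := S.nF) (T := Z ^ 23)
        (fun l => S.Best pp dep K fun a u f => ((a < j ∧ u < S.nU ∧ f < S.nF) ∨
          (a = j ∧ u < i ∧ f < S.nF)) ∨ (a = j ∧ u = i ∧ f < l)) rfl ?_ ?_ ?_).mono
        (for_le_pow 23 h.two h.nF_le le_rfl le_rfl) fun s' fr' hb => ?_
      · intro s' fr; simp [fr.nat 0 rfl, fr₂.nat 0 rfl, fr₁.nat 0 rfl, h.env.nF]
      · exact hb₂.congr (Store.nat_writeNat_of_ne _ (by decide) _ _)
          (Store.nat_writeNat_of_ne _ (by decide) _ _) (Store.nat_writeNat_of_ne _ (by decide) _ _)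
          rfl fun a u f => by omega
      · intro l hl s₃ fr₃ hc₃ hb₃
        have fr : Frame search s s₃ := by
          refine ⟨fun A hA => ?_, fun A hA => ?_⟩
          · simp only [search, Prog.for, Prog.writesNat, Bool.or_eq_false_iff, Bool.or_self] at hA
            have h₁ := fr₁.nat A
            have h₂ := fr₂.nat A
            have h₃ := fr₃.nat A
            simp only [Prog.for, Prog.writesNat, Bool.or_eq_false_iff, Bool.or_self] at h₁ h₂ h₃
            rw [h₃ (by tauto), h₂ (by tauto), h₁ (by tauto)]
          · simp only [search, Prog.for, Prog.writesReal, Bool.or_eq_false_iff, Bool.or_self] at hA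
            have h₁ := fr₁.real A
            have h₂ := fr₂.real A
            have h₃ := fr₃.real A
            simp only [Prog.for, Prog.writesReal, Bool.or_eq_false_iff, Bool.or_self] at h₁ h₂ h₃
            rw [h₃ (by tauto), h₂ (by tauto), h₁ (by tauto)]
        refine (tryTriple_spec h fr hj hi hl (by rw [fr₃.nat 50 rfl, fr₂.nat 50 rfl, hc₁])
          (by rw [fr₃.nat 51 rfl, hc₂]) hc₃ hb₃).mono le_rfl fun s' fr' hb => ?_
        exact hb.congr (Store.nat_writeNat_of_ne _ (by decide) _ _)
          (Store.nat_writeNat_of_ne _ (by decide) _ _) (Store.nat_writeNat_of_ne _ (by decide) _ _)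
          rfl fun a u f => by omega
      · exact hb.congr (Store.nat_writeNat_of_ne _ (by decide) _ _)
          (Store.nat_writeNat_of_ne _ (by decide) _ _) (Store.nat_writeNat_of_ne _ (by decide) _ _)
          rfl fun a u f => by omega
    · exact hb.congr (Store.nat_writeNat_of_ne _ (by decide) _ _)
        (Store.nat_writeNat_of_ne _ (by decide) _ _) (Store.nat_writeNat_of_ne _ (by decide) _ _) rfl
        fun a u f => by omega

/-! ### Tree metrics from depths -/

namespace WeightedTree

variable {V : Type*} (T : WeightedTree V)

/-- The total length of the edges of a walk. -/
def weight {v w : V} (p : T.graph.Walk v w) : ℝ := (p.edges.map T.length).sum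

theorem dist_eq {v w : V} : ∃ p : T.graph.Walk v w, p.IsPath ∧ T.dist v w = T.weight p :=
  ⟨_, (T.isTree.existsUnique_path v w).choose_spec.1, rfl⟩

theorem length_mem {v w : V} (p : T.graph.Walk v w) : ∀ x ∈ p.edges.map T.length, 0 ≤ x := by
  intro x hx
  obtain ⟨e, he, rfl⟩ := List.mem_map.1 hx
  exact T.length_nonneg e (p.edges_subset_edgeSet he)

theorem dist_nonneg (v w : V) : 0 ≤ T.dist v w := by
  obtain ⟨p, _, h⟩ := T.dist_eq (v := v) (w := w)
  rw [h]
  exact List.sum_nonneg (T.length_mem p)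

theorem _root_.List.Sublist.sum_le_of_nonneg {l l' : List ℝ} (h : l.Sublist l')
    (hl : ∀ x ∈ l', 0 ≤ x) : l.sum ≤ l'.sum := by
  induction h with
  | slnil => exact le_rfl
  | cons a _ ih =>
    have h1 := hl a (by simp)
    have h2 := ih fun x hx => hl x (by simp [hx])
    simp only [List.sum_cons]; linarith
  | cons_cons a _ ih =>
    have h2 := ih fun x hx => hl x (by simp [hx])
    simp only [List.sum_cons]; linarith

/-- Removing the detours of a walk gives the unique path, whose edges form a sublist of the edges of
the walk; lengths are non-negative. -/
theorem dist_le_weight {v w : V} (p : T.graph.Walk v w) : T.dist v w ≤ T.weight p := by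
  classical
  have h := (T.isTree.existsUnique_path v w).unique
    (T.isTree.existsUnique_path v w).choose_spec.1 p.bypass_isPath
  have e : T.dist v w = T.weight p.bypass := by rw [← h]; rfl
  rw [e]
  exact (p.edges_bypass_sublist_edges.map _).sum_le_of_nonneg (T.length_mem p)

end WeightedTree

/-- Positions of the vertices of a tree, such that parents come first, with parents and depths. -/
structure Rooting {nV : ℕ} (T : WeightedTree (Fin nV)) (pos : Fin nV → ℕ) (pp : ℕ → ℕ)
    (dep : ℕ → ℝ) : Prop where
  lt : ∀ v, pos v < nV
  inj : Function.Injective pos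
  surj : ∀ k < nV, ∃ v, pos v = k
  zero : pp 0 = 0
  parent_lt : ∀ k, 0 < k → k < nV → pp k < k
  parent : ∀ v, 0 < pos v → ∃ w, pos w = pp (pos v) ∧ T.graph.Adj v w ∧
    dep (pos v) = dep (pos w) + T.length s(v, w)

namespace Rooting

variable {nV : ℕ} {T : WeightedTree (Fin nV)} {pos : Fin nV → ℕ} {pp : ℕ → ℕ} {dep : ℕ → ℝ}

theorem dep_le (h : Rooting T pos pp dep) {k : ℕ} (hk : k < nV) : dep (pp k) ≤ dep k := by
  rcases Nat.eq_zero_or_pos k with rfl | hk0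
  · rw [h.zero]
  · obtain ⟨v, rfl⟩ := h.surj k hk
    obtain ⟨w, h1, h2, h3⟩ := h.parent v hk0
    have := T.length_nonneg s(v, w) h2
    rw [← h1]; linarith

theorem exists_walk (h : Rooting T pos pp dep) {a : ℕ} (v : Fin nV) (ha : Anc pp a (pos v)) :
    ∃ w, pos w = a ∧ ∃ p : T.graph.Walk v w, T.weight p = dep (pos v) - dep a := by
  obtain ⟨i, hi⟩ := ha
  induction i generalizing v with
  | zero => exact ⟨v, hi, .nil, by simp [WeightedTree.weight, show pos v = a from hi]⟩
  | succ i ih =>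
    rw [Function.iterate_succ_apply] at hi
    rcases Nat.eq_zero_or_pos (pos v) with h0 | h0
    · have e : pp (pos v) = pos v := by rw [h0, h.zero]
      exact ih v (e ▸ hi)
    · obtain ⟨w, h1, h2, h3⟩ := h.parent v h0
      obtain ⟨x, hx, p, hp⟩ := ih w (h1 ▸ hi)
      refine ⟨x, hx, .cons h2 p, ?_⟩
      simp only [WeightedTree.weight, SimpleGraph.Walk.edges_cons, List.map_cons,
        List.sum_cons] at hp ⊢
      rw [hp]; linarith

theorem dist_le (h : Rooting T pos pp dep) {a : ℕ} {x y : Fin nV} (hx : Anc pp a (pos x))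
    (hy : Anc pp a (pos y)) : T.dist x y ≤ dep (pos x) + dep (pos y) - dep a - dep a := by
  obtain ⟨w, hw, p, hp⟩ := h.exists_walk x hx
  obtain ⟨w', hw', q, hq⟩ := h.exists_walk y hy
  obtain rfl : w = w' := h.inj (hw.trans hw'.symm)
  refine (T.dist_le_weight (p.append q.reverse)).trans_eq ?_
  simp only [WeightedTree.weight, SimpleGraph.Walk.edges_append, SimpleGraph.Walk.edges_reverse,
    List.map_append, List.map_reverse, List.sum_append, List.sum_reverse] at hp hq ⊢
  rw [hp, hq]; ring

/-- Every vertex but the root contributes the edge to its parent. These edges are distinct, as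
parents come first, and there are `nV - 1` of them, so they are all edges of the tree. -/
theorem adj (h : Rooting T pos pp dep) {x y : Fin nV} (hxy : T.graph.Adj x y) :
    (0 < pos x ∧ pp (pos x) = pos y ∧ dep (pos x) = dep (pos y) + T.length s(x, y)) ∨
      (0 < pos y ∧ pp (pos y) = pos x ∧ dep (pos y) = dep (pos x) + T.length s(x, y)) := by
  classical
  have hpos : 0 < nV := (Nat.zero_le _).trans_lt x.2
  have hex : ∀ v, ∃ w, 0 < pos v → pos w = pp (pos v) ∧ T.graph.Adj v w ∧
      dep (pos v) = dep (pos w) + T.length s(v, w) := fun v => by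
    by_cases h0 : 0 < pos v
    · obtain ⟨w, hw⟩ := h.parent v h0
      exact ⟨w, fun _ => hw⟩
    · exact ⟨v, fun h => absurd h h0⟩
  choose par hpar using hex
  obtain ⟨r, hr⟩ := h.surj 0 hpos
  have hne : ∀ v, v ≠ r → 0 < pos v := fun v hv =>
    Nat.pos_of_ne_zero fun e => hv (h.inj (e.trans hr.symm))
  have himg : (Finset.univ.erase r).image (fun v => s(v, par v)) = T.graph.edgeFinset := by
    refine Finset.eq_of_subset_of_card_le (fun e he => ?_) ?_
    · obtain ⟨v, hv, rfl⟩ := Finset.mem_image.1 he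
      rw [SimpleGraph.mem_edgeFinset]
      exact (hpar v (hne v (Finset.ne_of_mem_erase hv))).2.1
    · rw [Finset.card_image_of_injOn, Finset.card_erase_of_mem (Finset.mem_univ _),
        Finset.card_univ, ← T.isTree.card_edgeFinset, Nat.add_sub_cancel]
      intro v hv w hw e
      have hv0 := hne v (Finset.ne_of_mem_erase (Finset.mem_coe.1 hv))
      have hw0 := hne w (Finset.ne_of_mem_erase (Finset.mem_coe.1 hw))
      rcases Sym2.eq_iff.1 e with e | e
      · exact e.1
      · have h1 := (hpar v hv0).1
        have h2 := (hpar w hw0).1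
        have h3 := h.parent_lt _ hv0 (h.lt v)
        have h4 := h.parent_lt _ hw0 (h.lt w)
        rw [e.2] at h1
        rw [← e.1] at h2
        omega
  have hm : s(x, y) ∈ T.graph.edgeFinset := SimpleGraph.mem_edgeFinset.2 hxy
  rw [← himg] at hm
  obtain ⟨v, hv, e⟩ := Finset.mem_image.1 hm
  have hv0 := hne v (Finset.ne_of_mem_erase hv)
  obtain ⟨h1, h2, h3⟩ := hpar v hv0
  rcases Sym2.eq_iff.1 e with ⟨rfl, e2⟩ | ⟨rfl, e2⟩
  · rw [e2] at h1 h3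
    exact .inl ⟨hv0, h1.symm, h3⟩
  · rw [e2] at h1 h3
    exact .inr ⟨hv0, h1.symm, by rw [Sym2.eq_swap]; exact h3⟩

/-- Induction on the walk, for arbitrary walks. The meeting point `a` of the rest of the walk can be
kept when its first vertex is prolonged, unless the step goes down from `x` to `z` and `a = z`; then
`x` takes its place. -/
theorem exists_anc_weight (h : Rooting T pos pp dep) {x y : Fin nV} (p : T.graph.Walk x y) :
    ∃ a < nV, Anc pp a (pos x) ∧ Anc pp a (pos y) ∧
      dep (pos x) + dep (pos y) - dep a - dep a ≤ T.weight p := by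
  induction p with
  | nil => exact ⟨_, h.lt _, .refl _, .refl _, by simp [WeightedTree.weight]⟩
  | @cons x z y hxz p ih =>
    obtain ⟨a, ha, h1, h2, h3⟩ := ih
    have hl := T.length_nonneg s(x, z) hxz
    have hw : T.weight (.cons hxz p) = T.length s(x, z) + T.weight p := by
      simp [WeightedTree.weight]
    rw [hw]
    rcases h.adj hxz with ⟨_, e1, e2⟩ | ⟨hz, e1, e2⟩
    · exact ⟨a, ha, Anc.step (e1 ▸ h1), h2, by linarith⟩
    · rcases h1.eq_or with rfl | h1
      · exact ⟨pos x, h.lt x, .refl _, (Anc.step (e1 ▸ .refl _)).trans h2, by linarith⟩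
      · exact ⟨a, ha, e1 ▸ h1, h2, by linarith⟩

/-- The two inequalities together replace any theory of lowest common ancestors: the walk through a
common ancestor bounds the distance above, and the path itself provides an ancestor for which
equality holds. -/
theorem exists_anc (h : Rooting T pos pp dep) (x y : Fin nV) :
    ∃ a < nV, Anc pp a (pos x) ∧ Anc pp a (pos y) ∧
      T.dist x y = dep (pos x) + dep (pos y) - dep a - dep a := by
  obtain ⟨p, _, hp⟩ := T.dist_eq (v := x) (w := y)
  obtain ⟨a, ha, h1, h2, h3⟩ := h.exists_anc_weight p
  exact ⟨a, ha, h1, h2, le_antisymm (h.dist_le h1 h2) (hp ▸ h3)⟩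

end Rooting

/-! ### The edge list of a tree in memory -/

theorem toArray_lt {α : Type*} [Zero α] {k : ℕ} (a : Fin k → α) (i : Fin k) :
    toArray a i = a i := by
  simp [toArray]

/-- The edge list of a weighted tree. -/
def EdgeList.edges {nV nE : ℕ} {T : WeightedTree (Fin nV)} (E : EdgeList T.graph nE) : Edges where
  nV := nV
  nE := nE
  src := toArray fun i => (E.src i : ℕ)
  dst := toArray fun i => (E.dst i : ℕ)
  len := toArray fun i => T.length s(E.src i, E.dst i)

namespace EdgeList

variable {nV nE : ℕ} {T : WeightedTree (Fin nV)} (E : EdgeList T.graph nE)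

theorem ends_lt (e : ℕ) (he : e < nE) : E.edges.src e < nV ∧ E.edges.dst e < nV := by
  have h1 := toArray_lt (fun i => (E.src i : ℕ)) ⟨e, he⟩
  have h2 := toArray_lt (fun i => (E.dst i : ℕ)) ⟨e, he⟩
  simp only at h1 h2
  simp only [edges, h1, h2]
  exact ⟨(E.src _).2, (E.dst _).2⟩

theorem joins_iff {x y : Fin nV} {e : ℕ} (he : e < nE) :
    E.edges.Joins e x y ↔ s(E.src ⟨e, he⟩, E.dst ⟨e, he⟩) = s(x, y) := by
  have h1 := toArray_lt (fun i => (E.src i : ℕ)) ⟨e, he⟩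
  have h2 := toArray_lt (fun i => (E.dst i : ℕ)) ⟨e, he⟩
  simp only at h1 h2
  simp only [Edges.Joins, edges, h1, h2, Sym2.eq_iff, Fin.ext_iff]

theorem exists_joins {x y : Fin nV} (h : T.graph.Adj x y) : ∃ e < nE, E.edges.Joins e x y := by
  have : s(x, y) ∈ Set.range fun i => s(E.src i, E.dst i) := by rw [E.range_eq]; exact h
  obtain ⟨i, hi⟩ := this
  exact ⟨i, i.2, (E.joins_iff i.2).2 hi⟩

theorem reach_walk {j : ℕ} {u v : Fin nV} (p : T.graph.Walk u v) (hu : E.edges.Reach j u) :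
    E.edges.Reach (j + p.length) v := by
  induction p generalizing j with
  | nil => exact hu
  | @cons u w v huw p ih =>
    obtain ⟨e, he, hj⟩ := E.exists_joins huw
    have := ih (j := j + 1) (.inr ⟨e, he, u, hu, hj⟩)
    rwa [SimpleGraph.Walk.length_cons, Nat.add_comm p.length, ← Nat.add_assoc]

theorem reach_mono {j k : ℕ} (hjk : j ≤ k) {v : ℕ} (h : E.edges.Reach j v) :
    E.edges.Reach k v := by
  induction hjk with
  | refl => exact h
  | step _ ih => exact .inl ih

theorem reach (v : ℕ) (hv : v < nV) : E.edges.Reach nV v := by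
  obtain ⟨p, hp⟩ := (T.isTree.existsUnique_path ⟨0, by omega⟩ ⟨v, hv⟩).exists
  have hl := hp.length_lt
  rw [Fintype.card_fin] at hl
  exact E.reach_mono (by omega) (E.reach_walk (j := 0) p rfl)

theorem card_eq (E : EdgeList T.graph nE) : nE + 1 = nV := by
  classical
  have h := T.isTree.card_edgeFinset
  rw [Fintype.card_fin] at h
  rw [← h]
  have : (Finset.univ.image fun i => s(E.src i, E.dst i)) = T.graph.edgeFinset := by
    ext e
    rw [SimpleGraph.mem_edgeFinset, ← E.range_eq]
    simp
  rw [← this, Finset.card_image_of_injective _ E.injective, Finset.card_univ, Fintype.card_fin]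

theorem rooting {vis vert pp : ℕ → ℕ} {dep : ℕ → ℝ} (h : E.edges.Explored vis vert pp dep nV)
    (ha : ∀ v < nV, vis v ≠ 0) : Rooting T (fun v => vis v - 1) pp dep := by
  refine ⟨fun v => (h.vis_ok v v.2 (ha v v.2)).1, fun v w e => ?_, fun k hk => ?_, h.pp_root,
    fun k h0 hk => (h.parent k h0 hk).1, fun v h0 => ?_⟩
  · have h1 := (h.vis_ok v v.2 (ha v v.2)).2
    have h2 := (h.vis_ok w w.2 (ha w w.2)).2
    have e : vis v - 1 = vis w - 1 := e
    rw [e, h2] at h1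
    exact Fin.ext h1.symm
  · obtain ⟨h1, h2⟩ := h.vert_ok k hk
    exact ⟨⟨vert k, h1⟩, by simp [h2]⟩
  · obtain ⟨hk, hv⟩ := h.vis_ok v v.2 (ha v v.2)
    obtain ⟨h1, e, he, h2, h3⟩ := h.parent _ h0 hk
    obtain ⟨h4, h5⟩ := h.vert_ok _ (h1.trans hk)
    have he : e < nE := he
    refine ⟨⟨vert (pp (vis v - 1)), h4⟩, by simp [h5], ?_⟩
    rw [hv] at h3
    have hs := (E.joins_iff (x := ⟨_, h4⟩) (y := v) he).1 h3
    have hmem : s(E.src ⟨e, he⟩, E.dst ⟨e, he⟩) ∈ T.graph.edgeSet := by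
      rw [← E.range_eq]; exact ⟨_, rfl⟩
    rw [hs, SimpleGraph.mem_edgeSet] at hmem
    refine ⟨hmem.symm, ?_⟩
    have hl : E.edges.len e = T.length s(E.src ⟨e, he⟩, E.dst ⟨e, he⟩) :=
      toArray_lt (fun i => T.length s(E.src i, E.dst i)) ⟨e, he⟩
    simp only [h5, Nat.add_sub_cancel]
    rw [h2, hl, hs, Sym2.eq_swap]

end EdgeList

/-! ### The algorithm -/

/-- The program that solves the problem. -/
def gather : Prog := prepare ;; search

theorem ncard_setOf_fin (n : ℕ) (p : ℕ → Prop) [DecidablePred p] :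
    {u : Fin n | p u}.ncard = ((Finset.range n).filter p).card := by
  rw [← Set.ncard_image_of_injective _ Fin.val_injective, ← Set.ncard_coe_finset]
  congr 1
  ext k
  simp only [Set.mem_image, Set.mem_ofPred_eq, Finset.coe_filter, Finset.mem_range]
  exact ⟨by rintro ⟨u, h, rfl⟩; exact ⟨u.2, h⟩, fun h => ⟨⟨k, h.1⟩, h.2, rfl⟩⟩

section Tree

variable {nV nU nF K : ℕ} {I : Instance (Fin nV) (Fin nU) (Fin nF)} {S : Scheme} {pp : ℕ → ℕ}
  {dep : ℕ → ℝ} {pos : Fin nV → ℕ}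

/-- The scheme describes the instance. -/
structure Describes (S : Scheme) (I : Instance (Fin nV) (Fin nU) (Fin nF)) (pos : Fin nV → ℕ)
    (pp : ℕ → ℕ) (dep : ℕ → ℝ) (K : ℕ) : Prop where
  nV_eq : S.nV = nV
  nU_eq : S.nU = nU
  nF_eq : S.nF = nF
  r_eq : S.r = I.r
  rooted : Rooted S.nV S.n pp
  rooting : Rooting I.tree pos pp dep
  scaled : ∀ k < S.nV + S.n, S.D k = K * dep k
  user : ∀ u : Fin nU, pp (nV + u) = pos (I.user u) ∧ dep (nV + u) = dep (pos (I.user u))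
  facility : ∀ f : Fin nF, pp (nV + (nU + f)) = pos (I.facility f) ∧
    dep (nV + (nU + f)) = dep (pos (I.facility f))
  K_pos : 0 < K

theorem Describes.exists_span (h : Describes S I pos pp dep K) (u : Fin nU) (f : Fin nF) :
    ∃ a < nV, Anc pp a (nV + u) ∧ Anc pp a (nV + (nU + f)) ∧
      I.tree.dist (I.user u) (I.facility f) = S.span dep a u f := by
  obtain ⟨a, ha, h1, h2, h3⟩ := h.rooting.exists_anc (I.user u) (I.facility f)
  refine ⟨a, ha, .step ((h.user u).1 ▸ h1), .step ((h.facility f).1 ▸ h2), ?_⟩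
  rw [h3, Scheme.span, h.nV_eq, h.nU_eq, (h.user u).2, (h.facility f).2]

theorem Describes.close_iff (h : Describes S I pos pp dep K) (u : Fin nU) (f : Fin nF) (β : ℝ) :
    S.Close pp (K * β) u (S.nU + f) ↔ I.tree.dist (I.user u) (I.facility f) ≤ β := by
  have hK : (0 : ℝ) < K := Nat.cast_pos.2 h.K_pos
  have hu := u.2
  have hf := f.2
  have hn : S.n = nU + nF := by simp only [Scheme.n, h.nU_eq, h.nF_eq]
  have hsc : ∀ a < nV, S.D (nV + u) + S.D (nV + (nU + f)) - S.D a - S.D a =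
      K * S.span dep a u f := fun a ha => by
    have := h.nV_eq
    rw [h.scaled _ (by omega), h.scaled _ (by omega), h.scaled a (by omega), Scheme.span, h.nV_eq,
      h.nU_eq]
    ring
  rw [Scheme.Close, h.nV_eq, h.nU_eq]
  constructor
  · rintro ⟨w, h1, h2, h3⟩
    have hR := h.rooted
    have e := h.nV_eq
    -- The node of an item is a leaf: if `w` were the node of `f`, it would be an ancestor of the
    -- node of `u`, which has a smaller number. So `w` is a vertex.
    have a2 : Anc pp w (pos (I.facility f)) := by
      rcases h2.eq_or with rfl | h2
      · have := hR.anc_le h1 (by omega)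
        omega
      · exact (h.facility f).1 ▸ h2
    have hw : w < nV := (hR.anc_le a2 (by have := h.rooting.lt (I.facility f); omega)).trans_lt
      (h.rooting.lt _)
    have a1 : Anc pp w (pos (I.user u)) := by
      rcases h1.eq_or with rfl | h1
      · omega
      · exact (h.user u).1 ▸ h1
    rw [hsc w hw] at h3
    refine (h.rooting.dist_le a1 a2).trans (le_trans (le_of_eq ?_) (le_of_mul_le_mul_left h3 hK))
    rw [Scheme.span, h.nV_eq, h.nU_eq, (h.user u).2, (h.facility f).2]
  · intro hd
    obtain ⟨a, ha, h1, h2, h3⟩ := h.exists_span u f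
    refine ⟨a, h1, h2, ?_⟩
    rw [hsc a ha, ← h3]
    exact mul_le_mul_of_nonneg_left hd hK.le

theorem Solution.dist_le_cost (R : Solution I) (u : Fin nU) :
    I.tree.dist (I.user u) (I.facility (R.assign u)) ≤ R.cost :=
  le_ciSup (f := fun u => I.tree.dist (I.user u) (I.facility (R.assign u)))
    (Set.finite_range _).bddAbove u

theorem Solution.exists_cost_eq (R : Solution I) (hU : 0 < nU) :
    ∃ u, I.tree.dist (I.user u) (I.facility (R.assign u)) = R.cost := by
  have : Nonempty (Fin nU) := ⟨⟨0, hU⟩⟩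
  exact exists_eq_ciSup_of_finite (f := fun u => I.tree.dist (I.user u) (I.facility (R.assign u)))

/-- The cost is attained at some user, hence is a distance from a user to a facility, hence the span
of one of the finitely many triples that are tried. -/
theorem Describes.solvable (h : Describes S I pos pp dep K) (hU : 0 < nU) (R : Solution I) :
    ∃ a < nV, ∃ u < nU, ∃ f < nF, S.span dep a u f = R.cost ∧
      S.Solvable pp K (S.span dep a u f) := by
  obtain ⟨u, hu⟩ := R.exists_cost_eq hU
  obtain ⟨a, ha, _, _, h3⟩ := h.exists_span u (R.assign u)
  refine ⟨a, ha, u, u.2, R.assign u, (R.assign u).2, h3 ▸ hu, ?_, ?_⟩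
  · rw [← h3]; exact I.tree.dist_nonneg _ _
  rw [← h3, hu]
  have hσ : ∀ v : Fin nU, toArray (fun v => (R.assign v : ℕ)) v = R.assign v := toArray_lt _
  refine ⟨toArray fun v => (R.assign v : ℕ), fun v hv => ?_, fun v hv => ?_, fun f hf => ?_⟩
  · rw [h.nU_eq] at hv
    rw [hσ ⟨v, hv⟩, h.nF_eq]
    exact (R.assign _).2
  · rw [h.nU_eq] at hv
    have := (h.close_iff ⟨v, hv⟩ (R.assign ⟨v, hv⟩) R.cost).2 (R.dist_le_cost _)
    rwa [← hσ] at this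
  · rw [h.nF_eq] at hf
    rw [h.nU_eq, h.r_eq, ← ncard_setOf_fin]
    have e : {v : Fin nU | toArray (fun v => (R.assign v : ℕ)) v = f} =
        {v | R.assign v = ⟨f, hf⟩} := by
      ext v
      simp only [Set.mem_ofPred_eq, hσ, Fin.ext_iff]
    rw [e]
    by_cases ho : (⟨f, hf⟩ : Fin nF) ∈ R.opened
    · exact .inr (R.r_le _ ho)
    · refine .inl ?_
      rw [Set.ncard_eq_zero, Set.eq_empty_iff_forall_notMem]
      exact fun v hv => ho (hv ▸ R.assign_mem v)

/-- Opening exactly the facilities that receive a user excludes the alternative of an empty load. -/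
theorem Describes.exists_solution (h : Describes S I pos pp dep K) (hU : 0 < nU) {β : ℝ} {σ : ℕ → ℕ}
    (hσ : S.Sol pp (K * β) σ) {s : Store} (hw : s.Writes S.nU S.nF σ) :
    ∃ R : Solution I, s.Outputs R ∧ R.cost ≤ β := by
  have hU' := h.nU_eq
  have hlt : ∀ u : Fin nU, σ u < nF := fun u => by
    rw [← h.nF_eq]; exact hσ.lt u (by have := u.2; omega)
  let R : Solution I :=
    { opened := Set.range fun u : Fin nU => (⟨σ u, hlt u⟩ : Fin nF)
      assign := fun u => ⟨σ u, hlt u⟩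
      assign_mem := fun u => ⟨u, rfl⟩
      r_le := by
        rintro _ ⟨u, rfl⟩
        have e : {v : Fin nU | (⟨σ v, hlt v⟩ : Fin nF) = ⟨σ u, hlt u⟩} =
            {v : Fin nU | σ v = σ u} := by
          ext v; simp
        rw [e, ncard_setOf_fin nU fun v => σ v = σ u]
        have hl := hσ.load (σ u) (by rw [h.nF_eq]; exact hlt u)
        rw [h.nU_eq, h.r_eq] at hl
        refine hl.resolve_left fun h0 => ?_
        rw [Finset.card_eq_zero] at h0
        have hm : (u : ℕ) ∈ (Finset.range nU).filter fun v => σ v = σ u := by simp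
        rw [h0] at hm
        simp at hm }
  refine ⟨R, ⟨fun u => hw.1 u (by have := u.2; omega), fun f => ?_⟩, ?_⟩
  · have hf := hw.2 f (by rw [h.nF_eq]; exact f.2)
    have e : f ∈ R.opened ↔ ∃ u < S.nU, σ u = f := by
      constructor
      · rintro ⟨u, rfl⟩
        exact ⟨u, by have := u.2; omega, rfl⟩
      · rintro ⟨u, hu, e⟩
        exact ⟨⟨u, by omega⟩, Fin.ext e⟩
    rw [e]
    exact hf
  · have : Nonempty (Fin nU) := ⟨⟨0, hU⟩⟩
    refine ciSup_le fun u => (h.close_iff u (R.assign u) β).1 (hσ.close u ?_)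
    have := u.2; omega

end Tree

/-- The bound for the running time. -/
theorem size_bounds {nV nU nF K : ℕ} (hV : 0 < nV) (hU : 0 < nU) (hF : 0 < nF) :
    let Z := nV * (nU + nF) ^ (4 * (K + 3) + 3)
    16 ≤ Z ∧ nV + (nU + nF) ≤ Z ∧ K ≤ Z ∧
      2 * (nV + (nU + nF)) * ((nU + nF) * nU + 1) ^ (2 * (K + 3)) ≤ Z := by
  intro Z
  set n := nU + nF with hn
  have hn2 : 2 ≤ n := by omega
  have hm : 2 ≤ 4 * (K + 3) + 3 := by omega
  have h1 : (n * nU + 1) ^ (2 * (K + 3)) ≤ n ^ (4 * (K + 3)) := by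
    -- There is at least one facility, so `nU + 1 ≤ n`.
    have : n * nU + 1 ≤ n ^ 2 := by
      have h : n * (nU + 1) ≤ n * n := Nat.mul_le_mul_left _ (by omega)
      rw [pow_two]
      have : n * (nU + 1) = n * nU + n := by ring
      omega
    calc _ ≤ (n ^ 2) ^ (2 * (K + 3)) := Nat.pow_le_pow_left this _
      _ = _ := by rw [← pow_mul]; congr 1; ring
  have h2 : 2 * (nV + n) ≤ nV * n ^ 3 := by
    have a : nV + n ≤ nV * n + 1 := by
      obtain ⟨v, rfl⟩ := Nat.exists_eq_add_of_lt hV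
      obtain ⟨m, hm⟩ := Nat.exists_eq_add_of_le hn2
      rw [hm]; ring_nf; nlinarith [Nat.zero_le (v * m)]
    have b : 1 ≤ nV * n := Nat.mul_pos hV (by omega)
    have c : 4 * (nV * n) ≤ nV * n ^ 3 := by
      have : 4 ≤ n * n := Nat.mul_le_mul hn2 hn2
      calc 4 * (nV * n) ≤ (n * n) * (nV * n) := Nat.mul_le_mul_right _ this
        _ = _ := by ring
    omega
  have h3 : 2 * (nV + n) * (n * nU + 1) ^ (2 * (K + 3)) ≤ Z := by
    calc _ ≤ nV * n ^ 3 * n ^ (4 * (K + 3)) := Nat.mul_le_mul h2 h1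
      _ = _ := by simp only [Z]; ring
  have h4 : n ^ (4 * (K + 3) + 3) ≤ Z := Nat.le_mul_of_pos_left _ hV
  have h5 : (2 : ℕ) ^ (4 * (K + 3) + 3) ≤ n ^ (4 * (K + 3) + 3) := Nat.pow_le_pow_left hn2 _
  have h6 : (2 : ℕ) ^ 4 ≤ 2 ^ (4 * (K + 3) + 3) := Nat.pow_le_pow_right (by omega) (by omega)
  have h7 : 4 * (K + 3) + 3 < 2 ^ (4 * (K + 3) + 3) := Nat.lt_two_pow_self
  refine ⟨by omega, ?_, by omega, h3⟩
  have h8 : 1 ≤ (n * nU + 1) ^ (2 * (K + 3)) := Nat.one_le_pow _ _ (by omega)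
  have h9 := Nat.mul_le_mul_left (2 * (nV + n)) h8
  omega

/-- From `K ≤ 4/ε + 1` one gets `30 * (4 * (K + 3) + 3) ≤ 480/ε + 570`, which is at most `1050 * max
1 (1/ε)`. -/
theorem time_bound {nV n K : ℕ} {ε : ℝ} (hV : 0 < nV) (hn : 0 < n) (hε : 0 < ε)
    (hK : K = ⌊4 / ε⌋₊ + 1) :
    (((nV * n ^ (4 * (K + 3) + 3)) ^ 30 : ℕ) : ℝ) ≤
      (nV : ℝ) ^ 1050 * (n : ℝ) ^ (((1050 : ℕ) : ℝ) * max 1 (1 / ε)) := by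
  have hV1 : (1 : ℝ) ≤ nV := by exact_mod_cast hV
  have hn1 : (1 : ℝ) ≤ n := by exact_mod_cast hn
  have hf : (⌊4 / ε⌋₊ : ℝ) ≤ 4 / ε := Nat.floor_le (by positivity)
  have h1 : (1 : ℝ) ≤ max 1 (1 / ε) := le_max_left _ _
  have h2 : 1 / ε ≤ max 1 (1 / ε) := le_max_right _ _
  have h3 : 4 / ε = 4 * (1 / ε) := by ring
  push_cast
  rw [mul_pow, ← pow_mul]
  refine mul_le_mul (pow_le_pow_right₀ hV1 (by norm_num)) ?_ (by positivity) (by positivity)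
  rw [← Real.rpow_natCast]
  refine Real.rpow_le_rpow_of_exponent_le hn1 ?_
  rw [hK]
  push_cast
  linarith

theorem gather_spec {nV nE nU nF : ℕ} (I : Instance (Fin nV) (Fin nU) (Fin nF))
    (E : EdgeList I.tree.graph nE) {ε : ℝ} (hε : 0 < ε) (hU : 0 < nU) (hI : Nonempty (Solution I))
    {K : ℕ} (hK : K = ⌊4 / ε⌋₊ + 1) :
    WP gather (input I E ε) ((nV * (nU + nF) ^ (4 * (K + 3) + 3)) ^ 30) fun s =>
      ∃ R : Solution I, s.Outputs R ∧ R.cost ≤ (1 + ε) * I.opt := by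
  have hV : 0 < nV := (Nat.zero_le _).trans_lt (I.user ⟨0, hU⟩).2
  have hF : 0 < nF := (Nat.zero_le _).trans_lt (hI.some.assign ⟨0, hU⟩).2
  obtain ⟨hZ, hN, hKZ, hpool⟩ := size_bounds (K := K) hV hU hF
  set Z := nV * (nU + nF) ^ (4 * (K + 3) + 3) with hZdef
  have hc := E.card_eq
  have hG : E.edges.Mem (input I E ε) := ⟨rfl, rfl, rfl, rfl, rfl⟩
  have h3 : ∀ u : Fin nU, (input I E ε).nat 3 u = I.user u :=
    toArray_lt fun u => (I.user u : ℕ)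
  have h4 : ∀ f : Fin nF, (input I E ε).nat 4 f = I.facility f :=
    toArray_lt fun f => (I.facility f : ℕ)
  have hpow : Z ^ 8 ≤ Z ^ 29 := Nat.pow_le_pow_right (by omega) (by omega)
  have hpow' : 16 * Z ^ 29 ≤ Z ^ 30 := mul_pow_le hZ 29
  refine (WP.seq (T₂ := Z ^ 29) (prepare_spec (G := E.edges) (nU := nU) (nF := nF) hZ hN
    (show nE ≤ Z by omega) (by omega) hG rfl rfl hV E.ends_lt E.reach
    (fun u hu => by rw [h3 ⟨u, hu⟩]; exact (I.user _).2)
    (fun f hf => by rw [h4 ⟨f, hf⟩]; exact (I.facility _).2) hε rfl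
    (fun A hA i => ?_) (fun A hA i => ?_)) fun s fr h => ?_).mono (by omega) fun _ _ h => h
  · obtain ⟨k, rfl⟩ := Nat.exists_eq_add_of_le' hA; rfl
  · obtain ⟨k, rfl⟩ := Nat.exists_eq_add_of_le' hA; rfl
  obtain ⟨h7, hL⟩ := h
  rw [← hK] at hL
  set loc : ℕ → ℕ := fun x => if x < nU then (input I E ε).nat 3 x else
    (input I E ε).nat 4 (x - nU) with hloc
  have hlocU : ∀ u : Fin nU, loc u = I.user u := fun u => by simp [hloc, h3]
  have hlocF : ∀ f : Fin nF, loc (nU + f) = I.facility f := fun f => by simp [hloc, h4]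
  have hR := hL.explored.rooted hL.all (n := nU + nF) (loc := loc) (fun x hx => by
    by_cases h : x < nU
    · rw [hlocU ⟨x, h⟩]; exact (I.user _).2
    · obtain ⟨f, rfl⟩ := Nat.exists_eq_add_of_le (not_lt.1 h)
      rw [hlocF ⟨f, by omega⟩]; exact (I.facility _).2) hL.pp_item
  have hroot : Rooting I.tree _ _ _ := E.rooting hL.explored hL.all
  let S : Scheme :=
    { nV := nV, nU := nU, nF := nF, r := I.r, cid := s.nat aCid, mate := s.nat aMate
      out := s.nat aOut, top := s.nat aTop, D := s.real rD, b := s.real rb 0, B := s.real rB 0 }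
  have hD : Describes S I (fun v => s.nat 10 v - 1) (s.nat 12) (s.real 2) K := by
    refine ⟨rfl, rfl, rfl, rfl, hR, hroot, hL.scaled, fun u => ?_, fun f => ?_, by omega⟩
    · rw [← hlocU u]
      have hu : (u : ℕ) < nU + nF := by have := u.2; omega
      exact ⟨hL.pp_item _ hu, hL.dep_item _ hu⟩
    · rw [← hlocF f]
      have hf : nU + (f : ℕ) < nU + nF := by have := f.2; omega
      exact ⟨hL.pp_item _ hf, hL.dep_item _ hf⟩
  have hready : Ready S (s.nat 12) (s.real 2) K Z s := by
    have e0 := fr.nat 0 rfl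
    refine ⟨⟨by rw [e0]; rfl, by rw [e0]; rfl, by rw [e0]; rfl, by rw [e0]; rfl, h7, rfl, rfl, rfl,
      rfl, rfl, rfl, rfl⟩, rfl, hR, hL.plan, fun k hk => ?_, hL.scaled, ?_, hZ, ?_, ?_, ?_, ?_, hpool⟩
    · rcases lt_or_ge k nV with hv | hv
      · exact hroot.dep_le hv
      · obtain ⟨x, rfl⟩ := Nat.exists_eq_add_of_le hv
        have hx : x < nU + nF := Nat.lt_of_add_lt_add_left hk
        have e1 : s.nat 12 (nV + x) = s.nat 10 (loc x) - 1 := hL.pp_item x hx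
        rw [e1]
        exact (hL.dep_item x hx).ge
    all_goals
      simp only [S, Scheme.n]
      omega
  refine (search_spec hready (by rw [fr.nat 30 rfl]; rfl)).mono le_rfl fun s' _ hb => ?_
  -- The instance has a solution, and the triple belonging to its cost is solvable, so the search
  -- cannot have failed.
  have hfound : 1 ≤ s'.nat 30 0 ∧ 0 ≤ s'.real 6 0 ∧
      (∃ σ, S.Sol (s.nat 12) (K * s'.real 6 0 + 4 * s'.real 6 0) σ ∧ s'.Writes S.nU S.nF σ) ∧
      ∀ R : Solution I, s'.real 6 0 ≤ R.cost := by
    rcases hb with hb | hb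
    · obtain ⟨a, ha, u, hu, f, hf, _, h2⟩ := hD.solvable hU hI.some
      exact absurd h2 (hb.2 a u f ⟨ha, hu, hf⟩)
    · refine ⟨hb.1, hb.2.1, hb.2.2.1, fun R => ?_⟩
      obtain ⟨a, ha, u, hu, f, hf, h1, h2⟩ := hD.solvable hU R
      rw [← h1]
      exact hb.2.2.2 a u f ⟨ha, hu, hf⟩ h2
  obtain ⟨_, h0, ⟨σ, hσ, hw⟩, hle⟩ := hfound
  set b := s'.real 6 0
  have hK0 : (0 : ℝ) < K := by rw [hK]; positivity
  -- Scaled back by `K`, the additive error `4 * b` is the relative error `4 / K`.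
  have e : (K : ℝ) * b + 4 * b = K * ((1 + 4 / K) * b) := by field_simp
  rw [e] at hσ
  obtain ⟨R, hR1, hR2⟩ := hD.exists_solution hU hσ hw
  -- The record is a lower bound for all costs, so it is not needed that the infimum is attained.
  have hopt : b ≤ I.opt := le_ciInf hle
  refine ⟨R, hR1, hR2.trans (mul_le_mul ?_ hopt h0 (by linarith))⟩
  have h4K : 4 / ε < K := by rw [hK]; push_cast; exact Nat.lt_floor_add_one _
  rw [div_lt_iff₀ hε] at h4K
  have : 4 / (K : ℝ) ≤ ε := by rw [div_le_iff₀ hK0]; linarith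
  linarith

end RGathering

theorem mainTheorem1 :
    ∃ (P : RGathering.Prog) (C : ℕ), ∀ (nV nE nU nF : ℕ)
      (I : RGathering.Instance (Fin nV) (Fin nU) (Fin nF))
      (E : RGathering.EdgeList I.tree.graph nE) (ε : ℝ),
      0 < ε → 0 < nU → Nonempty (RGathering.Solution I) →
        ∃ (steps : ℕ) (s : RGathering.Store) (S : RGathering.Solution I),
          RGathering.Exec P (RGathering.input I E ε) steps s ∧
          s.Outputs S ∧
          S.cost ≤ (1 + ε) * I.opt ∧
          (steps : ℝ) ≤ (nV : ℝ) ^ C * ((nU : ℝ) + (nF : ℝ)) ^ ((C : ℝ) * max 1 (1 / ε)) := by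
  refine ⟨RGathering.gather, 1050, fun nV nE nU nF I E ε hε hU hI => ?_⟩
  obtain ⟨steps, s, he, hsteps, S, hout, hcost⟩ := RGathering.gather_spec I E hε hU hI rfl
  have hV : 0 < nV := (Nat.zero_le _).trans_lt (I.user ⟨0, hU⟩).2
  refine ⟨steps, s, S, he, hout, hcost, (Nat.cast_le.2 hsteps).trans ?_⟩
  have := RGathering.time_bound (n := nU + nF) hV (by omega) hε rfl
  rwa [Nat.cast_add] at this
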